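/- For a Young diagram $\mu$ with $N$ boxes let $d_\mu$ be the number of standard Young tableaux of shape $\mu$ and let $l^{(k)}(\mu)$ be the number of boxes in its $k$-th row ($k\ge 1$). For $n,N\ge 0$ set $$q^{(k)}_{n,N}=\frac1{N!}\sum_{\mu\vdash N,\ l^{(k)}(\mu)\le n} d_\mu^2$$ (the probability that $l^{(k)}\le n$ under Plancherel measure; in particular $q^{(k)}_{n,0}=1$), and for $\lambda\ge 0$ let $$\phi^{(k)}_n(\lambda)=\sum_{N=0}^\infty \frac{e^{-\lambda}\lambda^N}{N!}\,q^{(k)}_{n,N}.$$ Let $\Sigma$ be the unit circle in $\mathbb C$, oriented counterclockwise, let $\varphi(z)=e^{\sqrt\lambda\,(z-z^{-1})}$, and let $\mathcal K_n$ be the integral operator on $L^2(\Sigma,|dw|)$, $$(\mathcal K_nf)(z)=\int_\Sigma \mathcal K_n(z,w)f(w)\,dw,\qquad \mathcal K_n(z,w)=\frac{z^{-n}w^n-\varphi(z)\varphi(w)^{-1}}{2\pi i(z-w)}.$$ Then, for every integer $n\ge 0$ and every real $\lambda\ge 0$, $\mathcal K_n$ is a well-defined trace class operator (so that the Fredholm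 determinants $\det(I-c\,\mathcal K_n)$, $c\in\mathbb C$, exist), and $$\phi^{(1)}_n(\lambda)=2^{-n}\det(I-\mathcal K_n).$$ Moreover $t\mapsto(1+\sqrt t)^{-n}\det(I-\sqrt t\,\mathcal K_n)$ is differentiable at $t=1$, and $$\phi^{(2)}_{n+1}(\lambda)=\phi^{(1)}_n(\lambda)+\Bigl(-\frac{\partial}{\partial t}\Bigr)\Bigr|_{t=1}\Bigl[(1+\sqrt t)^{-n}\det(I-\sqrt t\,\mathcal K_n)\Bigr].$$ -/

import Mathlib

noncomputable section

namespace PlancherelRows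

open MeasureTheory Filter Topology

/-! ### Plancherel measure on Young diagrams -/

/-- A standard Young tableau of shape `μ`: a bijective filling of the boxes of `μ` by `μ.card`
consecutive integers (here `0, …, μ.card - 1`) that increases along every row and every column. -/
structure StandardYoungTableau (μ : YoungDiagram) where
  entry : μ.cells ≃ Fin μ.card
  row_strict : ∀ a b : μ.cells, a.1.1 = b.1.1 → a.1.2 < b.1.2 → entry a < entry b
  col_strict : ∀ a b : μ.cells, a.1.2 = b.1.2 → a.1.1 < b.1.1 → entry a < entry b

/-- `d_μ`, the number of standard Young tableaux of shape `μ`. -/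
def numSYT (μ : YoungDiagram) : ℕ := Nat.card (StandardYoungTableau μ)

theorem finite_youngDiagrams (N : ℕ) : {μ : YoungDiagram | μ.card = N}.Finite := by
  have hfin : ((Finset.range N ×ˢ Finset.range N).powerset : Set (Finset (ℕ × ℕ))).Finite :=
    Finset.finite_toSet _
  refine Set.Finite.of_finite_image (f := YoungDiagram.cells) (hfin.subset ?_) ?_
  · rintro _ ⟨μ, hμ, rfl⟩
    simp only [Set.mem_ofPred_eq] at hμ
    simp only [Finset.coe_powerset, Set.mem_preimage, Set.mem_powerset_iff, Finset.coe_subset]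
    rintro ⟨i, j⟩ hc
    rw [YoungDiagram.mem_cells] at hc
    have hj : j < μ.rowLen i := YoungDiagram.mem_iff_lt_rowLen.1 hc
    have hi : i < μ.colLen j := YoungDiagram.mem_iff_lt_colLen.1 hc
    have h1 : μ.rowLen i ≤ μ.card := by
      rw [YoungDiagram.rowLen_eq_card]; exact Finset.card_le_card (Finset.filter_subset _ _)
    have h2 : μ.colLen j ≤ μ.card := by
      rw [YoungDiagram.colLen_eq_card]; exact Finset.card_le_card (Finset.filter_subset _ _)
    simp only [Finset.mem_product, Finset.mem_range]
    omega
  · intro μ _ ν _ h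
    exact YoungDiagram.ext h

/-- The Young diagrams with `N` boxes. -/
def youngDiagrams (N : ℕ) : Finset YoungDiagram := (finite_youngDiagrams N).toFinset

/-- `q^{(k)}_{n,N}`: the probability under Plancherel measure (weight `d_μ² / N!`) on the Young
diagrams with `N` boxes that the `k`-th row, `k ≥ 1`, has at most `n` boxes. (Mathlib numbers the
rows from `0`.) For `N = 0` only the empty diagram occurs and the value is `1`. -/
def rowProb (k n N : ℕ) : ℝ :=
  (1 / (N.factorial : ℝ)) *
    ∑ μ ∈ (youngDiagrams N).filter (fun μ => μ.rowLen (k - 1) ≤ n), (numSYT μ : ℝ) ^ 2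

/-- `φ^{(k)}_n(lam)`, the Poissonization of `q^{(k)}_{n,N}`. -/
def poissonRow (k n : ℕ) (lam : ℝ) : ℝ :=
  ∑' N : ℕ, Real.exp (-lam) * lam ^ N / (N.factorial : ℝ) * rowProb k n N

/-! ### Trace class operators and Fredholm determinants -/

section Fredholm

variable {H : Type} [NormedAddCommGroup H] [InnerProductSpace ℂ H]

/-- `T` is trace class (nuclear): `T = ∑ ⟨y i, ·⟩ x i` with `∑ ‖x i‖ ‖y i‖ < ∞`. -/
def IsTraceClass (T : H →L[ℂ] H) : Prop :=
  ∃ x y : ℕ → H, Summable (fun i => ‖x i‖ * ‖y i‖) ∧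
    ∀ v : H, HasSum (fun i => inner ℂ (y i) v • x i) (T v)

open Classical in
/-- The determinant of the finite section of `I - T` on the span of `b i`, `i ∈ s`. -/
def sectionDet {ι : Type} (b : HilbertBasis ι ℂ H) (T : H →L[ℂ] H) (s : Finset ι) : ℂ :=
  Matrix.det (1 - Matrix.of fun i j : s => inner ℂ (b i) (T (b j)))

/-- `det (I - T) = d`: in every orthonormal basis the determinants of the finite sections of
`I - T` converge to `d`. For trace class `T` on a Hilbert space there is exactly one such `d`. -/
def HasFredholmDet (T : H →L[ℂ] H) (d : ℂ) : Prop :=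
  ∀ (ι : Type) (b : HilbertBasis ι ℂ H), Tendsto (sectionDet b T) atTop (𝓝 d)

open Classical in
/-- The Fredholm determinant `det (I - T)` (with value `0` if it does not exist). -/
def fredholmDet (T : H →L[ℂ] H) : ℂ :=
  if h : ∃ d, HasFredholmDet T d then h.choose else 0

end Fredholm

/-! ### The integral operator on the unit circle -/

/-- The unit circle, parametrized by the angle modulo `2π`; its volume measure is arc length. -/
abbrev Angle : Type := AddCircle (2 * Real.pi)

instance fact_two_pi_pos : Fact (0 < 2 * Real.pi) := ⟨Real.two_pi_pos⟩

/-- The point `e^{iθ}` of the unit circle. -/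
def pt (θ : Angle) : ℂ := (AddCircle.toCircle θ : ℂ)

/-- `L²` of the unit circle with respect to arc length. -/
abbrev L2Circle : Type := Lp ℂ 2 (volume : Measure Angle)

/-- `φ(z) = exp (√lam (z - 1/z))`. -/
def symbolFn (lam : ℝ) (z : ℂ) : ℂ := Complex.exp ((Real.sqrt lam : ℂ) * (z - z⁻¹))

/-- `K_n(z, w) = (z^{-n} w^n - φ(z) φ(w)^{-1}) / (2πi (z - w))`. The diagonal is a null set, so the
value there plays no role for the integral operator. -/
def kernel (lam : ℝ) (n : ℕ) (z w : ℂ) : ℂ :=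
  (z ^ (-(n : ℤ)) * w ^ n - symbolFn lam z * (symbolFn lam w)⁻¹) /
    (2 * (Real.pi : ℂ) * Complex.I * (z - w))

/-- `K` is the integral operator `(K f)(z) = ∫ k(z, w) f(w) dw` on `L²` of the unit circle, where
`dw` is the complex line element: `w = e^{iθ}`, `dw = i w dθ`. -/
def IsIntegralOperator (k : ℂ → ℂ → ℂ) (K : L2Circle →L[ℂ] L2Circle) : Prop :=
  ∀ f : L2Circle, ∀ᵐ θ : Angle,
    K f θ = ∫ η : Angle, k (pt θ) (pt η) * f η * (Complex.I * pt η)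

end PlancherelRows

end

/-!
Put `u = √lam`. The operator `K_n` is the orthogonal projection onto the closed span of the
functions `exp (-u / z) z ^ j`, `j ≥ 0`, minus the orthogonal projection onto the closed span of the
monomials `z ^ k`, `k ≥ -n`. Cutting both spans off at degree `M` gives differences `Q - R` of
finite rank projections that converge to `K_n` in trace norm, so that their Fredholm determinants
converge too.

For finite rank projections, `det (I - c (Q - R))` is a determinant of inner products. In the basis
of monomials it equals `(1 + c) ^ n` times the quotient by its value at `t = 0` of the `M × M`
determinant with entries `∑ y, w(y) u ^ (2 y - i - j) / ((y - i)! (y - j)!)`, where `t = c ^ 2` and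
the weight `w(y)` is `1 - t` for `y ≥ M + n` and `1` otherwise. Andréief's identity expands this
determinant into a sum over increasing sequences `y`, that is, over Young diagrams `μ` with at most
`M` rows; since `det (1 / (y_r - i)!) = d_μ / |μ|!`, the limit `M → ∞` gives
`(1 + √t) ^ (-n) det (I - √t K_n) = E[(1 - t) ^ #{r ≥ 1 | μ_r - r ≥ n}]` under the Poissonized
Plancherel measure.

The exponent vanishes exactly when the first row has at most `n` boxes and is at most `1` exactly
when the second row has at most `n + 1` boxes. Hence the value at `t = 1` and the derivative there
express the distributions of the first two rows.
-/

noncomputable section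

namespace PlancherelRows

open MeasureTheory Filter Topology

/-! ### Hadamard's inequality -/

section Hadamard

open scoped ComplexOrder

variable {𝕜 : Type*} [RCLike 𝕜] {n : Type*} [Fintype n] [DecidableEq n]
variable {E : Type*} [NormedAddCommGroup E] [InnerProductSpace 𝕜 E]

theorem norm_det_gram_le_one {v : n → E} (hv : ∀ i, ‖v i‖ = 1) :
    ‖(Matrix.gram 𝕜 v).det‖ ≤ 1 := by
  have hpsd := Matrix.posSemidef_gram 𝕜 v
  have hherm := hpsd.isHermitian
  have htrace : ∑ i, hherm.eigenvalues i = Fintype.card n := by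
    have h : (Matrix.gram 𝕜 v).trace = Fintype.card n := by
      simp [Matrix.trace, Matrix.gram_apply, inner_self_eq_norm_sq_to_K, hv]
    rw [hherm.trace_eq_sum_eigenvalues] at h
    exact_mod_cast h
  rw [hherm.det_eq_prod_eigenvalues, norm_prod]
  calc ∏ i, ‖(hherm.eigenvalues i : 𝕜)‖
      ≤ ∏ i, Real.exp (hherm.eigenvalues i - 1) := by
        refine Finset.prod_le_prod (fun _ _ => norm_nonneg _) fun i _ => ?_
        rw [RCLike.norm_ofReal, abs_of_nonneg (hpsd.eigenvalues_nonneg i)]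
        simpa using Real.add_one_le_exp (hherm.eigenvalues i - 1)
    _ = 1 := by
        rw [← Real.exp_sum, Finset.sum_sub_distrib, htrace]
        simp

theorem norm_det_repr_le (b : OrthonormalBasis n 𝕜 E) (v : n → E) :
    ‖(Matrix.of fun i j => b.repr (v j) i).det‖ ≤ ∏ i, ‖v i‖ := by
  by_cases hzero : ∃ i, v i = 0
  · obtain ⟨i, hi⟩ := hzero
    rw [Matrix.det_eq_zero_of_column_eq_zero i (by intro j; simp [hi]), norm_zero]
    positivity
  push Not at hzero
  set w : n → E := fun i => (‖v i‖⁻¹ : 𝕜) • v i with hw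
  have hw_norm (i) : ‖w i‖ = 1 := by
    have := norm_ne_zero_iff.2 (hzero i)
    simp [hw, norm_smul, this]
  have hw_det : ‖(Matrix.of fun i j => b.repr (w j) i).det‖ ≤ 1 := by
    have h := norm_det_gram_le_one (𝕜 := 𝕜) hw_norm
    rw [Matrix.gram_eq_conjTranspose_mul b w, Matrix.det_mul, Matrix.det_conjTranspose, norm_mul,
      norm_star] at h
    nlinarith [norm_nonneg (Matrix.of fun i j => b.repr (w j) i).det]
  have hvw : (Matrix.of fun i j => b.repr (v j) i) =
      Matrix.of fun i j => (‖v j‖ : 𝕜) * (Matrix.of fun i j => b.repr (w j) i) i j := by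
    ext i j
    have : (‖v j‖ : 𝕜) ≠ 0 := by simpa using hzero j
    simp [hw, this]
  rw [hvw, Matrix.det_mul_row, norm_mul, norm_prod]
  simpa using mul_le_of_le_one_right (by positivity) hw_det

theorem det_inner_eq_zero_of_not_linearIndependent {x : n → E}
    (hx : ¬LinearIndependent 𝕜 x) (y : n → E) :
    (Matrix.of fun i j => inner 𝕜 (y i) (x j)).det = 0 := by
  rw [Fintype.linearIndependent_iff] at hx
  push Not at hx
  obtain ⟨c, hc, i, hi⟩ := hx
  refine Matrix.exists_mulVec_eq_zero_iff.1 ⟨c, fun h => hi (by rw [h]; rfl), ?_⟩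
  ext k
  have : inner 𝕜 (y k) (∑ j, c j • x j) = 0 := by rw [hc, inner_zero_right]
  simpa [Matrix.mulVec, dotProduct, inner_sum, inner_smul_right, mul_comm] using this

theorem norm_det_inner_le (x y : n → E) :
    ‖(Matrix.of fun i j => inner 𝕜 (y i) (x j)).det‖ ≤ ∏ i, ‖x i‖ * ‖y i‖ := by
  by_cases hx : LinearIndependent 𝕜 x
  swap
  · rw [det_inner_eq_zero_of_not_linearIndependent hx, norm_zero]
    positivity
  let V := Submodule.span 𝕜 (Set.range x)
  have : FiniteDimensional 𝕜 V := FiniteDimensional.span_of_finite 𝕜 (Set.finite_range x)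
  have hV : Module.finrank 𝕜 V = Fintype.card n := finrank_span_eq_card hx
  let b : OrthonormalBasis n 𝕜 V :=
    (stdOrthonormalBasis 𝕜 V).reindex ((finCongr hV).trans (Fintype.equivFin n).symm)
  let x' : n → V := fun i => ⟨x i, Submodule.subset_span ⟨i, rfl⟩⟩
  let y' : n → V := fun i => V.orthogonalProjectionOnto (y i)
  have hfactor : (Matrix.of fun i j => inner 𝕜 (y i) (x j)) =
      (Matrix.of fun i j => b.repr (y' j) i).conjTranspose *
        (Matrix.of fun i j => b.repr (x' j) i) := by
    ext i j
    have hproj : inner 𝕜 (y i) (x j) = inner 𝕜 (y' i) (x' j) :=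
      (V.inner_orthogonalProjectionOnto_eq_of_mem_right (x' j) (y i)).symm
    rw [Matrix.of_apply, hproj, Matrix.mul_apply, ← b.sum_inner_mul_inner]
    simp [b.repr_apply_apply]
  have hy' : ∏ i, ‖y' i‖ ≤ ∏ i, ‖y i‖ :=
    Finset.prod_le_prod (fun _ _ => norm_nonneg _)
      fun i _ => V.norm_orthogonalProjectionOnto_apply_le (y i)
  rw [hfactor, Matrix.det_mul, Matrix.det_conjTranspose, norm_mul, norm_star,
    Finset.prod_mul_distrib, mul_comm]
  exact mul_le_mul (norm_det_repr_le b x') ((norm_det_repr_le b y').trans hy') (norm_nonneg _)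
    (by positivity)

end Hadamard

/-! ### Sums of principal minors -/

section MinorSum

open Classical in
/-- The principal minor of a possibly infinite matrix on a finite set of indices. -/
def principalMinor {I R : Type*} [CommRing R] (G : I → I → R) (S : Finset I) : R :=
  (Matrix.of fun i j : S => G i j).det

/-- The Fredholm series `∑ (-1)^|S| det G_S` over the finite sets of indices: the value of
`det (1 - G)` for an infinite matrix `G`. -/
def minorSum {I 𝕜 : Type*} [RCLike 𝕜] (G : I → I → 𝕜) : 𝕜 :=
  ∑' S : Finset I, (-1) ^ S.card * principalMinor G S

section CommRing

variable {I J R : Type*} [CommRing R]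

theorem principalMinor_comp_embedding (G : I → I → R) (f : J ↪ I) (S : Finset J) :
    principalMinor (fun i j => G (f i) (f j)) S = principalMinor G (S.map f) := by
  classical
  unfold principalMinor
  rw [← Matrix.det_submatrix_equiv_self (S.equivMap f)]
  congr 1

theorem det_one_sub_eq_sum_principalMinor {n : Type*} [Fintype n] [DecidableEq n]
    (G : Matrix n n R) :
    (1 - G).det = ∑ S : Finset n, (-1) ^ S.card * principalMinor G S := by
  have hexpand : (1 - G).det =
      ∑ S : Finset n, (Matrix.of (S.piecewise (-G).row (1 : Matrix n n R).row)).det := by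
    rw [sub_eq_neg_add]
    exact (Matrix.detRowAlternating (n := n) (R := R)).toMultilinearMap.map_add_univ
      (fun i => (-G) i) (fun i => (1 : Matrix n n R) i)
  rw [hexpand]
  refine Finset.sum_congr rfl fun S _ => ?_
  have hsub : (-G).submatrix (Subtype.val : S → n) (Subtype.val : S → n) =
      -(Matrix.of fun i j : S => G i j) := by ext; simp
  rw [Matrix.det_piecewise_one_eq_submatrix_det, hsub, Matrix.det_neg, Fintype.card_coe]
  unfold principalMinor
  congr!

theorem sum_powerset_principalMinor (G : I → I → R) (J : Finset I) [DecidableEq J] :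
    ∑ S ∈ J.powerset, (-1) ^ S.card * principalMinor G S =
      (1 - Matrix.of fun i j : J => G i j).det := by
  rw [det_one_sub_eq_sum_principalMinor]
  refine (Finset.sum_bij (fun S _ => S.map (Function.Embedding.subtype _)) ?_
    (fun S _ S' _ h => Finset.map_injective _ h) ?_ ?_).symm
  · intro S _
    rw [Finset.mem_powerset]
    intro i hi
    obtain ⟨a, _, rfl⟩ := Finset.mem_map.1 hi
    exact a.2
  · intro S hS
    rw [Finset.mem_powerset] at hS
    classical
    refine ⟨S.subtype (· ∈ J), Finset.mem_univ _, ?_⟩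
    rw [Finset.subtype_map]
    exact Finset.filter_true_of_mem fun i hi => hS hi
  · intro S _
    rw [Finset.card_map]
    congr 1
    exact principalMinor_comp_embedding G (Function.Embedding.subtype _) S

end CommRing

theorem minorSum_eq_det_one_sub {I 𝕜 : Type*} [RCLike 𝕜] [Fintype I] [DecidableEq I]
    (G : Matrix I I 𝕜) : minorSum G = (1 - G).det :=
  (tsum_fintype _).trans (det_one_sub_eq_sum_principalMinor G).symm

section Convergence

variable {I α 𝕜 : Type*} [RCLike 𝕜] {l : Filter α} {w : I → ℝ}

theorem summable_principalMinor {G : I → I → 𝕜} (hw : Summable w) (hw0 : 0 ≤ w)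
    (hG : ∀ S, ‖principalMinor G S‖ ≤ ∏ i ∈ S, w i) :
    Summable fun S : Finset I => (-1) ^ S.card * principalMinor G S :=
  Summable.of_norm_bounded (summable_finsetProd_of_summable_nonneg hw0 hw)
    fun S => by simpa using hG S

theorem tendsto_principalMinor {G : α → I → I → 𝕜} {G' : I → I → 𝕜}
    (h : ∀ i j, Tendsto (fun a => G a i j) l (𝓝 (G' i j))) (S : Finset I) :
    Tendsto (fun a => principalMinor (G a) S) l (𝓝 (principalMinor G' S)) := by
  classical
  have hdet : Continuous fun M : Matrix S S 𝕜 => M.det := continuous_id.matrix_det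
  exact (hdet.tendsto _).comp (tendsto_pi_nhds.2 fun i => tendsto_pi_nhds.2 fun j => h i j)

theorem tendsto_minorSum_of_dominated {G : α → I → I → 𝕜} {G' : I → I → 𝕜}
    (hw : Summable w) (hw0 : 0 ≤ w) (hG : ∀ a S, ‖principalMinor (G a) S‖ ≤ ∏ i ∈ S, w i)
    (h : ∀ i j, Tendsto (fun a => G a i j) l (𝓝 (G' i j))) :
    Tendsto (fun a => minorSum (G a)) l (𝓝 (minorSum G')) :=
  tendsto_tsum_of_dominated_convergence (summable_finsetProd_of_summable_nonneg hw0 hw)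
    (fun S => (tendsto_principalMinor h S).const_mul _)
    (Eventually.of_forall fun a S => by simpa using hG a S)

end Convergence

section Inner

variable {I 𝕜 E : Type*} [RCLike 𝕜] [NormedAddCommGroup E] [InnerProductSpace 𝕜 E]

theorem norm_principalMinor_inner_le (x y : I → E) (S : Finset I) :
    ‖principalMinor (fun i j => inner 𝕜 (y i) (x j)) S‖ ≤ ∏ i ∈ S, ‖x i‖ * ‖y i‖ := by
  classical
  rw [← Finset.prod_coe_sort]
  unfold principalMinor
  convert norm_det_inner_le (𝕜 := 𝕜) (fun i : S => x i) (fun i : S => y i)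

theorem det_one_sub_eq_minorSum_inner {m : Type*} [Fintype m] [DecidableEq m]
    {x y : I → EuclideanSpace 𝕜 m} (hs : Summable fun i => ‖x i‖ * ‖y i‖) {A : Matrix m m 𝕜}
    (hA : ∀ k l, HasSum (fun i => x i k * star (y i l)) (A k l)) :
    (1 - A).det = minorSum fun i j => inner 𝕜 (y i) (x j) := by
  classical
  have hpowerset (J : Finset I) :
      ∑ S ∈ J.powerset, (-1) ^ S.card * principalMinor (fun i j => inner 𝕜 (y i) (x j)) S =
        (1 - Matrix.of fun k l => ∑ i ∈ J, x i k * star (y i l)).det := by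
    have hfactor : (Matrix.of fun i j : J => inner 𝕜 (y i) (x j)) =
        (Matrix.of fun (i : J) k => star (y i k)) * (Matrix.of fun k (i : J) => x i k) := by
      ext i j
      simp [Matrix.mul_apply, PiLp.inner_apply, mul_comm]
    rw [sum_powerset_principalMinor, hfactor, Matrix.det_one_sub_mul_comm]
    congr 2
    ext k l
    rw [Matrix.mul_apply, Matrix.of_apply]
    exact Finset.sum_coe_sort J fun i => x i k * star (y i l)
  have hsum := summable_principalMinor hs (fun i => by positivity)
    (norm_principalMinor_inner_le (𝕜 := 𝕜) x y)
  have hdet : Continuous fun M : Matrix m m 𝕜 => (1 - M).det :=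
    (continuous_const.sub continuous_id).matrix_det
  refine tendsto_nhds_unique ?_ (hsum.hasSum.comp tendsto_finset_powerset_atTop_atTop)
  simp only [Function.comp_def, hpowerset]
  exact (hdet.tendsto A).comp (tendsto_pi_nhds.2 fun k => tendsto_pi_nhds.2 fun l => hA k l)

end Inner

end MinorSum

/-! ### Fredholm determinants of nuclear operators -/

section Nuclear

variable {H : Type} [NormedAddCommGroup H] [InnerProductSpace ℂ H]

/-- `T = ∑ ⟨y i, ·⟩ x i` with `∑ ‖x i‖ ‖y i‖ < ∞`, over an arbitrary index type. -/
structure IsNuclearExpansion {I : Type*} (T : H →L[ℂ] H) (x y : I → H) : Prop where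
  summable : Summable fun i => ‖x i‖ * ‖y i‖
  hasSum : ∀ v, HasSum (fun i => inner ℂ (y i) v • x i) (T v)

/-- The coordinates of `v` in the finite section `s` of the basis `b`. -/
def sectionCoord {ι : Type*} (b : HilbertBasis ι ℂ H) (s : Finset ι) (v : H) :
    EuclideanSpace ℂ s :=
  WithLp.toLp 2 fun k => inner ℂ (b k) v

section SectionCoord

variable {ι : Type*} (b : HilbertBasis ι ℂ H) (s : Finset ι)

theorem norm_sectionCoord_le (v : H) : ‖sectionCoord b s v‖ ≤ ‖v‖ := by
  rw [← sq_le_sq₀ (norm_nonneg _) (norm_nonneg _), EuclideanSpace.norm_sq_eq]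
  refine le_of_eq_of_le ?_ (b.orthonormal.sum_inner_products_le v (s := s))
  exact Finset.sum_coe_sort s fun k => ‖inner ℂ (b k) v‖ ^ 2

theorem norm_sectionCoord_mul_le (v w : H) :
    ‖sectionCoord b s v‖ * ‖sectionCoord b s w‖ ≤ ‖v‖ * ‖w‖ := by
  gcongr <;> exact norm_sectionCoord_le b s _

theorem inner_sectionCoord (v w : H) :
    inner ℂ (sectionCoord b s v) (sectionCoord b s w) =
      ∑ k ∈ s, inner ℂ v (b k) * inner ℂ (b k) w := by
  rw [PiLp.inner_apply, ← Finset.sum_coe_sort s fun k => inner ℂ v (b k) * inner ℂ (b k) w]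
  simp [sectionCoord, mul_comm]

end SectionCoord

theorem IsNuclearExpansion.sectionDet_eq_minorSum {I : Type*} {ι : Type} {T : H →L[ℂ] H}
    {x y : I → H} (hT : IsNuclearExpansion T x y) (b : HilbertBasis ι ℂ H) (s : Finset ι) :
    sectionDet b T s =
      minorSum fun i j => inner ℂ (sectionCoord b s (y i)) (sectionCoord b s (x j)) := by
  classical
  have hs : Summable fun i => ‖sectionCoord b s (x i)‖ * ‖sectionCoord b s (y i)‖ :=
    hT.summable.of_nonneg_of_le (fun i => by positivity)
      fun i => norm_sectionCoord_mul_le b s (x i) (y i)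
  rw [← det_one_sub_eq_minorSum_inner hs
    (A := Matrix.of fun k l : s => inner ℂ (b k) (T (b l))) fun k l => ?_]
  · unfold sectionDet
    congr!
  · have h := (hT.hasSum (b l)).mapL (innerSL ℂ (b k))
    simpa [sectionCoord, inner_smul_right, mul_comm] using h

theorem IsNuclearExpansion.hasFredholmDet {I : Type*} {T : H →L[ℂ] H} {x y : I → H}
    (hT : IsNuclearExpansion T x y) :
    HasFredholmDet T (minorSum fun i j => inner ℂ (y i) (x j)) := by
  intro ι b
  rw [funext (hT.sectionDet_eq_minorSum b)]
  refine tendsto_minorSum_of_dominated hT.summable (fun i => by positivity) (fun s S => ?_)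
    fun i j => by
      simp only [inner_sectionCoord]
      exact b.hasSum_inner_mul_inner (y i) (x j)
  exact (norm_principalMinor_inner_le _ _ S).trans <| Finset.prod_le_prod
    (fun _ _ => by positivity) fun i _ => norm_sectionCoord_mul_le b s (x i) (y i)

theorem IsNuclearExpansion.smul {I : Type*} {T : H →L[ℂ] H} {x y : I → H}
    (hT : IsNuclearExpansion T x y) (c : ℂ) : IsNuclearExpansion (c • T) (fun i => c • x i) y where
  summable := by simpa [norm_smul, mul_assoc] using hT.summable.mul_left ‖c‖
  hasSum v := by simpa [smul_comm c] using (hT.hasSum v).const_smul c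

theorem IsNuclearExpansion.hasFredholmDet_smul {I : Type*} {T : H →L[ℂ] H} {x y : I → H}
    (hT : IsNuclearExpansion T x y) (c : ℂ) :
    HasFredholmDet (c • T) (minorSum fun i j => c * inner ℂ (y i) (x j)) := by
  simpa only [inner_smul_right] using (hT.smul c).hasFredholmDet

theorem IsNuclearExpansion.isTraceClass {I : Type*} [Countable I] {T : H →L[ℂ] H} {x y : I → H}
    (hT : IsNuclearExpansion T x y) : IsTraceClass T := by
  obtain ⟨f, hf⟩ := Countable.exists_injective_nat I
  have hout {k : ℕ} (hk : k ∉ Set.range f) (z : I → H) : Function.extend f z 0 k = 0 :=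
    Function.extend_apply' _ _ _ (by simpa using hk)
  refine ⟨Function.extend f x 0, Function.extend f y 0, ?_, fun v => ?_⟩
  · rw [← hf.summable_iff fun k hk => by simp [hout hk]]
    simpa [Function.comp_def, hf.extend_apply] using hT.summable
  · rw [← hf.hasSum_iff fun k hk => by simp [hout hk]]
    simpa [Function.comp_def, hf.extend_apply] using hT.hasSum v

theorem IsNuclearExpansion.of_hilbertBasis {I ι : Type*} [CompleteSpace H]
    (b : HilbertBasis ι ℂ H) {T : H →L[ℂ] H} {x y : I → H}
    (hs : Summable fun i => ‖x i‖ * ‖y i‖)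
    (hT : ∀ k, HasSum (fun i => inner ℂ (y i) (b k) • x i) (T (b k))) :
    IsNuclearExpansion T x y := by
  have hsum : Summable fun i => InnerProductSpace.rankOne ℂ (x i) (y i) :=
    Summable.of_norm (by simpa using hs)
  have happly (v : H) : HasSum (fun i => inner ℂ (y i) v • x i)
      ((∑' i, InnerProductSpace.rankOne ℂ (x i) (y i)) v) := by
    simpa using hsum.hasSum.mapL (ContinuousLinearMap.apply ℂ H v)
  have hT_eq : T = ∑' i, InnerProductSpace.rankOne ℂ (x i) (y i) := by
    refine ContinuousLinearMap.ext_on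
      (Submodule.dense_iff_topologicalClosure_eq_top.2 b.dense_span) ?_
    rintro _ ⟨k, rfl⟩
    exact (hT k).unique (happly (b k))
  exact ⟨hs, hT_eq ▸ happly⟩

theorem HasFredholmDet.unique {ι : Type} (b : HilbertBasis ι ℂ H) {T : H →L[ℂ] H} {d d' : ℂ}
    (h : HasFredholmDet T d) (h' : HasFredholmDet T d') : d = d' :=
  tendsto_nhds_unique (h ι b) (h' ι b)

theorem HasFredholmDet.hasFredholmDet_fredholmDet {T : H →L[ℂ] H} {d : ℂ}
    (h : HasFredholmDet T d) : HasFredholmDet T (fredholmDet T) := by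
  have hex : ∃ d, HasFredholmDet T d := ⟨d, h⟩
  rw [fredholmDet, dif_pos hex]
  exact hex.choose_spec

theorem HasFredholmDet.fredholmDet_eq {ι : Type} (b : HilbertBasis ι ℂ H) {T : H →L[ℂ] H} {d : ℂ}
    (h : HasFredholmDet T d) : fredholmDet T = d :=
  h.hasFredholmDet_fredholmDet.unique b h

end Nuclear

/-! ### Determinants of inverse factorials -/

section RowUpdates

variable {n R : Type*} [Fintype n] [DecidableEq n] [CommRing R] (A : Matrix n n R)

theorem det_updateRow_eq_sum_adjugate (r : n) (b : n → R) :
    (A.updateRow r b).det = ∑ i, A.adjugate i r * b i := by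
  rw [← Matrix.cramer_transpose_apply, Matrix.cramer_eq_adjugate_mulVec,
    ← Matrix.adjugate_transpose]
  rfl

theorem det_updateCol_eq_sum_adjugate (i : n) (b : n → R) :
    (A.updateCol i b).det = ∑ r, A.adjugate i r * b r := by
  rw [← Matrix.cramer_apply, Matrix.cramer_eq_adjugate_mulVec]
  rfl

theorem sum_det_updateRow_eq_sum_det_updateCol (B : n → n → R) :
    ∑ r, (A.updateRow r (B r)).det = ∑ i, (A.updateCol i fun r => B r i).det := by
  simp only [det_updateRow_eq_sum_adjugate, det_updateCol_eq_sum_adjugate]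
  exact Finset.sum_comm

theorem sum_det_updateRow_sub_mul (a b : n → R) :
    ∑ r, (A.updateRow r fun i => (a r - b i) * A r i).det = (∑ r, a r - ∑ i, b i) * A.det := by
  simp only [det_updateRow_eq_sum_adjugate]
  calc ∑ r, ∑ i, A.adjugate i r * ((a r - b i) * A r i)
      = ∑ r, a r * ∑ i, A r i * A.adjugate i r - ∑ i, b i * ∑ r, A r i * A.adjugate i r := by
        simp only [Finset.mul_sum]
        rw [Finset.sum_comm (f := fun i r => b i * (A r i * A.adjugate i r)),
          ← Finset.sum_sub_distrib]
        refine Finset.sum_congr rfl fun r _ => ?_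
        rw [← Finset.sum_sub_distrib]
        exact Finset.sum_congr rfl fun i _ => by ring
    _ = (∑ r, a r - ∑ i, b i) * A.det := by
        simp only [← Matrix.det_eq_sum_mul_adjugate_row, ← Matrix.det_eq_sum_mul_adjugate_col,
          ← Finset.sum_mul, sub_mul]

end RowUpdates

/-- `1 / (y - i)!`, which is zero for `y < i`. -/
def invFact (y i : ℕ) : ℝ := if i ≤ y then 1 / ((y - i).factorial : ℝ) else 0

theorem invFact_succ_succ (y i : ℕ) : invFact (y + 1) (i + 1) = invFact y i := by
  simp [invFact]

theorem invFact_zero_left (i : ℕ) : invFact 0 i = if i = 0 then 1 else 0 := by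
  by_cases h : i = 0 <;> simp [invFact, h]

theorem sub_mul_invFact (y i : ℕ) : ((y : ℝ) - i) * invFact y i = invFact y (i + 1) := by
  unfold invFact
  rcases lt_trichotomy y i with h | rfl | h
  · rw [if_neg (by omega), if_neg (by omega), mul_zero]
  · simp
  · obtain ⟨k, rfl⟩ : ∃ k, y = i + k + 1 := ⟨y - i - 1, by omega⟩
    rw [if_pos (by omega), if_pos (by omega), show i + k + 1 - i = k + 1 by omega,
      show i + k + 1 - (i + 1) = k by omega, Nat.factorial_succ]
    push_cast
    have : ((k : ℝ) + 1) ≠ 0 := by positivity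
    field_simp
    ring

/-- The matrix `1 / (z r - i)!`, whose determinant is `d_μ / |μ|!` when the `z r` are the shifted
row lengths of the Young diagram `μ`. -/
def invFactMatrix {M : ℕ} (z : Fin M → ℕ) : Matrix (Fin M) (Fin M) ℝ :=
  Matrix.of fun r i => invFact (z r) i

/-- The determinant of `1 / (z r - i)!`. -/
def invFactDet {M : ℕ} (z : Fin M → ℕ) : ℝ := (invFactMatrix z).det

/-- The sum `0 + 1 + ⋯ + (M - 1)`, the least sum of `M` distinct natural numbers. -/
def staircase (M : ℕ) : ℕ := ∑ i : Fin M, (i : ℕ)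

section InvFactDet

variable {M : ℕ} {z : Fin M → ℕ}

theorem invFactDet_comp_perm (z : Fin M → ℕ) (σ : Equiv.Perm (Fin M)) :
    invFactDet (z ∘ σ) = (Equiv.Perm.sign σ : ℤ) * invFactDet z :=
  Matrix.det_permute σ (invFactMatrix z)

theorem invFactDet_comp_perm_sq (z : Fin M → ℕ) (σ : Equiv.Perm (Fin M)) :
    invFactDet (z ∘ σ) ^ 2 = invFactDet z ^ 2 := by
  rw [invFactDet_comp_perm, mul_pow]
  rcases Int.units_eq_one_or (Equiv.Perm.sign σ) with h | h <;> simp [h]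

theorem injective_of_invFactDet_ne_zero (h : invFactDet z ≠ 0) : Function.Injective z := by
  intro a b hab
  by_contra hne
  exact h (Matrix.det_zero_of_row_eq hne (by ext i; simp [invFactMatrix, hab]))

theorem invFactDet_update (z : Fin M → ℕ) (r : Fin M) (k : ℕ) :
    invFactDet (Function.update z r k) =
      ((invFactMatrix z).updateRow r fun i => invFact k i).det := by
  unfold invFactDet
  congr 1
  ext a i
  by_cases h : a = r
  · subst h; simp [invFactMatrix]
  · simp [invFactMatrix, h]

theorem invFactDet_val (M : ℕ) : invFactDet (fun i : Fin M => (i : ℕ)) = 1 := by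
  unfold invFactDet
  rw [Matrix.det_of_isLowerTriangular]
  · simp [invFactMatrix, invFact]
  · intro i j hij
    exact if_neg (not_le.2 (show (i : ℕ) < j from hij))

theorem sum_invFactDet_lower (z : Fin M → ℕ) :
    ∑ r, (if z r = 0 then 0 else invFactDet (Function.update z r (z r - 1))) =
      ((∑ r, z r : ℕ) - (staircase M : ℝ)) * invFactDet z := by
  unfold staircase
  push_cast
  rw [invFactDet, ← sum_det_updateRow_sub_mul (invFactMatrix z) (fun r => (z r : ℝ))
    (fun i => ((i : ℕ) : ℝ))]
  refine Finset.sum_congr rfl fun r _ => ?_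
  simp only [invFactMatrix, Matrix.of_apply, sub_mul_invFact]
  split_ifs with hr
  · refine (Matrix.det_eq_zero_of_row_eq_zero r fun i => ?_).symm
    simp [hr, invFact]
  · rw [invFactDet_update]
    congr 2
    ext i
    rw [← invFact_succ_succ, Nat.sub_add_cancel (by omega)]

theorem staircase_add_mul_le_sum (hz : Function.Injective z) {c : ℕ} (hc : ∀ r, c ≤ z r) :
    staircase M + M * c ≤ ∑ r, z r := by
  have h := Finset.sum_range_le_sum
    (s := Finset.univ.map ((⟨z, hz⟩ : Fin M ↪ ℕ).trans Nat.castEmbedding)) (c := (c : ℤ))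
    (by simpa using hc)
  rw [Finset.card_map, Finset.card_univ, Fintype.card_fin, Finset.sum_map] at h
  simp only [Function.Embedding.trans_apply, Function.Embedding.coeFn_mk,
    Nat.castEmbedding_apply, Finset.sum_add_distrib, Finset.sum_const, Finset.card_range,
    nsmul_eq_mul] at h
  unfold staircase
  rw [Fin.sum_univ_eq_sum_range (fun i => i)]
  zify
  linarith

theorem invFactDet_eq_zero_of_sum_lt (h : ∑ r, z r < staircase M) : invFactDet z = 0 := by
  by_contra hne
  have := staircase_add_mul_le_sum (injective_of_invFactDet_ne_zero hne) fun r => Nat.zero_le (z r)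
  omega

theorem exists_eq_zero_of_sum_lt (hz : Function.Injective z) (h : ∑ r, z r < staircase M + M) :
    ∃ r, z r = 0 := by
  by_contra! hne
  have := staircase_add_mul_le_sum hz fun r => Nat.one_le_iff_ne_zero.2 (hne r)
  omega

-- In the sum over column updates, raising column `i + 1` produces column `i`, and raising column
-- `0` changes it only by a vector that vanishes at `r₀`.
theorem sum_invFactDet_raise {r₀ : Fin M} (hr₀ : z r₀ = 0) :
    ∑ r, invFactDet (Function.update z r (z r + 1)) = invFactDet z := by
  obtain ⟨m, rfl⟩ : ∃ m, M = m + 1 := ⟨M - 1, by have := r₀.2; omega⟩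
  set A := invFactMatrix z with hA
  simp only [invFactDet_update]
  rw [sum_det_updateRow_eq_sum_det_updateCol A fun r i => invFact (z r + 1) i, Fin.sum_univ_succ]
  have hsucc : ∑ i : Fin m, (A.updateCol i.succ fun r => invFact (z r + 1) i.succ).det = 0 := by
    refine Finset.sum_eq_zero fun i _ => ?_
    refine Matrix.det_zero_of_column_eq (i := i.castSucc) (j := i.succ)
      (Fin.castSucc_lt_succ).ne fun r => ?_
    rw [Matrix.updateCol_self, Matrix.updateCol_ne (Fin.castSucc_lt_succ).ne]
    simp [hA, invFactMatrix, invFact_succ_succ]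
  have hsplit : (fun r => invFact (z r + 1) (0 : Fin (m + 1))) =
      (fun r => A r 0) + fun r => invFact (z r + 1) (0 : Fin (m + 1)) - A r 0 := by
    ext r; simp
  have hdiff : (A.updateCol 0 fun r => invFact (z r + 1) (0 : Fin (m + 1)) - A r 0).det = 0 := by
    refine Matrix.det_eq_zero_of_row_eq_zero r₀ fun i => ?_
    by_cases hi : i = 0
    · subst hi
      simp [hA, invFactMatrix, hr₀, invFact]
    · rw [Matrix.updateCol_ne hi]
      simp [hA, invFactMatrix, hr₀, invFact_zero_left, hi]
  rw [hsucc, add_zero, hsplit, Matrix.det_updateCol_add, Matrix.updateCol_eq_self, hdiff, add_zero]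
  rfl

end InvFactDet

/-- The sum of the squares of the determinants of inverse factorials in degree `N`, which is `M!`
times the sum of `(d_μ / N!)²` over the Young diagrams with `N` boxes and at most `M` rows. -/
def sqSum (M N : ℕ) : ℝ :=
  ∑ z ∈ Finset.piAntidiag (Finset.univ : Finset (Fin M)) (N + staircase M), invFactDet z ^ 2

theorem sum_update_add {ι A : Type*} [Fintype ι] [DecidableEq ι] [AddCommMonoid A]
    (z : ι → A) (r : ι) (a : A) :
    Finset.univ.sum (Function.update z r a) + z r = Finset.univ.sum z + a := by
  rw [Finset.sum_update_of_mem (Finset.mem_univ r),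
    ← Finset.add_sum_erase _ _ (Finset.mem_univ r), Finset.sdiff_singleton_eq_erase]
  abel

theorem sum_piAntidiag_succ_lower {ι A : Type*} [Fintype ι] [DecidableEq ι] [AddCommMonoid A]
    (N : ℕ) (r : ι) (F : (ι → ℕ) → (ι → ℕ) → A) :
    ∑ z ∈ Finset.piAntidiag Finset.univ (N + 1),
        (if z r = 0 then 0 else F z (Function.update z r (z r - 1))) =
      ∑ z ∈ Finset.piAntidiag Finset.univ N, F (Function.update z r (z r + 1)) z := by
  simp only [← ite_not (p := _ = 0)]
  rw [← Finset.sum_filter]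
  refine Finset.sum_bij' (fun z _ => Function.update z r (z r - 1))
    (fun z _ => Function.update z r (z r + 1)) ?_ ?_ ?_ ?_ ?_
  all_goals simp only [Finset.mem_filter, Finset.mem_piAntidiag, Finset.mem_univ, implies_true,
    and_true, and_imp]
  · intro z hz hr
    have := sum_update_add z r (z r - 1)
    omega
  · intro z hz
    have := sum_update_add z r (z r + 1)
    refine ⟨by omega, by simp⟩
  · intro z _ hr
    simp [Nat.sub_add_cancel (Nat.pos_of_ne_zero hr)]
  · simp
  · intro z _ hr
    simp [Nat.sub_add_cancel (Nat.pos_of_ne_zero hr)]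

theorem add_one_mul_sqSum_succ {M N : ℕ} (hN : N < M) :
    ((N : ℝ) + 1) * sqSum M (N + 1) = sqSum M N := by
  have hlower : ((N : ℝ) + 1) * sqSum M (N + 1) =
      ∑ z ∈ Finset.piAntidiag (Finset.univ : Finset (Fin M)) (N + staircase M + 1), ∑ r,
        if z r = 0 then 0 else invFactDet z * invFactDet (Function.update z r (z r - 1)) := by
    rw [sqSum, Finset.mul_sum, add_right_comm N 1]
    refine Finset.sum_congr rfl fun z hz => ?_
    have hsum : ∑ r, z r = N + staircase M + 1 := by simpa using hz
    have hfactor : ∀ r, (if z r = 0 then 0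
        else invFactDet z * invFactDet (Function.update z r (z r - 1))) =
        invFactDet z * if z r = 0 then 0 else invFactDet (Function.update z r (z r - 1)) :=
      fun r => by rw [mul_ite, mul_zero]
    rw [Finset.sum_congr rfl fun r _ => hfactor r, ← Finset.mul_sum, sum_invFactDet_lower, hsum]
    push_cast
    ring
  have hraise : sqSum M N =
      ∑ z ∈ Finset.piAntidiag (Finset.univ : Finset (Fin M)) (N + staircase M), ∑ r,
        invFactDet (Function.update z r (z r + 1)) * invFactDet z := by
    refine Finset.sum_congr rfl fun z hz => ?_
    have hsum : ∑ r, z r = N + staircase M := by simpa using hz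
    rw [← Finset.sum_mul]
    by_cases hdet : invFactDet z = 0
    · simp [hdet]
    obtain ⟨r, hr⟩ := exists_eq_zero_of_sum_lt (injective_of_invFactDet_ne_zero hdet)
      (by omega)
    rw [sum_invFactDet_raise hr, sq]
  rw [hlower, hraise, Finset.sum_comm, Finset.sum_comm (s := Finset.piAntidiag _ (N + staircase M))]
  exact Finset.sum_congr rfl fun r _ =>
    sum_piAntidiag_succ_lower _ r fun z w => invFactDet z * invFactDet w

/-! ### Andréief's identity -/

section Andreief

variable {n α R : Type*} [Fintype n] [DecidableEq n] [CommRing R] (s : Finset α) (a b : α → n → R)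

theorem sum_det_mul_prod_eq_det :
    ∑ y ∈ Fintype.piFinset fun _ : n => s, (Matrix.of fun r i => a (y r) i).det * ∏ r, b (y r) r =
      (Matrix.of fun i j => ∑ y ∈ s, a y i * b y j).det := by
  rw [Matrix.det_apply' (Matrix.of fun i j => ∑ y ∈ s, a y i * b y j)]
  simp only [Matrix.of_apply, Finset.prod_univ_sum, Finset.mul_sum]
  rw [Finset.sum_comm]
  refine Finset.sum_congr rfl fun y _ => ?_
  rw [← Matrix.det_transpose, Matrix.det_apply', Finset.sum_mul]
  refine Finset.sum_congr rfl fun σ _ => ?_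
  simp only [Matrix.transpose_apply, Matrix.of_apply, Finset.prod_mul_distrib]
  ring

theorem sum_det_mul_sign_mul_prod_perm (τ : Equiv.Perm n) :
    ∑ y ∈ Fintype.piFinset fun _ : n => s, (Matrix.of fun r i => a (y r) i).det *
        ((Equiv.Perm.sign τ : ℤ) * ∏ r, b (y (τ r)) r) =
      ∑ y ∈ Fintype.piFinset fun _ : n => s,
        (Matrix.of fun r i => a (y r) i).det * ∏ r, b (y r) r := by
  refine Finset.sum_bij' (fun y _ => y ∘ τ) (fun y _ => y ∘ τ.symm) ?_ ?_ ?_ ?_ fun y _ => ?_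
  · exact fun y hy => Fintype.mem_piFinset.2 fun r => Fintype.mem_piFinset.1 hy _
  · exact fun y hy => Fintype.mem_piFinset.2 fun r => Fintype.mem_piFinset.1 hy _
  · exact fun y _ => by ext; simp
  · exact fun y _ => by ext; simp
  · have hsign : (Matrix.of fun r i => a ((y ∘ τ) r) i).det =
        (Equiv.Perm.sign τ : ℤ) * (Matrix.of fun r i => a (y r) i).det :=
      Matrix.det_permute τ (Matrix.of fun r i => a (y r) i)
    rw [hsign]
    simp only [Function.comp_apply]
    ring

theorem sum_det_mul_det_eq_factorial_mul_det :
    ∑ y ∈ Fintype.piFinset fun _ : n => s,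
        (Matrix.of fun r i => a (y r) i).det * (Matrix.of fun r i => b (y r) i).det =
      (Fintype.card n).factorial * (Matrix.of fun i j => ∑ y ∈ s, a y i * b y j).det := by
  simp only [fun y : n → α => Matrix.det_apply' (Matrix.of fun r i => b (y r) i),
    Matrix.of_apply, Finset.mul_sum]
  rw [Finset.sum_comm]
  simp only [sum_det_mul_sign_mul_prod_perm, sum_det_mul_prod_eq_det]
  simp [Fintype.card_perm]

end Andreief

/-! ### The branching rule for standard Young tableaux -/

/-- The fillings of the boxes of `μ` that are standard Young tableaux, as functions on all of
`ℕ × ℕ` that vanish outside `μ`. The order on `ℕ × ℕ` is the product order, so that the last field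
comprises the conditions on the rows and on the columns. -/
structure IsTableau (μ : YoungDiagram) (f : ℕ × ℕ → ℕ) : Prop where
  eq_zero : ∀ c ∉ μ, f c = 0
  lt_card : ∀ c ∈ μ, f c < μ.card
  injOn : Set.InjOn f μ
  lt_of_lt : ∀ a b, a < b → b ∈ μ → f a < f b

section Tableaux

variable {μ : YoungDiagram}

theorem StandardYoungTableau.entry_injective (μ : YoungDiagram) :
    Function.Injective (StandardYoungTableau.entry (μ := μ)) := by
  rintro ⟨e, _, _⟩ ⟨e', _, _⟩ h
  cases h
  rfl

theorem StandardYoungTableau.entry_lt_entry (T : StandardYoungTableau μ) {a b : μ.cells}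
    (h : (a : ℕ × ℕ) < b) : T.entry a < T.entry b := by
  obtain ⟨⟨i, j⟩, ha⟩ := a
  obtain ⟨⟨i', j'⟩, hb⟩ := b
  rcases Prod.mk_lt_mk.1 h with ⟨hi, hj⟩ | ⟨hi, hj⟩
  · have hmem : (i', j) ∈ μ.cells := by simpa using μ.up_left_mem le_rfl hj (by simpa using hb)
    have hcol := T.col_strict ⟨(i, j), ha⟩ ⟨(i', j), hmem⟩ rfl hi
    rcases hj.eq_or_lt with rfl | hlt
    · exact hcol
    · exact hcol.trans (T.row_strict ⟨(i', j), hmem⟩ ⟨(i', j'), hb⟩ rfl hlt)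
  · have hmem : (i, j') ∈ μ.cells := by simpa using μ.up_left_mem hi le_rfl (by simpa using hb)
    have hrow := T.row_strict ⟨(i, j), ha⟩ ⟨(i, j'), hmem⟩ rfl hj
    rcases hi.eq_or_lt with rfl | hlt
    · exact hrow
    · exact hrow.trans (T.col_strict ⟨(i, j'), hmem⟩ ⟨(i', j'), hb⟩ rfl hlt)

/-- The entries of a standard Young tableau as a function on `ℕ × ℕ`, zero outside the diagram. -/
def StandardYoungTableau.toFun (T : StandardYoungTableau μ) (c : ℕ × ℕ) : ℕ :=
  if h : c ∈ μ.cells then (T.entry ⟨c, h⟩ : ℕ) else 0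

theorem StandardYoungTableau.toFun_of_mem (T : StandardYoungTableau μ) {c : ℕ × ℕ}
    (h : c ∈ μ.cells) : T.toFun c = T.entry ⟨c, h⟩ := dif_pos h

theorem StandardYoungTableau.isTableau (T : StandardYoungTableau μ) : IsTableau μ T.toFun where
  eq_zero c hc := dif_neg (by simpa using hc)
  lt_card c hc := by
    rw [T.toFun_of_mem ((YoungDiagram.mem_cells c).2 hc)]
    exact Fin.is_lt _
  injOn a ha b hb h := by
    rw [T.toFun_of_mem ((YoungDiagram.mem_cells a).2 ha),
      T.toFun_of_mem ((YoungDiagram.mem_cells b).2 hb)] at h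
    exact congrArg Subtype.val (T.entry.injective (Fin.ext h))
  lt_of_lt a b hab hb := by
    rw [T.toFun_of_mem ((YoungDiagram.mem_cells a).2 (μ.isLowerSet hab.le hb)),
      T.toFun_of_mem ((YoungDiagram.mem_cells b).2 hb)]
    exact T.entry_lt_entry hab

theorem IsTableau.exists_toFun_eq {f : ℕ × ℕ → ℕ} (hf : IsTableau μ f) :
    ∃ T : StandardYoungTableau μ, T.toFun = f := by
  let e : μ.cells → Fin μ.card := fun c => ⟨f c, hf.lt_card _ (by simp)⟩
  have he : Function.Bijective e := by
    rw [Fintype.bijective_iff_injective_and_card]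
    exact ⟨fun a b h => Subtype.ext (hf.injOn (by simp) (by simp) (by simpa [e] using h)), by simp⟩
  refine ⟨⟨Equiv.ofBijective e he, fun a b hrow h => ?_, fun a b hcol h => ?_⟩,
    funext fun c => ?_⟩
  · exact hf.lt_of_lt _ _ (Prod.lt_iff.2 (.inr ⟨hrow.le, h⟩)) (by simp)
  · exact hf.lt_of_lt _ _ (Prod.lt_iff.2 (.inl ⟨h, hcol.le⟩)) (by simp)
  · by_cases h : c ∈ μ.cells
    · exact StandardYoungTableau.toFun_of_mem _ h
    · rw [hf.eq_zero c (by simpa using h)]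
      exact dif_neg h

theorem numSYT_eq_card_isTableau (μ : YoungDiagram) :
    numSYT μ = Nat.card {f : ℕ × ℕ → ℕ // IsTableau μ f} := by
  refine Nat.card_eq_of_bijective (fun T : StandardYoungTableau μ => ⟨T.toFun, T.isTableau⟩)
    ⟨fun T T' h => ?_, fun ⟨f, hf⟩ => ?_⟩
  · refine StandardYoungTableau.entry_injective μ (Equiv.ext fun c => Fin.ext ?_)
    simpa [T.toFun_of_mem c.2, T'.toFun_of_mem c.2] using congrFun (Subtype.ext_iff.1 h) c.1
  · obtain ⟨T, rfl⟩ := hf.exists_toFun_eq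
    exact ⟨T, rfl⟩

instance finite_isTableau (μ : YoungDiagram) : Finite {f : ℕ × ℕ → ℕ // IsTableau μ f} := by
  refine Finite.of_injective
    (fun f => fun c : μ.cells => (⟨f.1 c, f.2.lt_card _ (by simp)⟩ : Fin μ.card))
    fun f g h => Subtype.ext (funext fun c => ?_)
  by_cases hc : c ∈ μ.cells
  · simpa using congrFun h ⟨c, hc⟩
  · rw [f.2.eq_zero c (by simpa using hc), g.2.eq_zero c (by simpa using hc)]

theorem rowLen_eq_of_mem_iff {i m : ℕ} (h : ∀ j, (i, j) ∈ μ ↔ j < m) : μ.rowLen i = m :=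
  eq_of_forall_lt_iff fun j => by rw [← h j, YoungDiagram.mem_iff_lt_rowLen]

theorem card_eq_zero_iff : μ.card = 0 ↔ μ = ⊥ := by
  rw [YoungDiagram.card, Finset.card_eq_zero]
  exact ⟨fun h => YoungDiagram.ext h, fun h => by rw [h]; rfl⟩

theorem rowLen_bot (i : ℕ) : (⊥ : YoungDiagram).rowLen i = 0 :=
  rowLen_eq_of_mem_iff fun j => by simp

theorem numSYT_bot : numSYT ⊥ = 1 := by
  rw [numSYT_eq_card_isTableau, Nat.card_eq_one_iff_unique]
  refine ⟨⟨fun f g => Subtype.ext (funext fun c => ?_)⟩, ⟨⟨0, ?_⟩⟩⟩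
  · rw [f.2.eq_zero c (by simp), g.2.eq_zero c (by simp)]
  · exact ⟨fun _ _ => rfl, by simp, by simp [Set.InjOn], by simp⟩

/-- The last box of row `r`. Its column is a truncated subtraction: the row must be nonempty. -/
def lastBox (μ : YoungDiagram) (r : ℕ) : ℕ × ℕ := (r, μ.rowLen r - 1)

/-- The row `r` is longer than the next one, so that its last box can be removed. -/
def IsCorner (μ : YoungDiagram) (r : ℕ) : Prop := μ.rowLen (r + 1) < μ.rowLen r

variable {r : ℕ} {f g : ℕ × ℕ → ℕ}

theorem IsCorner.lastBox_mem (h : IsCorner μ r) : lastBox μ r ∈ μ := by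
  unfold IsCorner at h
  rw [lastBox, YoungDiagram.mem_iff_lt_rowLen]
  omega

theorem IsCorner.notMem_of_lastBox_lt (h : IsCorner μ r) {c : ℕ × ℕ} (hc : lastBox μ r < c) :
    c ∉ μ := by
  obtain ⟨i, j⟩ := c
  unfold IsCorner at h
  rw [YoungDiagram.mem_iff_lt_rowLen, not_lt]
  rcases Prod.mk_lt_mk.1 hc with ⟨hi, hj⟩ | ⟨hi, hj⟩
  · have := μ.rowLen_anti (r + 1) i hi
    omega
  · have := μ.rowLen_anti r i hi
    omega

open Classical in
/-- `μ` with the last box of row `r` removed if it is a corner, and `μ` otherwise. -/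
def eraseRow (μ : YoungDiagram) (r : ℕ) : YoungDiagram :=
  if h : IsCorner μ r then
    { cells := μ.cells.erase (lastBox μ r)
      isLowerSet := by
        intro b a hab hb
        simp only [Finset.coe_erase, Set.mem_sdiff, Finset.mem_coe, YoungDiagram.mem_cells,
          Set.mem_singleton_iff] at hb ⊢
        refine ⟨μ.isLowerSet hab hb.1, ?_⟩
        rintro rfl
        exact h.notMem_of_lastBox_lt (lt_of_le_of_ne hab (Ne.symm hb.2)) hb.1 }
  else μ

theorem IsCorner.cells_eraseRow (h : IsCorner μ r) :
    (eraseRow μ r).cells = μ.cells.erase (lastBox μ r) := by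
  rw [eraseRow, dif_pos h]

theorem IsCorner.mem_eraseRow (h : IsCorner μ r) {c : ℕ × ℕ} :
    c ∈ eraseRow μ r ↔ c ≠ lastBox μ r ∧ c ∈ μ := by
  rw [← YoungDiagram.mem_cells, h.cells_eraseRow, Finset.mem_erase, YoungDiagram.mem_cells]

theorem IsCorner.card_eraseRow (h : IsCorner μ r) : (eraseRow μ r).card + 1 = μ.card := by
  rw [YoungDiagram.card, h.cells_eraseRow]
  exact Finset.card_erase_add_one ((YoungDiagram.mem_cells _).2 h.lastBox_mem)

theorem IsCorner.rowLen_eraseRow (h : IsCorner μ r) (i : ℕ) :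
    (eraseRow μ r).rowLen i = if i = r then μ.rowLen r - 1 else μ.rowLen i := by
  refine rowLen_eq_of_mem_iff fun j => ?_
  rw [h.mem_eraseRow, YoungDiagram.mem_iff_lt_rowLen, lastBox]
  split_ifs with hi
  · subst hi
    simp only [ne_eq, Prod.mk.injEq, true_and]
    omega
  · simp [hi]

theorem IsTableau.update_lastBox (h : IsCorner μ r) (hg : IsTableau (eraseRow μ r) g) :
    IsTableau μ (Function.update g (lastBox μ r) (eraseRow μ r).card) := by
  have hlt : ∀ c ∈ μ, c ≠ lastBox μ r → g c < (eraseRow μ r).card := fun c hc hne =>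
    hg.lt_card c (h.mem_eraseRow.2 ⟨hne, hc⟩)
  have hcard := h.card_eraseRow
  refine ⟨fun c hc => ?_, fun c hc => ?_, fun a ha b hb hab => ?_, fun a b hab hb => ?_⟩
  · rw [Function.update_of_ne (by rintro rfl; exact hc h.lastBox_mem)]
    exact hg.eq_zero c fun hmem => hc (h.mem_eraseRow.1 hmem).2
  · by_cases hlast : c = lastBox μ r
    · rw [hlast, Function.update_self]
      omega
    · rw [Function.update_of_ne hlast]
      exact (hlt c hc hlast).trans (by omega)
  · by_cases ha' : a = lastBox μ r <;> by_cases hb' : b = lastBox μ r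
    · rw [ha', hb']
    · rw [ha', Function.update_self, Function.update_of_ne hb'] at hab
      exact absurd hab.symm (hlt b hb hb').ne
    · rw [hb', Function.update_self, Function.update_of_ne ha'] at hab
      exact absurd hab (hlt a ha ha').ne
    · rw [Function.update_of_ne ha', Function.update_of_ne hb'] at hab
      exact hg.injOn (h.mem_eraseRow.2 ⟨ha', ha⟩) (h.mem_eraseRow.2 ⟨hb', hb⟩) hab
  · have ha' : a ≠ lastBox μ r := by
      rintro rfl
      exact h.notMem_of_lastBox_lt hab hb
    rw [Function.update_of_ne ha']
    by_cases hb' : b = lastBox μ r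
    · rw [hb', Function.update_self]
      exact hlt a (μ.isLowerSet hab.le hb) ha'
    · rw [Function.update_of_ne hb']
      exact hg.lt_of_lt a b hab (h.mem_eraseRow.2 ⟨hb', hb⟩)

theorem IsTableau.exists_eq (hf : IsTableau μ f) {k : ℕ} (hk : k < μ.card) :
    ∃ c ∈ μ, f c = k := by
  have himage : μ.cells.image f = Finset.range μ.card := by
    refine Finset.eq_of_subset_of_card_le (fun x hx => ?_) ?_
    · obtain ⟨c, hc, rfl⟩ := Finset.mem_image.1 hx
      exact Finset.mem_range.2 (hf.lt_card c ((YoungDiagram.mem_cells c).1 hc))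
    · rw [Finset.card_range, Finset.card_image_of_injOn hf.injOn]
  obtain ⟨c, hc, rfl⟩ := Finset.mem_image.1 (himage ▸ Finset.mem_range.2 hk)
  exact ⟨c, (YoungDiagram.mem_cells c).1 hc, rfl⟩

theorem IsTableau.exists_isCorner (hf : IsTableau μ f) (hμ : 0 < μ.card) :
    ∃ r, IsCorner μ r ∧ f (lastBox μ r) + 1 = μ.card := by
  obtain ⟨⟨r, j⟩, hmem, hmax⟩ := hf.exists_eq (k := μ.card - 1) (by omega)
  have hnot : ∀ c, (r, j) < c → c ∉ μ := fun c hlt hc => by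
    have := hf.lt_of_lt _ _ hlt hc
    have := hf.lt_card c hc
    omega
  have hright : (r, j + 1) ∉ μ := hnot _ (Prod.mk_lt_mk.2 (.inr ⟨le_rfl, by omega⟩))
  have hbelow : (r + 1, j) ∉ μ := hnot _ (Prod.mk_lt_mk.2 (.inl ⟨by omega, le_rfl⟩))
  rw [YoungDiagram.mem_iff_lt_rowLen] at hright hbelow hmem
  have hj : μ.rowLen r - 1 = j := by omega
  refine ⟨r, show _ < _ by omega, ?_⟩
  rw [lastBox, hj, hmax]
  omega

theorem IsTableau.erase_lastBox (h : IsCorner μ r) (hf : IsTableau μ f)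
    (hlast : f (lastBox μ r) + 1 = μ.card) :
    IsTableau (eraseRow μ r) (Function.update f (lastBox μ r) 0) := by
  have hcard := h.card_eraseRow
  have hupdate : ∀ c ∈ eraseRow μ r, Function.update f (lastBox μ r) 0 c = f c := fun c hc =>
    Function.update_of_ne (h.mem_eraseRow.1 hc).1 _ _
  refine ⟨fun c hc => ?_, fun c hc => ?_, fun a ha b hb hab => ?_, fun a b hab hb => ?_⟩
  · by_cases hc' : c = lastBox μ r
    · rw [hc', Function.update_self]
    · rw [Function.update_of_ne hc']
      exact hf.eq_zero c fun hmem => hc (h.mem_eraseRow.2 ⟨hc', hmem⟩)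
  · rw [hupdate c hc]
    obtain ⟨hne, hmem⟩ := h.mem_eraseRow.1 hc
    have := hf.lt_card c hmem
    have : f c ≠ f (lastBox μ r) := fun heq => hne (hf.injOn hmem h.lastBox_mem heq)
    omega
  · rw [hupdate a ha, hupdate b hb] at hab
    exact hf.injOn (h.mem_eraseRow.1 ha).2 (h.mem_eraseRow.1 hb).2 hab
  · rw [hupdate b hb, hupdate a ((eraseRow μ r).isLowerSet hab.le hb)]
    exact hf.lt_of_lt a b hab (h.mem_eraseRow.1 hb).2

theorem IsTableau.row_eq_of_update_eq {r' : ℕ} {g' : ℕ × ℕ → ℕ} (h : IsCorner μ r)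
    (h' : IsCorner μ r') (hg : IsTableau (eraseRow μ r) g)
    (heq : Function.update g (lastBox μ r) (eraseRow μ r).card =
      Function.update g' (lastBox μ r') (eraseRow μ r').card) : r = r' := by
  have hcard : (eraseRow μ r).card = (eraseRow μ r').card := by
    have := h.card_eraseRow
    have := h'.card_eraseRow
    omega
  have hbox : lastBox μ r = lastBox μ r' :=
    (hg.update_lastBox h).injOn h.lastBox_mem h'.lastBox_mem (by
      rw [Function.update_self, heq, Function.update_self, hcard])
  exact (Prod.mk.inj hbox).1

theorem IsTableau.eq_of_update_eq {g' : ℕ × ℕ → ℕ} {m : ℕ} (h : IsCorner μ r)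
    (hg : IsTableau (eraseRow μ r) g) (hg' : IsTableau (eraseRow μ r) g')
    (heq : Function.update g (lastBox μ r) m = Function.update g' (lastBox μ r) m) : g = g' := by
  ext c
  by_cases hc : c = lastBox μ r
  · have hnot : c ∉ eraseRow μ r := fun hmem => (h.mem_eraseRow.1 hmem).1 hc
    rw [hg.eq_zero c hnot, hg'.eq_zero c hnot]
  · simpa [hc] using congrFun heq c

open Classical in
theorem numSYT_eq_sum_eraseRow (hμ : 0 < μ.card) {M : ℕ} (hM : μ.rowLen M = 0) :
    numSYT μ = ∑ r : Fin M, if IsCorner μ r then numSYT (eraseRow μ r) else 0 := by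
  rw [← Finset.sum_filter, ← Finset.sum_subtype_eq_sum_filter, Finset.subtype_univ]
  simp only [numSYT_eq_card_isTableau]
  rw [← Nat.card_sigma]
  symm
  refine Nat.card_eq_of_bijective
    (fun p : Σ r : {r : Fin M // IsCorner μ r}, {g : ℕ × ℕ → ℕ // IsTableau (eraseRow μ r.1) g} =>
      ⟨Function.update p.2.1 (lastBox μ p.1.1) (eraseRow μ p.1.1).card,
        p.2.2.update_lastBox p.1.2⟩) ⟨?_, ?_⟩
  · rintro ⟨⟨r, hr⟩, g, hg⟩ ⟨⟨r', hr'⟩, g', hg'⟩ heq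
    have heq := Subtype.ext_iff.1 heq
    obtain rfl : r = r' := Fin.ext (hg.row_eq_of_update_eq hr hr' heq)
    obtain rfl : g = g' := hg.eq_of_update_eq hr hg' heq
    rfl
  · rintro ⟨f, hf⟩
    obtain ⟨r, hr, hlast⟩ := hf.exists_isCorner hμ
    have hrM : r < M := by
      by_contra! hle
      have := μ.rowLen_anti M r hle
      unfold IsCorner at hr
      omega
    refine ⟨⟨⟨⟨r, hrM⟩, hr⟩, _, hf.erase_lastBox hr hlast⟩, Subtype.ext ?_⟩
    have hcard := hr.card_eraseRow
    simp only [Function.update_idem]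
    rw [show (eraseRow μ r).card = f (lastBox μ r) by omega, Function.update_eq_self]

end Tableaux

/-! ### Young diagrams as increasing sequences -/

/-- The strictly increasing sequence of the numbers `μ_r + M - 1 - r`, `r < M`. -/
def shifted (M : ℕ) (μ : YoungDiagram) (i : Fin M) : ℕ := μ.rowLen (Fin.rev i) + i

section Shifted

variable {M : ℕ} {μ ν : YoungDiagram}

theorem shifted_strictMono (M : ℕ) (μ : YoungDiagram) : StrictMono (shifted M μ) := fun _ _ hij =>
  add_lt_add_of_le_of_lt (μ.rowLen_anti _ _ (Fin.rev_le_rev.2 hij.le)) hij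

theorem rowLen_eq_zero_of_le {i : ℕ} (hM : μ.rowLen M = 0) (hi : M ≤ i) : μ.rowLen i = 0 :=
  Nat.eq_zero_of_le_zero (hM ▸ μ.rowLen_anti M i hi)

theorem rowLen_eq_zero_of_card_le (h : μ.card ≤ M) : μ.rowLen M = 0 := by
  by_contra hne
  have hsub : (Finset.range (M + 1)).image (fun i => (i, 0)) ⊆ μ.cells := by
    intro c hc
    obtain ⟨i, hi, rfl⟩ := Finset.mem_image.1 hc
    rw [YoungDiagram.mem_cells, YoungDiagram.mem_iff_lt_rowLen]
    have := μ.rowLen_anti i M (Nat.lt_succ_iff.1 (Finset.mem_range.1 hi))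
    omega
  have hcard := Finset.card_le_card hsub
  rw [Finset.card_image_of_injective _ fun a b hab => (Prod.mk.inj hab).1, Finset.card_range]
    at hcard
  exact absurd (hcard.trans h) (by omega)

theorem card_eq_sum_rowLen (hM : μ.rowLen M = 0) : μ.card = ∑ i : Fin M, μ.rowLen i := by
  rw [Fin.sum_univ_eq_sum_range fun i => μ.rowLen i, YoungDiagram.card,
    Finset.card_eq_sum_card_fiberwise (f := Prod.fst) (t := Finset.range M)]
  · exact Finset.sum_congr rfl fun i _ => by rw [YoungDiagram.rowLen_eq_card, YoungDiagram.row]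
  · rintro ⟨i, j⟩ hc
    have hj : j < μ.rowLen i := YoungDiagram.mem_iff_lt_rowLen.1 hc
    simp only [Finset.coe_range, Set.mem_Iio]
    by_contra! hle
    rw [rowLen_eq_zero_of_le hM hle] at hj
    omega

theorem sum_shifted (hM : μ.rowLen M = 0) : ∑ i, shifted M μ i = μ.card + staircase M := by
  simp only [shifted, Finset.sum_add_distrib]
  rw [card_eq_sum_rowLen hM, staircase]
  exact congrArg (· + _) (Equiv.sum_comp Fin.revPerm fun i : Fin M => μ.rowLen i)

theorem shifted_bot (M : ℕ) : shifted M ⊥ = fun i : Fin M => (i : ℕ) :=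
  funext fun i => by rw [shifted, rowLen_bot, zero_add]

theorem shifted_eraseRow {i : Fin M} (h : IsCorner μ (Fin.rev i)) :
    shifted M (eraseRow μ (Fin.rev i)) =
      Function.update (shifted M μ) i (shifted M μ i - 1) := by
  have hpos : 0 < μ.rowLen (Fin.rev i) := Nat.zero_lt_of_lt h
  ext k
  by_cases hk : k = i
  · subst hk
    simp only [shifted, h.rowLen_eraseRow, if_true, Function.update_self]
    omega
  · have hne : ((Fin.rev k : Fin M) : ℕ) ≠ Fin.rev i := fun heq =>
      hk (Fin.rev_injective (Fin.ext heq))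
    rw [Function.update_of_ne hk, shifted, h.rowLen_eraseRow, if_neg hne, shifted]

-- Shortening a row that is no corner makes two terms of the sequence equal.
theorem invFactDet_lower_shifted_eq_zero (hM : μ.rowLen M = 0) {i : Fin M}
    (h : ¬IsCorner μ (Fin.rev i)) (hi : shifted M μ i ≠ 0) :
    invFactDet (Function.update (shifted M μ) i (shifted M μ i - 1)) = 0 := by
  have heq : μ.rowLen (Fin.rev i + 1) = μ.rowLen (Fin.rev i) :=
    le_antisymm (μ.rowLen_anti _ _ (Nat.le_succ _)) (not_lt.1 h)
  have hlt := i.2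
  have hrev : ((Fin.rev i : Fin M) : ℕ) = M - (i + 1) := Fin.val_rev i
  have hi0 : 0 < (i : ℕ) := by
    by_contra! hle
    rw [rowLen_eq_zero_of_le hM (show M ≤ (Fin.rev i : Fin M) + 1 by omega)] at heq
    unfold shifted at hi
    omega
  let k : Fin M := ⟨i - 1, by omega⟩
  have hki : k ≠ i := Fin.ne_of_val_ne (show (i : ℕ) - 1 ≠ i by omega)
  have hrevk : ((Fin.rev k : Fin M) : ℕ) = Fin.rev i + 1 := by
    rw [Fin.val_rev, hrev]
    change M - (i - 1 + 1) = _
    omega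
  by_contra hne
  refine hki (injective_of_invFactDet_ne_zero hne ?_)
  rw [Function.update_self, Function.update_of_ne hki, shifted, shifted, hrevk, heq]
  change _ + ((i : ℕ) - 1) = _
  omega

open Classical in
theorem invFactDet_lower_shifted (hM : μ.rowLen M = 0) (i : Fin M) :
    (if shifted M μ i = 0 then 0
      else invFactDet (Function.update (shifted M μ) i (shifted M μ i - 1))) =
      if IsCorner μ (Fin.rev i) then invFactDet (shifted M (eraseRow μ (Fin.rev i))) else 0 := by
  by_cases hc : IsCorner μ (Fin.rev i)
  · have hpos : 0 < μ.rowLen (Fin.rev i) := Nat.zero_lt_of_lt hc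
    rw [if_pos hc, shifted_eraseRow hc, if_neg (by unfold shifted; omega)]
  · rw [if_neg hc, ite_eq_left_iff]
    exact invFactDet_lower_shifted_eq_zero hM hc

theorem numSYT_eq_factorial_mul_invFactDet (hM : μ.rowLen M = 0) :
    (numSYT μ : ℝ) = μ.card.factorial * invFactDet (shifted M μ) := by
  classical
  induction hN : μ.card generalizing μ with
  | zero =>
    rw [card_eq_zero_iff.1 hN, numSYT_bot, shifted_bot, invFactDet_val]
    simp
  | succ N ih =>
    have herase : ∀ r : Fin M, IsCorner μ r →
        (numSYT (eraseRow μ r) : ℝ) = N.factorial * invFactDet (shifted M (eraseRow μ r)) :=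
      fun r hr => ih (by rw [hr.rowLen_eraseRow, if_neg r.2.ne', hM])
        (by have := hr.card_eraseRow; omega)
    have hlower := sum_invFactDet_lower (shifted M μ)
    rw [sum_shifted hM, hN] at hlower
    calc (numSYT μ : ℝ)
        = ∑ r : Fin M, if IsCorner μ r then (numSYT (eraseRow μ r) : ℝ) else 0 := by
          rw [numSYT_eq_sum_eraseRow (by omega) hM]
          push_cast
          rfl
      _ = N.factorial * ∑ r : Fin M,
            if IsCorner μ r then invFactDet (shifted M (eraseRow μ r)) else 0 := by
          rw [Finset.mul_sum]
          refine Finset.sum_congr rfl fun r _ => ?_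
          split_ifs with hr
          · exact herase r hr
          · rw [mul_zero]
      _ = (N + 1).factorial * invFactDet (shifted M μ) := by
          rw [← Equiv.sum_comp Fin.revPerm]
          simp only [Fin.revPerm_apply, ← invFactDet_lower_shifted hM]
          rw [hlower, Nat.factorial_succ]
          push_cast
          ring

theorem val_le_of_strictMono {z : Fin M → ℕ} (hz : StrictMono z) (i : Fin M) : (i : ℕ) ≤ z i := by
  obtain ⟨i, hi⟩ := i
  induction i with
  | zero => exact Nat.zero_le _
  | succ k ih => exact (ih (by omega)).trans_lt (hz (Fin.mk_lt_mk.2 k.lt_succ_self))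

theorem monotone_sub_val_of_strictMono {z : Fin M → ℕ} (hz : StrictMono z) :
    Monotone fun i => z i - i := by
  cases M with
  | zero => exact fun i => i.elim0
  | succ m =>
    refine Fin.monotone_iff_le_succ.2 fun i => ?_
    have := hz (Fin.castSucc_lt_succ (i := i))
    simp only [Fin.val_castSucc, Fin.val_succ]
    omega

theorem exists_shifted_eq {z : Fin M → ℕ} (hz : StrictMono z) :
    ∃ μ : YoungDiagram, μ.rowLen M = 0 ∧ shifted M μ = z := by
  have hanti : Antitone fun r : Fin M => z (Fin.rev r) - Fin.rev r :=
    (monotone_sub_val_of_strictMono hz).comp_antitone Fin.rev_anti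
  have hmem : ∀ i j, (i, j) ∈ YoungDiagram.ofRowLens _ hanti.sortedGE_ofFn ↔
      ∃ h : i < M, j < z (Fin.rev ⟨i, h⟩) - Fin.rev ⟨i, h⟩ := fun i j => by
    rw [YoungDiagram.mem_ofRowLens]
    simp
  refine ⟨YoungDiagram.ofRowLens _ hanti.sortedGE_ofFn,
    rowLen_eq_of_mem_iff fun j => by rw [hmem]; simp, funext fun i => ?_⟩
  have hrow : (YoungDiagram.ofRowLens _ hanti.sortedGE_ofFn).rowLen (Fin.rev i) = z i - i :=
    rowLen_eq_of_mem_iff fun j => by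
      rw [hmem, exists_prop_of_true (Fin.rev i).2, Fin.eta, Fin.rev_rev]
  rw [shifted, hrow, Nat.sub_add_cancel (val_le_of_strictMono hz i)]

theorem shifted_injective (hμ : μ.rowLen M = 0) (hν : ν.rowLen M = 0)
    (h : shifted M μ = shifted M ν) : μ = ν := by
  refine YoungDiagram.ext (Finset.ext fun ⟨i, j⟩ => ?_)
  suffices hrow : μ.rowLen i = ν.rowLen i by
    rw [YoungDiagram.mem_cells, YoungDiagram.mem_cells, YoungDiagram.mem_iff_lt_rowLen,
      YoungDiagram.mem_iff_lt_rowLen, hrow]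
  by_cases hi : i < M
  · have := congrFun h (Fin.rev ⟨i, hi⟩)
    simpa only [shifted, Fin.rev_rev, add_left_inj] using this
  · rw [rowLen_eq_zero_of_le hμ (not_lt.1 hi), rowLen_eq_zero_of_le hν (not_lt.1 hi)]

theorem mem_youngDiagrams {N : ℕ} : μ ∈ youngDiagrams N ↔ μ.card = N := by
  simp [youngDiagrams]

theorem shifted_comp_perm_injective {σ τ : Equiv.Perm (Fin M)} (hμ : μ.rowLen M = 0)
    (hν : ν.rowLen M = 0) (h : shifted M μ ∘ σ = shifted M ν ∘ τ) : σ = τ ∧ μ = ν := by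
  have hrange : Set.range (shifted M μ) = Set.range (shifted M ν) := by
    rw [← σ.surjective.range_comp, h, τ.surjective.range_comp]
  obtain rfl := shifted_injective hμ hν
    (((shifted_strictMono M μ).range_inj (shifted_strictMono M ν)).1 hrange)
  exact ⟨Equiv.ext fun i => (shifted_strictMono M μ).injective (congrFun h i), rfl⟩

theorem exists_shifted_comp_perm_eq {z : Fin M → ℕ} (hz : Function.Injective z) :
    ∃ (σ : Equiv.Perm (Fin M)) (μ : YoungDiagram), μ.rowLen M = 0 ∧ shifted M μ ∘ σ = z := by
  obtain ⟨μ, hM, hμ⟩ := exists_shifted_eq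
    ((Tuple.monotone_sort z).strictMono_of_injective (hz.comp (Tuple.sort z).injective))
  exact ⟨(Tuple.sort z).symm, μ, hM, by ext i; simp [hμ]⟩

theorem sum_shifted_comp_perm (hM : μ.rowLen M = 0) (σ : Equiv.Perm (Fin M)) :
    Finset.univ.sum (shifted M μ ∘ σ) = μ.card + staircase M := by
  rw [← sum_shifted hM]
  exact Equiv.sum_comp σ (shifted M μ)

-- An injective sequence is, in exactly one way, a rearrangement of the shifted rows of a diagram.
theorem sum_piAntidiag_eq_factorial_mul_sum {R : Type*} [Semiring R] (M N : ℕ)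
    (g : (Fin M → ℕ) → R) (hsymm : ∀ z (σ : Equiv.Perm (Fin M)), g (z ∘ σ) = g z)
    (hinj : ∀ z, g z ≠ 0 → Function.Injective z) :
    ∑ z ∈ Finset.piAntidiag (Finset.univ : Finset (Fin M)) (N + staircase M), g z =
      M.factorial * ∑ μ ∈ youngDiagrams N with μ.rowLen M = 0, g (shifted M μ) := by
  classical
  have hperm : (M.factorial : R) *
      ∑ μ ∈ youngDiagrams N with μ.rowLen M = 0, g (shifted M μ) =
      ∑ p ∈ (Finset.univ : Finset (Equiv.Perm (Fin M))) ×ˢ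
        (youngDiagrams N).filter fun μ => μ.rowLen M = 0, g (shifted M p.2 ∘ p.1) := by
    rw [Finset.sum_product]
    simp_rw [hsymm]
    simp [Fintype.card_perm]
  rw [hperm, ← Finset.sum_filter_of_ne (p := Function.Injective) fun z _ h => hinj z h]
  symm
  refine Finset.sum_bij (fun p _ => shifted M p.2 ∘ p.1) ?_ ?_ ?_ fun _ _ => rfl
  all_goals simp only [Finset.mem_product, Finset.mem_filter, Finset.mem_piAntidiag,
    mem_youngDiagrams, Finset.mem_univ, true_and, implies_true, and_true]
  · rintro ⟨σ, μ⟩ ⟨hN, hM⟩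
    exact ⟨by rw [sum_shifted_comp_perm hM, hN],
      (shifted_strictMono M μ).injective.comp σ.injective⟩
  · rintro ⟨σ, μ⟩ ⟨-, hμ⟩ ⟨τ, ν⟩ ⟨-, hν⟩ heq
    exact Prod.ext_iff.2 (shifted_comp_perm_injective hμ hν heq)
  · rintro z ⟨hsum, hz⟩
    obtain ⟨σ, μ, hM, rfl⟩ := exists_shifted_comp_perm_eq hz
    rw [sum_shifted_comp_perm hM] at hsum
    exact ⟨(σ, μ), ⟨Nat.add_right_cancel hsum, hM⟩, rfl⟩

end Shifted

theorem sqSum_eq_factorial_mul_sum_numSYT (M N : ℕ) :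
    sqSum M N = M.factorial *
      ∑ μ ∈ youngDiagrams N with μ.rowLen M = 0, ((numSYT μ : ℝ) / N.factorial) ^ 2 := by
  rw [sqSum, sum_piAntidiag_eq_factorial_mul_sum M N (fun z => invFactDet z ^ 2)
    invFactDet_comp_perm_sq fun z hz =>
      injective_of_invFactDet_ne_zero ((pow_ne_zero_iff two_ne_zero).1 hz)]
  congr 1
  refine Finset.sum_congr rfl fun μ hμ => ?_
  obtain ⟨hN, hM⟩ := Finset.mem_filter.1 hμ
  rw [mem_youngDiagrams] at hN
  rw [numSYT_eq_factorial_mul_invFactDet hM, hN, mul_div_cancel_left₀ _ (by positivity)]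

theorem filter_rowLen_eq_zero {M N : ℕ} (h : N ≤ M) :
    (youngDiagrams N).filter (fun μ => μ.rowLen M = 0) = youngDiagrams N :=
  Finset.filter_true_of_mem fun _ hμ =>
    rowLen_eq_zero_of_card_le ((mem_youngDiagrams.1 hμ).trans_le h)

theorem sqSum_zero (M : ℕ) : sqSum M 0 = M.factorial := by
  have hbot : youngDiagrams 0 = {⊥} := by
    ext μ
    rw [mem_youngDiagrams, Finset.mem_singleton, card_eq_zero_iff]
  rw [sqSum_eq_factorial_mul_sum_numSYT, filter_rowLen_eq_zero M.zero_le, hbot,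
    Finset.sum_singleton, numSYT_bot]
  simp

theorem sqSum_eq_factorial_div {M N : ℕ} (h : N ≤ M) :
    sqSum M N = M.factorial / N.factorial := by
  induction N with
  | zero => rw [sqSum_zero, Nat.factorial_zero, Nat.cast_one, div_one]
  | succ N ih =>
    have hsucc := add_one_mul_sqSum_succ (Nat.lt_of_succ_le h)
    rw [ih (by omega)] at hsucc
    rw [Nat.factorial_succ, Nat.cast_mul, Nat.cast_succ, mul_comm, ← div_div, ← hsucc,
      mul_div_cancel_left₀ _ (by positivity)]

theorem sum_numSYT_sq (N : ℕ) : ∑ μ ∈ youngDiagrams N, (numSYT μ : ℝ) ^ 2 = N.factorial := by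
  have hN : (N.factorial : ℝ) ≠ 0 := by positivity
  have h := sqSum_eq_factorial_mul_sum_numSYT N N
  rw [sqSum_eq_factorial_div le_rfl, filter_rowLen_eq_zero le_rfl, div_self hN] at h
  simp only [div_pow, ← Finset.sum_div] at h
  field_simp at h
  exact h.symm

/-! ### Weighted determinants as sums over Young diagrams -/

/-- `v ^ (y - i) / (y - i)!`, which is zero for `y < i`. -/
def powFact (v : ℝ) (y i : ℕ) : ℝ := v ^ (y - i) * invFact y i

theorem det_powFact {M : ℕ} (v : ℝ) (z : Fin M → ℕ) :
    (Matrix.of fun r i : Fin M => powFact v (z r) i).det =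
      v ^ (∑ r, z r - staircase M) * invFactDet z := by
  rw [← Matrix.det_transpose, Matrix.det_apply', invFactDet, ← Matrix.det_transpose,
    Matrix.det_apply', Finset.mul_sum]
  refine Finset.sum_congr rfl fun σ _ => ?_
  simp only [Matrix.transpose_apply, Matrix.of_apply, invFactMatrix, powFact,
    Finset.prod_mul_distrib, Finset.prod_pow_eq_pow_sum]
  by_cases h : ∀ r, (σ r : ℕ) ≤ z r
  · have hexp : ∑ r, (z r - (σ r : ℕ)) = ∑ r, z r - staircase M := by
      rw [Finset.sum_tsub_distrib _ fun r _ => h r, staircase,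
        Equiv.sum_comp σ fun i => (i : ℕ)]
    rw [hexp, mul_left_comm]
  · push Not at h
    obtain ⟨r, hr⟩ := h
    rw [Finset.prod_eq_zero (Finset.mem_univ r) (if_neg (not_le.2 hr)), mul_zero, mul_zero,
      mul_zero]

theorem summable_abs_powFact (v : ℝ) (i : ℕ) : Summable fun y => |powFact v y i| := by
  rw [← summable_nat_add_iff i]
  refine (Real.summable_pow_div_factorial v).abs.congr fun y => ?_
  simp [powFact, invFact, div_eq_mul_inv]

section WeightedDet

variable {M : ℕ} (w : ℕ → ℝ) (v : ℝ)

/-- The determinant of the `M × M` matrix `∑_y w(y) v^{y-i} v^{y-j} / ((y-i)! (y-j)!)`. -/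
def weightedDet (M : ℕ) (w : ℕ → ℝ) (v : ℝ) : ℝ :=
  (Matrix.of fun i j : Fin M => ∑' y, w y * powFact v y i * powFact v y j).det

/-- The summand at `z` of the Andréief expansion of `M! * weightedDet M w v`. -/
def weightedTerm (w : ℕ → ℝ) (v : ℝ) (z : Fin M → ℕ) : ℝ :=
  (∏ r, w (z r)) * ((v ^ 2) ^ (∑ r, z r - staircase M) * invFactDet z ^ 2)

variable {w} in
theorem summable_weight_mul_powFact (hw : ∀ y, |w y| ≤ 1) (i j : ℕ) :
    Summable fun y => w y * powFact v y i * powFact v y j := by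
  refine Summable.of_norm_bounded
    ((summable_abs_powFact v j).mul_left (∑' k, |powFact v k i|)) fun y => ?_
  have hi : |powFact v y i| ≤ ∑' k, |powFact v k i| :=
    (summable_abs_powFact v i).le_tsum y fun _ _ => abs_nonneg _
  rw [Real.norm_eq_abs, abs_mul, abs_mul]
  refine mul_le_mul_of_nonneg_right ?_ (abs_nonneg _)
  exact (mul_le_of_le_one_left (abs_nonneg _) (hw y)).trans hi

theorem factorial_mul_det_sum (s : Finset ℕ) :
    M.factorial * (Matrix.of fun i j : Fin M =>
      ∑ y ∈ s, w y * powFact v y i * powFact v y j).det =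
      ∑ z ∈ Fintype.piFinset fun _ : Fin M => s, weightedTerm w v z := by
  have handreief := sum_det_mul_det_eq_factorial_mul_det (n := Fin M) s
    (fun y i => w y * powFact v y i) fun y i => powFact v y i
  rw [Fintype.card_fin] at handreief
  rw [← handreief]
  refine Finset.sum_congr rfl fun z _ => ?_
  have hcol := Matrix.det_mul_column (fun r => w (z r))
    (Matrix.of fun r i : Fin M => powFact v (z r) i)
  simp only [Matrix.of_apply] at hcol
  rw [hcol, det_powFact, weightedTerm, ← pow_mul, mul_comm 2, pow_mul]
  ring

theorem staircase_le_sum_of_weightedTerm_ne_zero {z : Fin M → ℕ} (h : weightedTerm w v z ≠ 0) :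
    staircase M ≤ ∑ r, z r := by
  by_contra! hlt
  exact h (by simp [weightedTerm, invFactDet_eq_zero_of_sum_lt hlt])

end WeightedDet

theorem hasSum_sum_filter_eq_add {ι R : Type*} [AddCommMonoid R] [TopologicalSpace R]
    [ContinuousAdd R] (s : Finset ι) (g : ι → ℕ) (c : ℕ) (f : ι → R)
    (h : ∀ z ∈ s, f z ≠ 0 → c ≤ g z) :
    HasSum (fun N => ∑ z ∈ s with g z = N + c, f z) (∑ z ∈ s, f z) := by
  simp only [Finset.sum_filter]
  refine hasSum_sum fun z hz => ?_
  by_cases hfz : f z = 0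
  · simpa only [hfz, ite_self] using hasSum_zero
  · have hc := h z hz hfz
    convert hasSum_single (f := fun N => if g z = N + c then f z else 0) (g z - c)
      fun N hN => if_neg (by omega) using 1
    rw [if_pos (by omega)]

theorem filter_piFinset_range_eq_piAntidiag {ι : Type*} [Fintype ι] [DecidableEq ι] {K L : ℕ}
    (h : K < L) :
    ((Fintype.piFinset fun _ : ι => Finset.range L).filter fun z => ∑ r, z r = K) =
      Finset.piAntidiag Finset.univ K := by
  ext z
  simp only [Finset.mem_piAntidiag, Finset.mem_univ, implies_true, and_true, Finset.mem_filter,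
    Fintype.mem_piFinset, Finset.mem_range, and_iff_right_iff_imp]
  intro hz r
  exact (Finset.single_le_sum (fun _ _ => Nat.zero_le _) (Finset.mem_univ r)).trans_lt (hz ▸ h)

/-- `∑ (d_μ / N!)² f(μ)` over the Young diagrams `μ` with `N` boxes, that is, the Plancherel average
of `f` divided by `N!`. -/
def plancherelSum (N : ℕ) (f : YoungDiagram → ℝ) : ℝ :=
  ∑ μ ∈ youngDiagrams N, ((numSYT μ : ℝ) / N.factorial) ^ 2 * f μ

theorem plancherelSum_const (N : ℕ) (C : ℝ) :
    plancherelSum N (fun _ => C) = C / N.factorial := by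
  have hN : (N.factorial : ℝ) ≠ 0 := by positivity
  simp only [plancherelSum, div_pow, ← Finset.sum_mul, ← Finset.sum_div, sum_numSYT_sq]
  field_simp

theorem plancherelSum_mono {N : ℕ} {f g : YoungDiagram → ℝ} (h : ∀ μ, f μ ≤ g μ) :
    plancherelSum N f ≤ plancherelSum N g :=
  Finset.sum_le_sum fun μ _ => mul_le_mul_of_nonneg_left (h μ) (by positivity)

theorem abs_plancherelSum_le {N : ℕ} {f : YoungDiagram → ℝ} {C : ℝ} (hf : ∀ μ, |f μ| ≤ C) :
    |plancherelSum N f| ≤ C / N.factorial :=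
  calc |plancherelSum N f| ≤ plancherelSum N fun μ => |f μ| := by
        refine (Finset.abs_sum_le_sum_abs _ _).trans_eq (Finset.sum_congr rfl fun μ _ => ?_)
        rw [abs_mul, abs_of_nonneg (by positivity)]
    _ ≤ plancherelSum N fun _ => C := plancherelSum_mono hf
    _ = C / N.factorial := plancherelSum_const N C

theorem plancherelSum_sub (N : ℕ) (f g : YoungDiagram → ℝ) :
    plancherelSum N (fun μ => f μ - g μ) = plancherelSum N f - plancherelSum N g := by
  simp only [plancherelSum, mul_sub, Finset.sum_sub_distrib]

theorem plancherelSum_mul_left (N : ℕ) (c : ℝ) (f : YoungDiagram → ℝ) :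
    plancherelSum N (fun μ => c * f μ) = c * plancherelSum N f := by
  simp only [plancherelSum, Finset.mul_sum, mul_left_comm]

theorem sqSum_le (M N : ℕ) : sqSum M N ≤ M.factorial / N.factorial := by
  have hrows : ∑ μ ∈ youngDiagrams N with μ.rowLen M = 0, ((numSYT μ : ℝ) / N.factorial) ^ 2 ≤
      1 / N.factorial := by
    rw [← plancherelSum_const, plancherelSum]
    simp only [mul_one]
    exact Finset.sum_le_sum_of_subset_of_nonneg (Finset.filter_subset _ _)
      fun _ _ _ => by positivity
  rw [sqSum_eq_factorial_mul_sum_numSYT, div_eq_mul_one_div]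
  exact mul_le_mul_of_nonneg_left hrows (by positivity)

section BoundedWeight

variable {M : ℕ} {w : ℕ → ℝ}

theorem weightedTerm_of_mem_piAntidiag (w : ℕ → ℝ) (v : ℝ) {N : ℕ} {z : Fin M → ℕ}
    (hz : z ∈ Finset.piAntidiag Finset.univ (N + staircase M)) :
    weightedTerm w v z = (∏ r, w (z r)) * ((v ^ 2) ^ N * invFactDet z ^ 2) := by
  rw [weightedTerm, (Finset.mem_piAntidiag.1 hz).1, Nat.add_sub_cancel]

theorem abs_sum_weightedTerm_le (hw : ∀ y, |w y| ≤ 1) (v : ℝ) {N : ℕ}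
    {s : Finset (Fin M → ℕ)}
    (hs : s ⊆ Finset.piAntidiag Finset.univ (N + staircase M)) :
    |∑ z ∈ s, weightedTerm w v z| ≤ M.factorial * ((v ^ 2) ^ N / N.factorial) := by
  have hterm : ∀ z ∈ s, |weightedTerm w v z| ≤ (v ^ 2) ^ N * invFactDet z ^ 2 := fun z hz => by
    rw [weightedTerm_of_mem_piAntidiag w v (hs hz), abs_mul,
      abs_of_nonneg (by positivity : 0 ≤ (v ^ 2) ^ N * invFactDet z ^ 2), Finset.abs_prod]
    exact mul_le_of_le_one_left (by positivity)
      (Finset.prod_le_one (fun _ _ => abs_nonneg _) fun r _ => hw (z r))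
  calc |∑ z ∈ s, weightedTerm w v z|
      ≤ ∑ z ∈ s, (v ^ 2) ^ N * invFactDet z ^ 2 :=
        (Finset.abs_sum_le_sum_abs _ _).trans (Finset.sum_le_sum hterm)
    _ ≤ (v ^ 2) ^ N * sqSum M N := by
        rw [sqSum, Finset.mul_sum]
        exact Finset.sum_le_sum_of_subset_of_nonneg hs fun z _ _ => by positivity
    _ ≤ (v ^ 2) ^ N * (M.factorial / N.factorial) :=
        mul_le_mul_of_nonneg_left (sqSum_le M N) (by positivity)
    _ = M.factorial * ((v ^ 2) ^ N / N.factorial) := by ring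

theorem tendsto_det_sum_range (hw : ∀ y, |w y| ≤ 1) (v : ℝ) :
    Tendsto (fun L : ℕ => (Matrix.of fun i j : Fin M =>
      ∑ y ∈ Finset.range L, w y * powFact v y i * powFact v y j).det) atTop
      (𝓝 (weightedDet M w v)) := by
  have hdet : Continuous fun A : Matrix (Fin M) (Fin M) ℝ => A.det := continuous_id.matrix_det
  refine (hdet.tendsto _).comp (tendsto_pi_nhds.2 fun i => tendsto_pi_nhds.2 fun j => ?_)
  exact (summable_weight_mul_powFact v hw i j).hasSum.tendsto_sum_nat

theorem factorial_mul_weightedDet (hw : ∀ y, |w y| ≤ 1) (v : ℝ) :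
    M.factorial * weightedDet M w v =
      ∑' N, ∑ z ∈ Finset.piAntidiag (Finset.univ : Finset (Fin M)) (N + staircase M),
        weightedTerm w v z := by
  let box : ℕ → Finset (Fin M → ℕ) := fun L => Fintype.piFinset fun _ => Finset.range L
  have hbox : ∀ L, M.factorial * (Matrix.of fun i j : Fin M =>
      ∑ y ∈ Finset.range L, w y * powFact v y i * powFact v y j).det =
      ∑' N, ∑ z ∈ box L with ∑ r, z r = N + staircase M, weightedTerm w v z := fun L => by
    rw [factorial_mul_det_sum]
    exact (hasSum_sum_filter_eq_add (box L) (fun z => ∑ r, z r) _ _ fun z _ hz =>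
      staircase_le_sum_of_weightedTerm_ne_zero w v hz).tsum_eq.symm
  refine tendsto_nhds_unique
    (((tendsto_det_sum_range hw v).const_mul (M.factorial : ℝ)).congr hbox)
    (tendsto_tsum_of_dominated_convergence
      ((Real.summable_pow_div_factorial (v ^ 2)).mul_left (M.factorial : ℝ)) (fun N => ?_)
      (Eventually.of_forall fun L N => abs_sum_weightedTerm_le hw v fun z hz => ?_))
  · refine tendsto_const_nhds.congr' ?_
    filter_upwards [eventually_gt_atTop (N + staircase M)] with L hL
    rw [filter_piFinset_range_eq_piAntidiag hL]
  · simpa using (Finset.mem_filter.1 hz).2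

theorem weightedDet_eq_tsum (hw : ∀ y, |w y| ≤ 1) (v : ℝ) :
    weightedDet M w v = ∑' N : ℕ, (v ^ 2) ^ N *
      plancherelSum N fun μ => if μ.rowLen M = 0 then ∏ i, w (shifted M μ i) else 0 := by
  have hM : (M.factorial : ℝ) ≠ 0 := by positivity
  refine mul_left_cancel₀ hM ?_
  rw [factorial_mul_weightedDet hw v, ← tsum_mul_left]
  refine tsum_congr fun N => ?_
  rw [Finset.sum_congr rfl fun z hz => weightedTerm_of_mem_piAntidiag w v hz,
    sum_piAntidiag_eq_factorial_mul_sum M N fun z =>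
      (∏ r, w (z r)) * ((v ^ 2) ^ N * invFactDet z ^ 2)]
  · simp only [plancherelSum, mul_ite, mul_zero, ← Finset.sum_filter]
    rw [Finset.mul_sum ((youngDiagrams N).filter _) _ ((v ^ 2) ^ N)]
    congr 1
    refine Finset.sum_congr rfl fun μ hμ => ?_
    obtain ⟨hN, hrow⟩ := Finset.mem_filter.1 hμ
    rw [numSYT_eq_factorial_mul_invFactDet hrow, mem_youngDiagrams.1 hN,
      mul_div_cancel_left₀ _ (by positivity)]
    ring
  · intro z σ
    rw [invFactDet_comp_perm_sq]
    exact congrArg (· * _) (Equiv.prod_comp σ fun r => w (z r))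
  · exact fun z hz => injective_of_invFactDet_ne_zero fun h => hz (by simp [h])

end BoundedWeight

/-! ### Rows exceeding the staircase, and their Poissonized distribution -/

/-- The weight `1 - t` on `y ≥ M + n` and `1` elsewhere. -/
def tailWeight (M n : ℕ) (t : ℝ) (y : ℕ) : ℝ := if M + n ≤ y then 1 - t else 1

theorem abs_tailWeight_le {M n : ℕ} {t : ℝ} (ht : |1 - t| ≤ 1) (y : ℕ) :
    |tailWeight M n t y| ≤ 1 := by
  unfold tailWeight
  split_ifs <;> simp [ht]

/-- The number of rows `r` (counted from `0`) of `μ` with `μ_r - r - 1 ≥ n`. -/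
def exceed (n : ℕ) (μ : YoungDiagram) : ℕ :=
  ((Finset.range (μ.colLen 0)).filter fun r => n + 1 + r ≤ μ.rowLen r).card

section Exceed

variable {n : ℕ} {μ : YoungDiagram}

theorem filter_range_exceed_eq {M : ℕ} (hM : μ.rowLen M = 0) :
    ((Finset.range (μ.colLen 0)).filter fun r => n + 1 + r ≤ μ.rowLen r) =
      (Finset.range M).filter fun r => n + 1 + r ≤ μ.rowLen r := by
  ext r
  simp only [Finset.mem_filter, Finset.mem_range, and_congr_left_iff]
  intro hr
  have hcol : r < μ.colLen 0 := by
    rw [← YoungDiagram.mem_iff_lt_colLen, YoungDiagram.mem_iff_lt_rowLen]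
    omega
  have hlt : r < M := by
    by_contra! hle
    have := rowLen_eq_zero_of_le hM hle
    omega
  exact iff_of_true hcol hlt

theorem prod_tailWeight_shifted {M : ℕ} {t : ℝ} (hM : μ.rowLen M = 0) :
    ∏ i, tailWeight M n t (shifted M μ i) = (1 - t) ^ exceed n μ := by
  have hweight : ∀ r : Fin M, tailWeight M n t (shifted M μ (Fin.revPerm r)) =
      if n + 1 + r ≤ μ.rowLen r then 1 - t else 1 := fun r => by
    simp only [tailWeight, shifted, Fin.revPerm_apply, Fin.rev_rev, Fin.val_rev]
    exact if_congr (by omega) rfl rfl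
  rw [← Equiv.prod_comp Fin.revPerm, Finset.prod_congr rfl fun r _ => hweight r,
    Fin.prod_univ_eq_prod_range (fun r => if n + 1 + r ≤ μ.rowLen r then 1 - t else 1),
    Finset.prod_ite, Finset.prod_const, Finset.prod_const_one, mul_one, exceed,
    filter_range_exceed_eq hM]

theorem exceed_eq_zero_iff : exceed n μ = 0 ↔ μ.rowLen 0 ≤ n := by
  have hM := rowLen_eq_zero_of_card_le (μ := μ) (M := μ.card + 1) (Nat.le_succ _)
  rw [exceed, filter_range_exceed_eq hM, Finset.card_eq_zero, Finset.filter_eq_empty_iff]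
  constructor
  · intro h
    have := h (x := 0) (by simp)
    omega
  · intro h r _ hr
    have := μ.rowLen_anti 0 r (Nat.zero_le _)
    omega

theorem exceed_le_one_iff : exceed n μ ≤ 1 ↔ μ.rowLen 1 ≤ n + 1 := by
  have hM := rowLen_eq_zero_of_card_le (μ := μ) (M := μ.card + 2) (by omega)
  rw [exceed, filter_range_exceed_eq hM]
  constructor
  · intro h
    by_contra! hlt
    have hanti := μ.rowLen_anti 0 1 (Nat.zero_le _)
    refine absurd (Finset.card_le_one.1 h 0 ?_ 1 ?_) zero_ne_one <;>
      exact Finset.mem_filter.2 ⟨Finset.mem_range.2 (by omega), by omega⟩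
  · intro h
    refine (Finset.card_le_card (t := {0}) fun r hr => ?_).trans (Finset.card_singleton 0).le
    rw [Finset.mem_singleton]
    by_contra hne
    have hanti := μ.rowLen_anti 1 r (by omega)
    have := (Finset.mem_filter.1 hr).2
    omega

end Exceed

/-- The expectation of `f` under the Poissonized Plancherel measure of parameter `lam`. -/
def poissonAvg (lam : ℝ) (f : YoungDiagram → ℝ) : ℝ :=
  Real.exp (-lam) * ∑' N : ℕ, lam ^ N * plancherelSum N f

/-- The generating function `E[(1 - t) ^ exceed]` under the Poissonized Plancherel measure. -/
def poissonGen (n : ℕ) (lam t : ℝ) : ℝ := poissonAvg lam fun μ => (1 - t) ^ exceed n μ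

theorem tsum_pow_mul_plancherelSum_one (lam : ℝ) :
    ∑' N : ℕ, lam ^ N * plancherelSum N (fun _ => 1) = Real.exp lam := by
  simp only [plancherelSum_const, mul_one_div]
  rw [Real.exp_eq_exp_ℝ, NormedSpace.exp_eq_tsum_div]

theorem tendsto_weightedDet_tailWeight {n : ℕ} {t : ℝ} (ht : |1 - t| ≤ 1) (v : ℝ) :
    Tendsto (fun M => weightedDet M (tailWeight M n t) v) atTop
      (𝓝 (∑' N : ℕ, (v ^ 2) ^ N * plancherelSum N fun μ => (1 - t) ^ exceed n μ)) := by
  simp only [weightedDet_eq_tsum (abs_tailWeight_le ht)]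
  refine tendsto_tsum_of_dominated_convergence (Real.summable_pow_div_factorial (v ^ 2))
    (fun N => ?_) (Eventually.of_forall fun M N => ?_)
  · refine tendsto_const_nhds.congr' ?_
    filter_upwards [eventually_ge_atTop N] with M hM
    refine congrArg _ (Finset.sum_congr rfl fun μ hμ => ?_)
    have hrow := rowLen_eq_zero_of_card_le ((mem_youngDiagrams.1 hμ).trans_le hM)
    simp only [if_pos hrow, prod_tailWeight_shifted hrow]
  · rw [norm_mul, Real.norm_of_nonneg (by positivity), Real.norm_eq_abs, div_eq_mul_one_div]
    refine mul_le_mul_of_nonneg_left (abs_plancherelSum_le fun μ => ?_) (by positivity)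
    split_ifs with hrow
    · rw [prod_tailWeight_shifted hrow, abs_pow]
      exact pow_le_one₀ (abs_nonneg _) ht
    · simp

theorem tendsto_weightedDet_ratio {n : ℕ} {t : ℝ} (ht : |1 - t| ≤ 1) (v : ℝ) :
    Tendsto (fun M => weightedDet M (tailWeight M n t) v / weightedDet M (tailWeight M n 0) v)
      atTop (𝓝 (poissonGen n (v ^ 2) t)) := by
  have hden := tendsto_weightedDet_tailWeight (n := n) (t := 0) (by simp) v
  simp only [sub_zero, one_pow, tsum_pow_mul_plancherelSum_one] at hden
  have hratio := (tendsto_weightedDet_tailWeight (n := n) ht v).div hden (Real.exp_pos _).ne'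
  rwa [div_eq_inv_mul (tsum _), ← Real.exp_neg] at hratio

section PoissonAvg

variable {lam : ℝ} {f g : YoungDiagram → ℝ} {C D : ℝ}

theorem norm_pow_mul_plancherelSum_le (hlam : 0 ≤ lam) (hf : ∀ μ, |f μ| ≤ C) (N : ℕ) :
    ‖lam ^ N * plancherelSum N f‖ ≤ C * (lam ^ N / N.factorial) := by
  rw [norm_mul, Real.norm_of_nonneg (by positivity), Real.norm_eq_abs, mul_div_left_comm]
  exact mul_le_mul_of_nonneg_left (abs_plancherelSum_le hf) (by positivity)

theorem summable_pow_mul_plancherelSum (hlam : 0 ≤ lam) (hf : ∀ μ, |f μ| ≤ C) :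
    Summable fun N : ℕ => lam ^ N * plancherelSum N f :=
  .of_norm_bounded ((Real.summable_pow_div_factorial lam).mul_left C)
    (norm_pow_mul_plancherelSum_le hlam hf)

theorem abs_poissonAvg_le (hlam : 0 ≤ lam) (hf : ∀ μ, |f μ| ≤ C) : |poissonAvg lam f| ≤ C := by
  have hexp : HasSum (fun N : ℕ => C * (lam ^ N / N.factorial)) (C * Real.exp lam) := by
    rw [Real.exp_eq_exp_ℝ]
    exact (NormedSpace.expSeries_div_hasSum_exp lam).mul_left C
  calc |poissonAvg lam f|
      = Real.exp (-lam) * ‖∑' N : ℕ, lam ^ N * plancherelSum N f‖ := by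
        rw [poissonAvg, abs_mul, Real.abs_exp, Real.norm_eq_abs]
    _ ≤ Real.exp (-lam) * (C * Real.exp lam) :=
        mul_le_mul_of_nonneg_left
          (tsum_of_norm_bounded hexp (norm_pow_mul_plancherelSum_le hlam hf)) (Real.exp_pos _).le
    _ = C := by rw [mul_left_comm, ← Real.exp_add, neg_add_cancel, Real.exp_zero, mul_one]

theorem poissonAvg_sub (hlam : 0 ≤ lam) (hf : ∀ μ, |f μ| ≤ C) (hg : ∀ μ, |g μ| ≤ D) :
    poissonAvg lam (fun μ => f μ - g μ) = poissonAvg lam f - poissonAvg lam g := by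
  simp only [poissonAvg, plancherelSum_sub, mul_sub]
  rw [(summable_pow_mul_plancherelSum hlam hf).tsum_sub (summable_pow_mul_plancherelSum hlam hg),
    mul_sub]

theorem poissonAvg_mul_left (lam c : ℝ) (f : YoungDiagram → ℝ) :
    poissonAvg lam (fun μ => c * f μ) = c * poissonAvg lam f := by
  simp only [poissonAvg, plancherelSum_mul_left, mul_left_comm _ c, tsum_mul_left]

end PoissonAvg

theorem abs_ite_one_zero_le (p : Prop) [Decidable p] : |if p then (1 : ℝ) else 0| ≤ 1 := by
  split_ifs <;> simp

theorem poissonRow_eq_poissonAvg (k n : ℕ) (lam : ℝ) :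
    poissonRow k n lam = poissonAvg lam fun μ => if μ.rowLen (k - 1) ≤ n then 1 else 0 := by
  simp only [poissonRow, rowProb, poissonAvg, plancherelSum, ← tsum_mul_left, Finset.mul_sum,
    Finset.sum_filter]
  refine tsum_congr fun N => Finset.sum_congr rfl fun μ _ => ?_
  split_ifs
  · rw [div_pow]
    ring
  · simp

theorem poissonRow_one_eq_poissonGen (n : ℕ) (lam : ℝ) :
    poissonRow 1 n lam = poissonGen n lam 1 := by
  simp only [poissonRow_eq_poissonAvg, poissonGen, sub_self, zero_pow_eq, exceed_eq_zero_iff]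

theorem poissonRow_two_sub_poissonRow_one (n : ℕ) {lam : ℝ} (hlam : 0 ≤ lam) :
    poissonRow 2 (n + 1) lam - poissonRow 1 n lam =
      poissonAvg lam fun μ => if exceed n μ = 1 then 1 else 0 := by
  rw [poissonRow_eq_poissonAvg, poissonRow_eq_poissonAvg,
    ← poissonAvg_sub hlam (fun _ => abs_ite_one_zero_le _) fun _ => abs_ite_one_zero_le _]
  congr 1
  ext μ
  simp only [Nat.add_one_sub_one, Nat.sub_self, ← exceed_le_one_iff, ← exceed_eq_zero_iff]
  rcases exceed n μ with _ | _ | e <;> simp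

theorem abs_pow_sub_zero_pow_sub_le {τ : ℝ} (hτ : |τ| ≤ 1) (e : ℕ) :
    |τ ^ e - 0 ^ e - τ * (if e = 1 then 1 else 0)| ≤ τ ^ 2 := by
  rcases e with _ | _ | e
  · simpa using sq_nonneg τ
  · simpa using sq_nonneg τ
  · rw [if_neg (by omega), mul_zero, sub_zero, zero_pow (by omega), sub_zero, abs_pow, ← sq_abs τ]
    exact pow_le_pow_of_le_one (abs_nonneg τ) hτ (by omega)

theorem abs_poissonGen_sub_sub_le (n : ℕ) {lam t : ℝ} (hlam : 0 ≤ lam) (ht : |1 - t| ≤ 1) :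
    |poissonGen n lam t - poissonGen n lam 1 -
      (1 - t) * (poissonRow 2 (n + 1) lam - poissonRow 1 n lam)| ≤ (1 - t) ^ 2 := by
  have hpow : ∀ τ : ℝ, |τ| ≤ 1 → ∀ μ, |τ ^ exceed n μ| ≤ 1 := fun τ hτ μ => by
    rw [abs_pow]
    exact pow_le_one₀ (abs_nonneg _) hτ
  have hone : |(1 : ℝ) - 1| ≤ 1 := by simp
  rw [poissonRow_two_sub_poissonRow_one n hlam, poissonGen, poissonGen, ← poissonAvg_mul_left,
    ← poissonAvg_sub hlam (hpow _ ht) (hpow _ hone),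
    ← poissonAvg_sub (C := 1 + 1) (D := |1 - t| * 1) hlam]
  · refine abs_poissonAvg_le hlam fun μ => ?_
    rw [sub_self]
    exact abs_pow_sub_zero_pow_sub_le ht _
  · exact fun μ => (abs_sub _ _).trans (add_le_add (hpow _ ht μ) (hpow _ hone μ))
  · intro μ
    rw [abs_mul]
    exact mul_le_mul_of_nonneg_left (abs_ite_one_zero_le _) (abs_nonneg _)

theorem hasDerivAt_poissonGen (n : ℕ) {lam : ℝ} (hlam : 0 ≤ lam) :
    HasDerivAt (poissonGen n lam) (-(poissonRow 2 (n + 1) lam - poissonRow 1 n lam)) 1 := by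
  rw [hasDerivAt_iff_isLittleO]
  refine (Asymptotics.IsBigO.of_bound 1 ?_).trans_isLittleO
    (Asymptotics.isLittleO_pow_sub_sub (1 : ℝ) one_lt_two)
  filter_upwards [Metric.ball_mem_nhds (1 : ℝ) one_pos] with t ht
  rw [Metric.mem_ball, Real.dist_eq, abs_sub_comm] at ht
  have hbound := abs_poissonGen_sub_sub_le n hlam ht.le
  rw [one_mul, smul_eq_mul, Real.norm_eq_abs, Real.norm_eq_abs, Real.norm_eq_abs, abs_pow,
    abs_abs, sq_abs, ← neg_sub 1 t, neg_mul_neg, neg_sq]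
  exact hbound

/-! ### The Fourier basis and multiplication operators on the circle -/

/-- The normalized monomial `z^k / √(2π)` as a continuous function. -/
def monomial (k : ℤ) : C(Angle, ℂ) := ((Real.sqrt (2 * Real.pi))⁻¹ : ℂ) • fourier k

/-- The class of a continuous function in `L²`. -/
abbrev toL2 : C(Angle, ℂ) →L[ℂ] L2Circle := ContinuousMap.toLp 2 volume ℂ

theorem sqrt_two_pi_ne_zero : (Real.sqrt (2 * Real.pi) : ℂ) ≠ 0 :=
  Complex.ofReal_ne_zero.2 (Real.sqrt_pos.2 Real.two_pi_pos).ne'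

theorem sqrt_two_pi_inv_mul_self :
    ((Real.sqrt (2 * Real.pi))⁻¹ : ℂ) * ((Real.sqrt (2 * Real.pi))⁻¹ : ℂ) * (2 * Real.pi) = 1 := by
  have hsq : (Real.sqrt (2 * Real.pi) : ℂ) * Real.sqrt (2 * Real.pi) = 2 * Real.pi := by
    exact_mod_cast Real.mul_self_sqrt Real.two_pi_pos.le
  rw [← hsq]
  field_simp [sqrt_two_pi_ne_zero]

theorem orthonormal_monomial : Orthonormal ℂ fun k => toL2 (monomial k) := by
  rw [orthonormal_iff_ite]
  intro i j
  have hprod : ∀ x : Angle, monomial j x * (starRingEnd ℂ) (monomial i x) =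
      ((Real.sqrt (2 * Real.pi))⁻¹ : ℂ) * ((Real.sqrt (2 * Real.pi))⁻¹ : ℂ) *
        fourier (j + -i) x := fun x => by
    rw [fourier_add, fourier_neg]
    simp only [monomial, ContinuousMap.smul_apply, smul_eq_mul, map_mul, map_inv₀,
      Complex.conj_ofReal]
    ring
  simp_rw [ContinuousMap.inner_toLp, hprod]
  rw [integral_const_mul]
  split_ifs with hij
  · subst hij
    simp only [add_neg_cancel, fourier_zero, integral_const, Measure.real, AddCircle.measure_univ,
      ENNReal.toReal_ofReal Real.two_pi_pos.le]
    rw [Complex.real_smul, mul_one]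
    push_cast
    exact sqrt_two_pi_inv_mul_self
  · have hne : j + -i ≠ 0 := sub_ne_zero.mpr (Ne.symm hij)
    rw [integral_eq_zero_of_add_right_eq_neg (μ := (volume : Measure Angle))
      (fourier_add_half_inv_index hne Real.two_pi_pos), mul_zero]

theorem span_monomial_eq_top :
    ⊤ ≤ (Submodule.span ℂ (Set.range fun k => toL2 (monomial k))).topologicalClosure := by
  have hdense := (ContinuousMap.toLp_denseRange ℂ (volume : Measure Angle) (p := 2) ℂ
    (by norm_num)).topologicalClosure_map_submodule (span_fourier_closure_eq_top (T := 2 * Real.pi))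
  rw [← hdense, Submodule.map_span]
  refine Submodule.topologicalClosure_mono (Submodule.span_le.2 ?_)
  rintro _ ⟨_, ⟨k, rfl⟩, rfl⟩
  have hk : toL2 (fourier k) = ((Real.sqrt (2 * Real.pi))⁻¹ : ℂ)⁻¹ • toL2 (monomial k) := by
    rw [← map_smul, monomial, smul_smul, inv_mul_cancel₀ (inv_ne_zero sqrt_two_pi_ne_zero),
      one_smul]
  change toL2 (fourier k) ∈ _
  rw [hk]
  exact Submodule.smul_mem _ _ (Submodule.subset_span ⟨k, rfl⟩)

/-- The Fourier basis `z^k / √(2π)` of `L²` of the circle. Mathlib's `fourierBasis` is orthonormal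
for the measure of total mass one instead of arc length. -/
def fBasis : HilbertBasis ℤ ℂ L2Circle :=
  HilbertBasis.mk orthonormal_monomial span_monomial_eq_top

theorem fBasis_apply (k : ℤ) : fBasis k = toL2 (monomial k) := by
  rw [fBasis, HilbertBasis.coe_mk]

theorem inner_fBasis (i j : ℤ) : inner ℂ (fBasis i) (fBasis j) = if i = j then (1 : ℂ) else 0 :=
  orthonormal_iff_ite.1 fBasis.orthonormal i j

theorem norm_fBasis (k : ℤ) : ‖fBasis k‖ = 1 := fBasis.orthonormal.1 k

/-- Multiplication by a continuous function on `L²` of the circle. -/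
def mulOp : C(Angle, ℂ) →L[ℂ] (L2Circle →L[ℂ] L2Circle) :=
  ((ContinuousLinearMap.mul ℂ ℂ).holderL (volume : Measure Angle) ⊤ 2 2).comp
    (ContinuousMap.toLp ⊤ volume ℂ)

theorem coeFn_mulOp (g : C(Angle, ℂ)) (f : L2Circle) :
    mulOp g f =ᵐ[volume] fun θ => g θ * f θ := by
  have hholder := ContinuousLinearMap.coeFn_holder (r := 2) (ContinuousLinearMap.mul ℂ ℂ)
    (ContinuousMap.toLp (E := ℂ) ⊤ (volume : Measure Angle) ℂ g) f
  have htoLp := ContinuousMap.coeFn_toLp (p := ⊤) (𝕜 := ℂ) (volume : Measure Angle) g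
  filter_upwards [hholder, htoLp] with θ hf hg
  rwa [hg] at hf

theorem mulOp_mulOp (g h : C(Angle, ℂ)) (f : L2Circle) :
    mulOp g (mulOp h f) = mulOp (g * h) f := by
  refine Lp.ext ?_
  filter_upwards [coeFn_mulOp g (mulOp h f), coeFn_mulOp h f, coeFn_mulOp (g * h) f]
    with θ hg hh hgh
  rw [hg, hh, hgh, ContinuousMap.mul_apply, mul_assoc]

theorem mulOp_one (f : L2Circle) : mulOp 1 f = f := by
  refine Lp.ext ?_
  filter_upwards [coeFn_mulOp 1 f] with θ hθ
  rw [hθ, ContinuousMap.one_apply, one_mul]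

theorem mulOp_toL2 (g h : C(Angle, ℂ)) : mulOp g (toL2 h) = toL2 (g * h) := by
  refine Lp.ext ?_
  filter_upwards [coeFn_mulOp g (toL2 h), ContinuousMap.coeFn_toLp (p := 2) (𝕜 := ℂ) volume h,
    ContinuousMap.coeFn_toLp (p := 2) (𝕜 := ℂ) volume (g * h)] with θ hmul hh hgh
  rw [hmul, hh, hgh, ContinuousMap.mul_apply]

theorem inner_mulOp_left (g : C(Angle, ℂ)) (x y : L2Circle) :
    inner ℂ (mulOp g x) y = inner ℂ x (mulOp (star g) y) := by
  rw [L2.inner_def, L2.inner_def]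
  refine integral_congr_ae ?_
  filter_upwards [coeFn_mulOp g x, coeFn_mulOp (star g) y] with θ hx hy
  rw [hx, hy]
  simp only [RCLike.inner_apply, map_mul, ContinuousMap.star_apply, RCLike.star_def]
  ring

theorem mulOp_fourier_fBasis (m k : ℤ) : mulOp (fourier m) (fBasis k) = fBasis (k + m) := by
  rw [fBasis_apply, fBasis_apply, mulOp_toL2]
  congr 1
  ext θ
  simp only [ContinuousMap.mul_apply, monomial, ContinuousMap.smul_apply, smul_eq_mul, fourier_add]
  ring

/-! ### The exponentials `exp (v z)` and `exp (v / z)` -/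

/-- The function `exp (v z^σ)` on the circle. -/
def fexp (σ : ℤ) (v : ℝ) : C(Angle, ℂ) where
  toFun θ := Complex.exp (v * fourier σ θ)
  continuous_toFun := by fun_prop

theorem fexp_apply (σ : ℤ) (v : ℝ) (θ : Angle) : fexp σ v θ = Complex.exp (v * fourier σ θ) := rfl

/-- The coefficient `v^m / m!` of the exponential series. -/
def expCoeff (v : ℝ) (m : ℕ) : ℂ := ((v ^ m / m.factorial : ℝ) : ℂ)

theorem hasSum_expCoeff_mul_pow (v : ℝ) (z : ℂ) :
    HasSum (fun m : ℕ => expCoeff v m * z ^ m) (Complex.exp (v * z)) := by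
  rw [Complex.exp_eq_exp_ℂ]
  refine (NormedSpace.expSeries_div_hasSum_exp (v * z : ℂ)).congr_fun fun m => ?_
  rw [expCoeff, mul_pow]
  push_cast
  ring

theorem fourier_natCast_mul {T : ℝ} (m : ℕ) (σ : ℤ) (θ : AddCircle T) :
    fourier (m * σ) θ = (fourier σ θ : ℂ) ^ m := by
  rw [fourier_apply, fourier_apply, mul_smul, natCast_zsmul, AddCircle.toCircle_nsmul,
    Circle.coe_pow]

theorem hasSum_fexp (σ : ℤ) (v : ℝ) :
    HasSum (fun m : ℕ => expCoeff v m • (fourier (m * σ) : C(Angle, ℂ))) (fexp σ v) := by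
  have hs : Summable fun m : ℕ => expCoeff v m • (fourier (m * σ) : C(Angle, ℂ)) := by
    refine Summable.of_norm ((Real.summable_pow_div_factorial v).abs.congr fun m => ?_)
    rw [norm_smul, fourier_norm, mul_one, expCoeff, Complex.norm_real, Real.norm_eq_abs]
  convert hs.hasSum
  ext θ
  refine (hasSum_expCoeff_mul_pow v (fourier σ θ)).unique
    ((hs.hasSum.mapL (ContinuousMap.evalCLM ℂ θ)).congr_fun fun m => ?_)
  simp [-fourier_apply, fourier_natCast_mul]

theorem hasSum_mulOp_fexp (σ : ℤ) (v : ℝ) (k : ℤ) :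
    HasSum (fun m : ℕ => expCoeff v m • fBasis (k + m * σ)) (mulOp (fexp σ v) (fBasis k)) := by
  refine ((hasSum_fexp σ v).mapL
    ((ContinuousLinearMap.apply ℂ L2Circle (fBasis k)).comp mulOp)).congr_fun fun m => ?_
  simp [mulOp_fourier_fBasis]

theorem fexp_mul_fexp_neg (σ : ℤ) (v : ℝ) : fexp σ v * fexp σ (-v) = 1 := by
  ext θ
  rw [ContinuousMap.mul_apply, fexp_apply, fexp_apply, ← Complex.exp_add]
  simp

theorem mulOp_fexp_mulOp_fexp_neg (σ : ℤ) (v : ℝ) (f : L2Circle) :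
    mulOp (fexp σ v) (mulOp (fexp σ (-v)) f) = f := by
  rw [mulOp_mulOp, fexp_mul_fexp_neg, mulOp_one]

theorem mulOp_fexp_neg_mulOp_fexp (σ : ℤ) (v : ℝ) (f : L2Circle) :
    mulOp (fexp σ (-v)) (mulOp (fexp σ v) f) = f := by
  simpa using mulOp_fexp_mulOp_fexp_neg σ (-v) f

theorem star_fexp (σ : ℤ) (v : ℝ) : star (fexp σ v) = fexp (-σ) v := by
  ext θ
  rw [ContinuousMap.star_apply, fexp_apply, fexp_apply, fourier_neg, RCLike.star_def,
    ← Complex.exp_conj, map_mul, Complex.conj_ofReal]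

theorem hasSum_powFact_smul (v : ℝ) (b : ℤ) (i : ℕ) :
    HasSum (fun y : ℕ => (powFact v y i : ℂ) • fBasis (b - y))
      (mulOp (fexp (-1) v) (fBasis (b - i))) := by
  rw [← (add_right_injective i).hasSum_iff]
  · refine (hasSum_mulOp_fexp (-1) v (b - i)).congr_fun fun m => ?_
    simp only [Function.comp_apply]
    congr 1
    · simp [powFact, invFact, expCoeff, div_eq_mul_inv]
    · congr 1
      push_cast
      ring
  · intro y hy
    have hlt : ¬ i ≤ y := fun hle => hy ⟨y - i, Nat.add_sub_cancel' hle⟩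
    simp [powFact, invFact, hlt]

theorem inner_fBasis_mulOp_fexp (v : ℝ) (b : ℤ) (y i : ℕ) :
    inner ℂ (fBasis (b - y)) (mulOp (fexp (-1) v) (fBasis (b - i))) = (powFact v y i : ℂ) := by
  have hinner := (hasSum_powFact_smul v b i).mapL (innerSL ℂ (fBasis (b - y)))
  refine hinner.unique ?_
  convert hasSum_single y fun k hk => ?_ using 1
  · simp [norm_fBasis]
  · rw [innerSL_apply_apply, inner_smul_right, inner_fBasis, if_neg (by omega), mul_zero]

/-! ### Nuclear expansions of differences of projections -/

/-- Multiplication by `exp (-u / z)`. -/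
abbrev psiOp (u : ℝ) : L2Circle →L[ℂ] L2Circle := mulOp (fexp (-1) (-u))

/-- Multiplication by `exp (u z)`. -/
abbrev chiOp (u : ℝ) : L2Circle →L[ℂ] L2Circle := mulOp (fexp 1 u)

theorem inner_psiOp_chiOp (u : ℝ) (x y : L2Circle) :
    inner ℂ (psiOp u x) (chiOp u y) = inner ℂ x y := by
  rw [inner_mulOp_left, star_fexp, neg_neg, mulOp_fexp_neg_mulOp_fexp]

/-- `Q` behaves like the orthogonal projection onto the closed span of `exp (-u / z) z^j`, `j ∈ J`,
where `J` is an initial segment of `ℕ`. These properties are all that the nuclear expansion of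
`Q` minus a coordinate projection depends on, and they hold with the same constants for the finite
segments and for `J = ℕ`. -/
structure IsCut (u : ℝ) (J : Set ℕ) (Q : L2Circle →L[ℂ] L2Circle) : Prop where
  norm_le : ∀ x, ‖Q x‖ ≤ ‖x‖
  norm_sub_le : ∀ x, ‖Q x - x‖ ≤ ‖x‖
  isLowerSet : IsLowerSet J
  fix : ∀ j ∈ J, Q (psiOp u (fBasis j)) = psiOp u (fBasis j)
  kill : ∀ j : ℕ, Q (chiOp u (fBasis (-1 - j))) = 0
  top : ∀ j : ℕ, j ∉ J → Q (fBasis j) = 0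

/-- The span of `exp (-u / z) z^j`, `j < M`. -/
def cutSpace (u : ℝ) (M : ℕ) : Submodule ℂ L2Circle :=
  Submodule.span ℂ (Set.range fun j : Fin M => psiOp u (fBasis j))

instance (u : ℝ) (M : ℕ) : FiniteDimensional ℂ (cutSpace u M) :=
  FiniteDimensional.span_of_finite ℂ (Set.finite_range _)

/-- The orthogonal projection onto the span of `exp (-u / z) z^j`, `j < M`. -/
def cutProj (u : ℝ) (M : ℕ) : L2Circle →L[ℂ] L2Circle := (cutSpace u M).starProjection

/-- The orthogonal projection onto the closed span of `exp (-u / z) z^j`, `j ≥ 0`. -/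
def fullProj (u : ℝ) : L2Circle →L[ℂ] L2Circle :=
  (⨆ M, cutSpace u M).topologicalClosure.starProjection

theorem cutSpace_mono (u : ℝ) : Monotone (cutSpace u) := by
  intro M M' h
  refine Submodule.span_le.2 ?_
  rintro _ ⟨j, rfl⟩
  exact Submodule.subset_span ⟨⟨j, j.2.trans_le h⟩, rfl⟩

theorem tendsto_cutProj (u : ℝ) (x : L2Circle) :
    Tendsto (fun M => cutProj u M x) atTop (𝓝 (fullProj u x)) :=
  Submodule.starProjection_tendsto_closure_iSup (cutSpace u) (cutSpace_mono u) x

theorem norm_starProjection_sub_self_le {H : Type*} [NormedAddCommGroup H] [InnerProductSpace ℂ H]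
    (V : Submodule ℂ H) [V.HasOrthogonalProjection] (x : H) : ‖V.starProjection x - x‖ ≤ ‖x‖ := by
  rw [norm_sub_rev, ← Submodule.starProjection_orthogonal_val]
  exact Submodule.norm_starProjection_apply_le _ x

theorem mem_orthogonal_span_range_iff {H ι : Type*} [NormedAddCommGroup H] [InnerProductSpace ℂ H]
    {a : ι → H} {x : H} :
    x ∈ (Submodule.span ℂ (Set.range a))ᗮ ↔ ∀ j, inner ℂ (a j) x = 0 := by
  rw [← Submodule.span_singleton_le_iff_mem, ← Submodule.isOrtho_iff_le, Submodule.isOrtho_comm,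
    Submodule.isOrtho_span]
  simp

theorem cutProj_eq_zero {u : ℝ} {M : ℕ} {x : L2Circle}
    (h : ∀ j : Fin M, inner ℂ (psiOp u (fBasis j)) x = 0) : cutProj u M x = 0 :=
  (Submodule.starProjection_apply_eq_zero_iff _).2 (mem_orthogonal_span_range_iff.2 h)

theorem inner_psiOp_fBasis_of_lt (u : ℝ) {i j : ℕ} (hij : i < j) :
    inner ℂ (psiOp u (fBasis i)) (fBasis j) = 0 := by
  have h := inner_fBasis_mulOp_fexp (-u) j 0 (j - i)
  have hzero : powFact (-u) 0 (j - i) = 0 := by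
    simp [powFact, invFact, Nat.sub_eq_zero_iff_le, hij]
  rw [hzero, Nat.cast_zero, sub_zero, show (j : ℤ) - ((j - i : ℕ) : ℤ) = i by omega,
    Complex.ofReal_zero] at h
  rw [← inner_conj_symm, h, map_zero]

theorem isCut_cutProj (u : ℝ) (M : ℕ) : IsCut u (Set.Iio M) (cutProj u M) where
  norm_le x := (cutSpace u M).norm_starProjection_apply_le x
  norm_sub_le x := norm_starProjection_sub_self_le (cutSpace u M) x
  isLowerSet := isLowerSet_Iio M
  fix j hj := Submodule.starProjection_eq_self_iff.2 (Submodule.subset_span ⟨⟨j, hj⟩, rfl⟩)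
  kill j := cutProj_eq_zero fun i => by
    rw [inner_psiOp_chiOp, inner_fBasis, if_neg (by omega)]
  top _ hj := cutProj_eq_zero fun i => inner_psiOp_fBasis_of_lt u (i.2.trans_le (not_lt.1 hj))

theorem isCut_fullProj (u : ℝ) : IsCut u Set.univ (fullProj u) where
  norm_le x := Submodule.norm_starProjection_apply_le _ x
  norm_sub_le x := norm_starProjection_sub_self_le _ x
  isLowerSet := isLowerSet_univ
  fix j _ := by
    refine tendsto_nhds_unique (tendsto_cutProj u _) (tendsto_const_nhds.congr' ?_)
    filter_upwards [eventually_gt_atTop j] with M hM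
    exact ((isCut_cutProj u M).fix j hM).symm
  kill j := by
    refine tendsto_nhds_unique (tendsto_cutProj u _) ?_
    simp_rw [(isCut_cutProj u _).kill]
    exact tendsto_const_nhds
  top _ hj := (hj trivial).elim

/-- The index type of the nuclear expansion of `Q - R`, where `Q` is a cut over `J` and `R` is the
projection onto the span of `z^k` with `-n ≤ k < 0` or `k ∈ J`. The three summands account for the
monomials `z^k` with `k < -n`, with `k ≥ 0`, and with `-n ≤ k < 0`. -/
abbrev NucIndex (n : ℕ) : Type := (ℕ × ℕ) ⊕ ((ℕ × ℕ) ⊕ Fin n)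

/-- The vectors spanning the range in the nuclear expansion of `Q - R`. -/
def nucLeft (u : ℝ) (n : ℕ) (Q : L2Circle →L[ℂ] L2Circle) : NucIndex n → L2Circle
  | Sum.inl (_, l) => Q (chiOp u (fBasis l))
  | Sum.inr (Sum.inl (_, l)) => Q (psiOp u (fBasis (-1 - l))) - psiOp u (fBasis (-1 - l))
  | Sum.inr (Sum.inr r) => Q (fBasis (-1 - (r : ℕ))) - fBasis (-1 - (r : ℕ))

open Classical in
/-- The vectors representing the functionals in the nuclear expansion of `Q - R`. -/
def nucRight (u : ℝ) (n : ℕ) (J : Set ℕ) : NucIndex n → L2Circle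
  | Sum.inl (j, l) => if n ≤ j then expCoeff (-u) (j + l + 1) • fBasis (-1 - j) else 0
  | Sum.inr (Sum.inl (j, l)) => if j ∈ J then expCoeff u (j + l + 1) • fBasis j else 0
  | Sum.inr (Sum.inr r) => fBasis (-1 - (r : ℕ))

/-- A summable bound, uniform in the cut, for the terms of the nuclear expansion of `Q - R`. -/
def nucBound (u : ℝ) (n : ℕ) : NucIndex n → ℝ
  | Sum.inl (j, l) => ‖chiOp u‖ * ‖expCoeff (-u) (j + l + 1)‖
  | Sum.inr (Sum.inl (j, l)) => ‖psiOp u‖ * ‖expCoeff u (j + l + 1)‖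
  | Sum.inr (Sum.inr _) => 1

theorem conj_expCoeff (v : ℝ) (m : ℕ) : (starRingEnd ℂ) (expCoeff v m) = expCoeff v m :=
  Complex.conj_ofReal _

theorem summable_norm_expCoeff_add (v : ℝ) :
    Summable fun p : ℕ × ℕ => ‖expCoeff v (p.1 + p.2 + 1)‖ := by
  have hprod := (Real.summable_pow_div_factorial |v|).mul_of_nonneg
    (Real.summable_pow_div_factorial |v|) (fun _ => by positivity) (fun _ => by positivity)
  refine Summable.of_nonneg_of_le (fun _ => norm_nonneg _) (fun p => ?_) (hprod.mul_left |v|)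
  rw [expCoeff, Complex.norm_real, Real.norm_eq_abs, abs_div, abs_pow, Nat.abs_cast]
  have hfact : (p.1.factorial : ℝ) * p.2.factorial ≤ (p.1 + p.2 + 1).factorial := by
    have hle := Nat.le_of_dvd (Nat.factorial_pos _)
      (Nat.factorial_mul_factorial_dvd_factorial_add p.1 p.2)
    exact_mod_cast hle.trans (Nat.factorial_le (Nat.le_succ (p.1 + p.2)))
  calc |v| ^ (p.1 + p.2 + 1) / ((p.1 + p.2 + 1).factorial : ℝ)
      ≤ |v| ^ (p.1 + p.2 + 1) / (p.1.factorial * p.2.factorial) :=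
        div_le_div_of_nonneg_left (by positivity) (by positivity) hfact
    _ = |v| * (|v| ^ p.1 / p.1.factorial * (|v| ^ p.2 / p.2.factorial)) := by
        rw [pow_succ, pow_add]
        field_simp

theorem summable_nucBound (u : ℝ) (n : ℕ) : Summable (nucBound u n) := by
  refine Summable.sum _ ?_ (Summable.sum _ ?_ ?_)
  · exact (summable_norm_expCoeff_add (-u)).mul_left ‖chiOp u‖
  · exact (summable_norm_expCoeff_add u).mul_left ‖psiOp u‖
  · exact Summable.of_finite

theorem nucBound_nonneg (u : ℝ) (n : ℕ) : 0 ≤ nucBound u n := by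
  rintro (⟨j, l⟩ | ⟨j, l⟩ | r)
  · exact mul_nonneg (norm_nonneg _) (norm_nonneg _)
  · exact mul_nonneg (norm_nonneg _) (norm_nonneg _)
  · exact zero_le_one

theorem norm_ite_smul_fBasis_le (p : Prop) [Decidable p] (c : ℂ) (k : ℤ) :
    ‖if p then c • fBasis k else 0‖ ≤ ‖c‖ := by
  split_ifs
  · rw [norm_smul, norm_fBasis, mul_one]
  · simp

theorem norm_apply_fBasis_le (A : L2Circle →L[ℂ] L2Circle) (k : ℤ) : ‖A (fBasis k)‖ ≤ ‖A‖ :=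
  A.unit_le_opNorm _ (norm_fBasis k).le

section Cut

variable {u : ℝ} {n : ℕ} {J : Set ℕ} {Q : L2Circle →L[ℂ] L2Circle}

theorem IsCut.norm_nucLeft_mul_norm_nucRight_le (hQ : IsCut u J Q) (i : NucIndex n) :
    ‖nucLeft u n Q i‖ * ‖nucRight u n J i‖ ≤ nucBound u n i := by
  classical
  rcases i with ⟨j, l⟩ | ⟨j, l⟩ | r
  · exact mul_le_mul ((hQ.norm_le _).trans (norm_apply_fBasis_le _ _))
      (norm_ite_smul_fBasis_le _ _ _) (norm_nonneg _) (norm_nonneg _)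
  · exact mul_le_mul ((hQ.norm_sub_le _).trans (norm_apply_fBasis_le _ _))
      (norm_ite_smul_fBasis_le _ _ _) (norm_nonneg _) (norm_nonneg _)
  · simp only [nucLeft, nucRight, nucBound, norm_fBasis, mul_one]
    exact (hQ.norm_sub_le _).trans (norm_fBasis _).le

theorem IsCut.summable_nuc (hQ : IsCut u J Q) :
    Summable fun i => ‖nucLeft u n Q i‖ * ‖nucRight u n J i‖ :=
  Summable.of_nonneg_of_le (fun _ => by positivity) hQ.norm_nucLeft_mul_norm_nucRight_le
    (summable_nucBound u n)

theorem hasSum_nat_add_of_zero {E : Type*} [AddCommMonoid E] [TopologicalSpace E] {f : ℕ → E}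
    {a : E} (j : ℕ) (hzero : ∀ m ≤ j, f m = 0) (h : HasSum f a) :
    HasSum (fun l => f (j + l + 1)) a := by
  have hinj : Function.Injective fun l : ℕ => j + l + 1 := fun a b h => by simpa using h
  refine (hinj.hasSum_iff fun m hm => hzero m ?_).2 h
  by_contra! hlt
  exact hm ⟨m - j - 1, by simp only; omega⟩

theorem IsCut.hasSum_neg (hQ : IsCut u J Q) (j : ℕ) :
    HasSum (fun l : ℕ => expCoeff (-u) (j + l + 1) • Q (chiOp u (fBasis l)))
      (Q (fBasis (-1 - j))) := by
  -- `z^{-1-j} = exp (u z) exp (-u z) z^{-1-j}`, and `Q` kills all terms of the series of the last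
  -- two factors with a negative exponent.
  have h := (hasSum_mulOp_fexp 1 (-u) (-1 - j)).mapL (Q.comp (chiOp u))
  rw [ContinuousLinearMap.comp_apply, mulOp_fexp_mulOp_fexp_neg] at h
  refine (hasSum_nat_add_of_zero j (fun m hm => ?_) h).congr_fun fun l => ?_
  · rw [map_smul, ContinuousLinearMap.comp_apply,
      show (-1 - (j : ℤ) + m * 1) = -1 - ((j - m : ℕ) : ℤ) by omega, hQ.kill, smul_zero]
  · rw [map_smul, ContinuousLinearMap.comp_apply,
      show -1 - (j : ℤ) + (j + l + 1 : ℕ) * 1 = l by push_cast; ring]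

theorem IsCut.hasSum_nonneg (hQ : IsCut u J Q) {j : ℕ} (hj : j ∈ J) :
    HasSum (fun l : ℕ => expCoeff u (j + l + 1) •
      (Q (psiOp u (fBasis (-1 - l))) - psiOp u (fBasis (-1 - l)))) (Q (fBasis j) - fBasis j) := by
  -- `z^j = exp (-u / z) exp (u / z) z^j`, and `Q - 1` kills all terms of the series of the last
  -- two factors with a nonnegative exponent.
  have h := (hasSum_mulOp_fexp (-1) u j).mapL
    ((Q - ContinuousLinearMap.id ℂ L2Circle).comp (psiOp u))
  simp only [map_smul, ContinuousLinearMap.comp_apply, sub_apply,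
    ContinuousLinearMap.id_apply, mulOp_fexp_neg_mulOp_fexp] at h
  refine (hasSum_nat_add_of_zero j (fun m hm => ?_) h).congr_fun fun l => ?_
  · rw [show ((j : ℤ) + m * -1) = ((j - m : ℕ) : ℤ) by omega,
      hQ.fix (j - m) (hQ.isLowerSet (Nat.sub_le _ _) hj), sub_self, smul_zero]
  · rw [show (j : ℤ) + (j + l + 1 : ℕ) * -1 = -1 - l by push_cast; ring]

theorem hasSum_prod_of_fst_eq {α β E : Type*} [AddCommMonoid E] [TopologicalSpace E]
    {f : α × β → E} {a : E} (j₀ : α) (h0 : ∀ j l, j ≠ j₀ → f (j, l) = 0)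
    (h : HasSum (fun l => f (j₀, l)) a) : HasSum f a := by
  refine ((Prod.mk_right_injective j₀).hasSum_iff ?_).1 h
  rintro ⟨j, l⟩ hp
  exact h0 j l fun hj => hp ⟨l, by rw [hj]⟩

theorem inner_ite_smul_fBasis (p : Prop) [Decidable p] (v : ℝ) (m : ℕ) (i k : ℤ) :
    inner ℂ (if p then expCoeff v m • fBasis i else 0) (fBasis k) =
      if p ∧ i = k then expCoeff v m else 0 := by
  by_cases hp : p
  · rw [if_pos hp, inner_smul_left, conj_expCoeff, inner_fBasis]
    simp [hp]
  · simp [hp]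

theorem IsCut.hasSum_nuc_inl (hQ : IsCut u J Q) (k : ℤ) :
    HasSum (fun p => inner ℂ (nucRight u n J (Sum.inl p)) (fBasis k) • nucLeft u n Q (Sum.inl p))
      (if k < -n then Q (fBasis k) else 0) := by
  simp only [nucRight, nucLeft, inner_ite_smul_fBasis]
  split_ifs with hk
  · obtain ⟨j, rfl⟩ : ∃ j : ℕ, k = -1 - j := ⟨(-1 - k).toNat, by omega⟩
    refine hasSum_prod_of_fst_eq j (fun i l hi => ?_) ((hQ.hasSum_neg j).congr_fun fun l => ?_)
    · rw [if_neg (by omega), zero_smul]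
    · rw [if_pos (by omega)]
  · refine hasSum_zero.congr_fun fun p => ?_
    rw [if_neg (by omega), zero_smul]

open Classical in
theorem IsCut.hasSum_nuc_inr_inl (hQ : IsCut u J Q) (k : ℤ) :
    HasSum (fun p => inner ℂ (nucRight u n J (Sum.inr (Sum.inl p))) (fBasis k) •
      nucLeft u n Q (Sum.inr (Sum.inl p)))
      (if 0 ≤ k ∧ k.toNat ∈ J then Q (fBasis k) - fBasis k else 0) := by
  simp only [nucRight, nucLeft, inner_ite_smul_fBasis]
  split_ifs with hk
  · obtain ⟨j, rfl⟩ := Int.eq_ofNat_of_zero_le hk.1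
    have hj : j ∈ J := hk.2
    refine hasSum_prod_of_fst_eq j (fun i l hi => ?_) ((hQ.hasSum_nonneg hj).congr_fun fun l => ?_)
    · rw [if_neg (by omega), zero_smul]
    · rw [if_pos ⟨hj, rfl⟩]
  · refine hasSum_zero.congr_fun fun p => ?_
    rw [if_neg, zero_smul]
    rintro ⟨hp, rfl⟩
    exact hk ⟨Int.natCast_nonneg _, hp⟩

theorem hasSum_nuc_inr_inr (k : ℤ) :
    HasSum (fun r => inner ℂ (nucRight u n J (Sum.inr (Sum.inr r))) (fBasis k) •
      nucLeft u n Q (Sum.inr (Sum.inr r)))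
      (if -n ≤ k ∧ k < 0 then Q (fBasis k) - fBasis k else 0) := by
  simp only [nucRight, nucLeft, inner_fBasis]
  split_ifs with hk
  · obtain ⟨r, rfl⟩ : ∃ r : Fin n, k = -1 - (r : ℕ) :=
      ⟨⟨(-1 - k).toNat, by omega⟩, by simp only; omega⟩
    convert hasSum_single r fun s hs => ?_
    · rw [if_pos rfl, one_smul]
    · rw [if_neg (by omega), zero_smul]
  · refine hasSum_zero.congr_fun fun r => ?_
    rw [if_neg (by omega), zero_smul]

open Classical in
theorem IsCut.isNuclearExpansion_sub (hQ : IsCut u J Q) {R : L2Circle →L[ℂ] L2Circle}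
    (hR : ∀ k, R (fBasis k) = if -n ≤ k ∧ (0 ≤ k → k.toNat ∈ J) then fBasis k else 0) :
    IsNuclearExpansion (Q - R) (nucLeft u n Q) (nucRight u n J) := by
  refine .of_hilbertBasis fBasis hQ.summable_nuc fun k => ?_
  have h := (hQ.hasSum_nuc_inl k).sum (f := fun i : NucIndex n =>
    inner ℂ (nucRight u n J i) (fBasis k) • nucLeft u n Q i)
    (HasSum.sum (hQ.hasSum_nuc_inr_inl k) (hasSum_nuc_inr_inr k))
  convert h using 1
  rw [sub_apply, hR]
  rcases lt_or_ge k 0 with hk | hk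
  · by_cases hn : k < -n
    · simp [hn, hk.not_ge, hn.not_ge]
    · simp [hn, hk, hk.not_ge, not_lt.1 hn]
  · by_cases hJ : k.toNat ∈ J
    · simp [hk, hk.not_gt, hJ, show -(n : ℤ) ≤ k by omega, show ¬ k < -n by omega]
    · have htop := hQ.top _ hJ
      rw [Int.toNat_of_nonneg hk] at htop
      simp [hk, hk.not_gt, hJ, htop]

end Cut

theorem tendsto_nucRight (u : ℝ) {n : ℕ} (i : NucIndex n) :
    Tendsto (fun M => nucRight u n (Set.Iio M) i) atTop (𝓝 (nucRight u n Set.univ i)) := by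
  rcases i with i | ⟨j, l⟩ | r
  · exact tendsto_const_nhds
  · refine tendsto_const_nhds.congr' ?_
    filter_upwards [eventually_gt_atTop j] with M hM
    simp only [nucRight, Set.mem_univ, Set.mem_Iio, hM, if_true]
  · exact tendsto_const_nhds

theorem tendsto_nucLeft (u : ℝ) {n : ℕ} (i : NucIndex n) :
    Tendsto (fun M => nucLeft u n (cutProj u M) i) atTop (𝓝 (nucLeft u n (fullProj u) i)) := by
  rcases i with i | i | r
  · exact tendsto_cutProj u _
  · exact (tendsto_cutProj u _).sub_const _
  · exact (tendsto_cutProj u _).sub_const _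

theorem tendsto_minorSum_cut (u : ℝ) (n : ℕ) (c : ℂ) :
    Tendsto (fun M => minorSum fun i j => c * inner ℂ (nucRight u n (Set.Iio M) i)
      (nucLeft u n (cutProj u M) j)) atTop
      (𝓝 (minorSum fun i j => c * inner ℂ (nucRight u n Set.univ i)
        (nucLeft u n (fullProj u) j))) := by
  simp only [← inner_smul_right]
  refine tendsto_minorSum_of_dominated ((summable_nucBound u n).mul_left ‖c‖)
    (fun i => mul_nonneg (norm_nonneg _) (nucBound_nonneg u n i)) (fun M S => ?_)
    fun i j => (tendsto_nucRight u i).inner ((tendsto_nucLeft u j).const_smul c)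
  refine (norm_principalMinor_inner_le (fun i => c • nucLeft u n (cutProj u M) i) _ S).trans ?_
  refine Finset.prod_le_prod (fun _ _ => by positivity) fun i _ => ?_
  rw [norm_smul, mul_assoc]
  exact mul_le_mul_of_nonneg_left
    ((isCut_cutProj u M).norm_nucLeft_mul_norm_nucRight_le i) (norm_nonneg _)

/-! ### Determinants of differences of finite rank projections -/

section FiniteRank

variable {m p : Type*} [Fintype m] [DecidableEq m]

theorem det_fromBlocks_one_sub_one_add {𝕜 : Type*} [Field 𝕜] [Fintype p] [DecidableEq p]
    {T : Matrix m m 𝕜} (hT : T.det ≠ 0) (B : Matrix m p 𝕜) (C : Matrix p m 𝕜) {c : 𝕜}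
    (hc : 1 + c ≠ 0) :
    (Matrix.fromBlocks ((1 - c) • (1 : Matrix m m 𝕜)) (c • (T⁻¹ * B))
        (-(c • C)) ((1 + c) • (1 : Matrix p p 𝕜))).det =
      (1 + c) ^ Fintype.card p / (1 + c) ^ Fintype.card m *
        (((1 - c ^ 2) • T + c ^ 2 • (B * C)).det / T.det) := by
  let _ : Invertible ((1 + c) • (1 : Matrix p p 𝕜)) :=
    ⟨(1 + c)⁻¹ • 1, by simp [smul_smul, hc], by simp [smul_smul, hc]⟩
  have hinv : ⅟((1 + c) • (1 : Matrix p p 𝕜)) = (1 + c)⁻¹ • 1 := rfl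
  have hschur : (1 + c) • ((1 - c) • (1 : Matrix m m 𝕜) -
      c • (T⁻¹ * B) * ((1 + c)⁻¹ • (1 : Matrix p p 𝕜)) * -(c • C)) =
      T⁻¹ * ((1 - c ^ 2) • T + c ^ 2 • (B * C)) := by
    have hexpand : T⁻¹ * ((1 - c ^ 2) • T + c ^ 2 • (B * C)) =
        (1 - c ^ 2) • 1 + c ^ 2 • (T⁻¹ * B * C) := by
      rw [Matrix.mul_add, Matrix.mul_smul, Matrix.nonsing_inv_mul T (isUnit_iff_ne_zero.2 hT),
        Matrix.mul_smul, ← Matrix.mul_assoc]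
    rw [hexpand]
    simp only [Matrix.smul_mul, Matrix.mul_smul, Matrix.mul_neg, Matrix.mul_one, sub_neg_eq_add,
      smul_add, smul_smul]
    congr 2
    · ring
    · field_simp
  have hdet := congrArg Matrix.det hschur
  rw [Matrix.det_smul, Matrix.det_mul, Matrix.det_nonsing_inv, Ring.inverse_eq_inv',
    ← div_eq_inv_mul] at hdet
  rw [Matrix.det_fromBlocks₂₂, hinv, Matrix.det_smul, Matrix.det_one, mul_one, ← hdet]
  field_simp

variable {H : Type} [NormedAddCommGroup H] [InnerProductSpace ℂ H]

/-- The dual family of a linearly independent family `a` in the span of `a`. -/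
def dualFamily (a : m → H) (l : m) : H := ∑ k, star ((Matrix.gram ℂ a)⁻¹ l k) • a k

theorem inner_dualFamily (a : m → H) (l : m) (x : H) :
    inner ℂ (dualFamily a l) x = ∑ k, (Matrix.gram ℂ a)⁻¹ l k * inner ℂ (a k) x := by
  simp [dualFamily, mul_comm]

theorem isUnit_det_gram {a : m → H} (ha : LinearIndependent ℂ a) :
    IsUnit (Matrix.gram ℂ a).det :=
  isUnit_iff_ne_zero.2 (Matrix.det_gram_ne_zero_iff_linearIndependent.2 ha)

theorem inner_dualFamily_self {a : m → H} (ha : LinearIndependent ℂ a) (l k : m) :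
    inner ℂ (dualFamily a l) (a k) = if l = k then 1 else 0 := by
  have h := congrFun₂ (Matrix.nonsing_inv_mul (Matrix.gram ℂ a) (isUnit_det_gram ha)) l k
  rw [Matrix.mul_apply, Matrix.one_apply] at h
  rwa [inner_dualFamily]

theorem starProjection_span_eq_sum {a : m → H} (ha : LinearIndependent ℂ a)
    [(Submodule.span ℂ (Set.range a)).HasOrthogonalProjection] (x : H) :
    (Submodule.span ℂ (Set.range a)).starProjection x = ∑ l, inner ℂ (dualFamily a l) x • a l := by
  have hmem : ∑ l, inner ℂ (dualFamily a l) x • a l ∈ Submodule.span ℂ (Set.range a) :=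
    Submodule.sum_mem _ fun l _ => Submodule.smul_mem _ _ (Submodule.subset_span ⟨l, rfl⟩)
  refine Submodule.eq_starProjection_of_mem_orthogonal hmem
    (mem_orthogonal_span_range_iff.2 fun j => ?_)
  have hgram (k : m) : ∑ l, (Matrix.gram ℂ a)⁻¹ l k * inner ℂ (a j) (a l) =
      if j = k then 1 else 0 := by
    have h := congrFun₂ (Matrix.mul_nonsing_inv (Matrix.gram ℂ a) (isUnit_det_gram ha)) j k
    simpa only [Matrix.mul_apply, Matrix.one_apply, Matrix.gram_apply, mul_comm] using h
  rw [inner_sub_right, inner_sum, sub_eq_zero]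
  simp_rw [inner_smul_right, inner_dualFamily, Finset.sum_mul]
  rw [Finset.sum_comm]
  simp_rw [mul_right_comm, ← Finset.sum_mul, hgram]
  simp

/-- The matrix of the inner products `⟨e r, a l⟩`. -/
def crossGram (e : p → H) (a : m → H) : Matrix p m ℂ := Matrix.of fun r l => inner ℂ (e r) (a l)

theorem isNuclearExpansion_projections [Fintype p] {a : m → H} (ha : LinearIndependent ℂ a)
    [(Submodule.span ℂ (Set.range a)).HasOrthogonalProjection] (e : p → H) :
    IsNuclearExpansion ((Submodule.span ℂ (Set.range a)).starProjection -
      ∑ r, InnerProductSpace.rankOne ℂ (e r) (e r))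
      (Sum.elim a fun r => -e r) (Sum.elim (dualFamily a) e) where
  summable := Summable.of_finite
  hasSum v := by
    have h := hasSum_fintype fun i : m ⊕ p =>
      inner ℂ (Sum.elim (dualFamily a) e i) v • Sum.elim a (fun r => -e r) i
    convert h using 1
    simp [Fintype.sum_sum_type, starProjection_span_eq_sum ha, sub_eq_add_neg]

theorem one_sub_gram_projections [DecidableEq p] {a : m → H} (ha : LinearIndependent ℂ a)
    {e : p → H} (he : Orthonormal ℂ e) (c : ℂ) :
    1 - Matrix.of (fun i j => c * inner ℂ (Sum.elim (dualFamily a) e i)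
        (Sum.elim a (fun r => -e r) j)) =
      Matrix.fromBlocks ((1 - c) • (1 : Matrix m m ℂ))
        (c • ((Matrix.gram ℂ a)⁻¹ * (crossGram e a).conjTranspose))
        (-(c • crossGram e a)) ((1 + c) • (1 : Matrix p p ℂ)) := by
  ext (i | i) (j | j)
  · by_cases hij : i = j <;> simp [inner_dualFamily_self ha, hij]
  · simp [inner_dualFamily, Matrix.mul_apply, crossGram]
  · simp [crossGram]
  · by_cases hij : i = j <;> simp [orthonormal_iff_ite.1 he, he.1 j, hij]

theorem hasFredholmDet_smul_projections [Fintype p] {a : m → H} (ha : LinearIndependent ℂ a)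
    [(Submodule.span ℂ (Set.range a)).HasOrthogonalProjection] {e : p → H}
    (he : Orthonormal ℂ e) {c : ℂ} (hc : 1 + c ≠ 0) :
    HasFredholmDet (c • ((Submodule.span ℂ (Set.range a)).starProjection -
        ∑ r, InnerProductSpace.rankOne ℂ (e r) (e r)))
      ((1 + c) ^ Fintype.card p / (1 + c) ^ Fintype.card m *
        (((1 - c ^ 2) • Matrix.gram ℂ a +
          c ^ 2 • ((crossGram e a).conjTranspose * crossGram e a)).det /
            (Matrix.gram ℂ a).det)) := by
  classical
  rw [← det_fromBlocks_one_sub_one_add (isUnit_det_gram ha).ne_zero _ _ hc,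
    ← one_sub_gram_projections ha he, ← minorSum_eq_det_one_sub]
  exact (isNuclearExpansion_projections ha e).hasFredholmDet_smul c

end FiniteRank

/-! ### The finite rank approximations as weighted determinants -/

/-- The vectors `exp (-u / z) z^l`, `l < M`. -/
def cutVec (u : ℝ) (M : ℕ) (l : Fin M) : L2Circle := psiOp u (fBasis (l : ℕ))

/-- The monomials `z^k`, `-n ≤ k < M`. -/
def rangeVec (n M : ℕ) (r : Fin (M + n)) : L2Circle := fBasis ((r : ℕ) - n)

/-- The difference of the orthogonal projections onto the span of `cutVec u M` and onto the span of
`rangeVec n M`. -/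
def cutDiff (u : ℝ) (n M : ℕ) : L2Circle →L[ℂ] L2Circle :=
  cutProj u M - ∑ r, InnerProductSpace.rankOne ℂ (rangeVec n M r) (rangeVec n M r)

section CutDiff

variable (u : ℝ) (n M : ℕ)

theorem linearIndependent_cutVec : LinearIndependent ℂ (cutVec u M) := by
  have hbasis : LinearIndependent ℂ fun l : Fin M => fBasis ((l : ℕ) : ℤ) :=
    fBasis.orthonormal.linearIndependent.comp _ (Nat.cast_injective.comp Fin.val_injective)
  have hinj : Function.Injective (psiOp u) :=
    Function.LeftInverse.injective (mulOp_fexp_mulOp_fexp_neg (-1) u)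
  exact hbasis.map' (psiOp u).toLinearMap (LinearMap.ker_eq_bot.2 hinj)

theorem orthonormal_rangeVec : Orthonormal ℂ (rangeVec n M) :=
  fBasis.orthonormal.comp _ fun r s h => Fin.ext (by simpa using h)

theorem sum_rankOne_rangeVec_fBasis (k : ℤ) :
    (∑ r, InnerProductSpace.rankOne ℂ (rangeVec n M r) (rangeVec n M r)) (fBasis k) =
      if -(n : ℤ) ≤ k ∧ k < M then fBasis k else 0 := by
  simp only [sum_apply, InnerProductSpace.rankOne_apply, rangeVec, inner_fBasis]
  split_ifs with hk
  · obtain ⟨r, hr⟩ : ∃ r : Fin (M + n), k = (r : ℕ) - n :=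
      ⟨⟨(k + n).toNat, by omega⟩, by simp only; omega⟩
    rw [Finset.sum_eq_single_of_mem r (Finset.mem_univ r) fun s _ hs => ?_, hr, if_pos rfl,
      one_smul]
    rw [if_neg (by omega), zero_smul]
  · refine Finset.sum_eq_zero fun r _ => ?_
    rw [if_neg (by omega), zero_smul]

theorem isNuclearExpansion_cutDiff :
    IsNuclearExpansion (cutDiff u n M) (nucLeft u n (cutProj u M)) (nucRight u n (Set.Iio M)) :=
  (isCut_cutProj u M).isNuclearExpansion_sub fun k => by
    rw [sum_rankOne_rangeVec_fBasis]
    simp only [Set.mem_Iio]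
    congr 1
    rw [eq_iff_iff]
    omega

theorem hasFredholmDet_smul_cutDiff {c : ℂ} (hc : 1 + c ≠ 0) :
    HasFredholmDet (c • cutDiff u n M) ((1 + c) ^ n *
      (((1 - c ^ 2) • Matrix.gram ℂ (cutVec u M) + c ^ 2 •
        ((crossGram (rangeVec n M) (cutVec u M)).conjTranspose *
          crossGram (rangeVec n M) (cutVec u M))).det / (Matrix.gram ℂ (cutVec u M)).det)) := by
  have : (Submodule.span ℂ (Set.range (cutVec u M))).HasOrthogonalProjection :=
    inferInstanceAs (cutSpace u M).HasOrthogonalProjection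
  have h := hasFredholmDet_smul_projections (linearIndependent_cutVec u M)
    (orthonormal_rangeVec n M) hc
  rwa [Fintype.card_fin, Fintype.card_fin, pow_add,
    mul_div_cancel_left₀ _ (pow_ne_zero M hc)] at h

theorem cast_sub_one_sub_rev {M : ℕ} (l : Fin M) : (M : ℤ) - 1 - (l.rev : ℕ) = (l : ℕ) := by
  rw [Fin.val_rev]
  omega

theorem inner_fBasis_cutVec (l : Fin M) (y : ℕ) :
    inner ℂ (fBasis ((M : ℤ) - 1 - y)) (cutVec u M l) = (powFact (-u) y l.rev : ℂ) := by
  have h := inner_fBasis_mulOp_fexp (-u) ((M : ℤ) - 1) y l.rev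
  rwa [cast_sub_one_sub_rev] at h

theorem gram_cutVec_apply (l k : Fin M) : Matrix.gram ℂ (cutVec u M) l k =
    ((∑' y, powFact (-u) y l.rev * powFact (-u) y k.rev : ℝ) : ℂ) := by
  have hexpand := hasSum_powFact_smul (-u) ((M : ℤ) - 1) k.rev
  rw [cast_sub_one_sub_rev] at hexpand
  rw [Complex.ofReal_tsum]
  refine (HasSum.tsum_eq ((hexpand.mapL (innerSL ℂ (cutVec u M l))).congr_fun fun y => ?_)).symm
  rw [innerSL_apply_apply, inner_smul_right, ← inner_conj_symm, inner_fBasis_cutVec,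
    Complex.conj_ofReal, mul_comm, Complex.ofReal_mul]

theorem crossGram_apply (r : Fin (M + n)) (l : Fin M) :
    crossGram (rangeVec n M) (cutVec u M) r l = (powFact (-u) r.rev l.rev : ℂ) := by
  rw [← inner_fBasis_cutVec, crossGram, Matrix.of_apply, rangeVec]
  congr 2
  rw [Fin.val_rev]
  omega

theorem conjTranspose_crossGram_mul_apply (l k : Fin M) :
    ((crossGram (rangeVec n M) (cutVec u M)).conjTranspose *
      crossGram (rangeVec n M) (cutVec u M)) l k =
      ((∑ y ∈ Finset.range (M + n), powFact (-u) y l.rev * powFact (-u) y k.rev : ℝ) : ℂ) := by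
  rw [Matrix.mul_apply, Complex.ofReal_sum, ← Fin.sum_univ_eq_sum_range fun y =>
    ((powFact (-u) y l.rev * powFact (-u) y k.rev : ℝ) : ℂ), ← Equiv.sum_comp Fin.revPerm]
  refine Finset.sum_congr rfl fun r _ => ?_
  simp [crossGram_apply]

theorem tsum_tailWeight_eq (t v : ℝ) (i j : ℕ) :
    ∑' y, tailWeight M n t y * powFact v y i * powFact v y j =
      (1 - t) * ∑' y, powFact v y i * powFact v y j +
        t * ∑ y ∈ Finset.range (M + n), powFact v y i * powFact v y j := by
  have hsum : Summable fun y => powFact v y i * powFact v y j := by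
    simpa using summable_weight_mul_powFact v (w := 1) (by simp) i j
  have hhead := hasSum_sum_of_ne_finset_zero (L := .unconditional ℕ) (s := Finset.range (M + n))
    (f := fun y => if y < M + n then powFact v y i * powFact v y j else 0)
    fun y hy => if_neg (by simpa using hy)
  rw [Finset.sum_congr rfl fun y hy => if_pos (Finset.mem_range.1 hy)] at hhead
  refine HasSum.tsum_eq (((hsum.hasSum.mul_left (1 - t)).add (hhead.mul_left t)).congr_fun
    fun y => ?_)
  unfold tailWeight
  by_cases hy : M + n ≤ y
  · rw [if_pos hy, if_neg hy.not_gt]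
    ring
  · rw [if_neg hy, if_pos (not_le.1 hy)]
    ring

theorem det_gram_add_crossGram (t : ℝ) :
    ((1 - (t : ℂ)) • Matrix.gram ℂ (cutVec u M) + (t : ℂ) •
      ((crossGram (rangeVec n M) (cutVec u M)).conjTranspose *
        crossGram (rangeVec n M) (cutVec u M))).det =
      (weightedDet M (tailWeight M n t) (-u) : ℂ) := by
  have hmatrix : ((1 - (t : ℂ)) • Matrix.gram ℂ (cutVec u M) + (t : ℂ) •
      ((crossGram (rangeVec n M) (cutVec u M)).conjTranspose *
        crossGram (rangeVec n M) (cutVec u M))) =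
      (((Matrix.of fun i j : Fin M =>
        ∑' y, tailWeight M n t y * powFact (-u) y i * powFact (-u) y j).map
          Complex.ofRealHom).submatrix Fin.revPerm Fin.revPerm) := by
    ext l k
    simp only [Matrix.submatrix_apply, Matrix.map_apply, Matrix.of_apply, tsum_tailWeight_eq,
      Matrix.add_apply, Matrix.smul_apply, conjTranspose_crossGram_mul_apply, gram_cutVec_apply,
      Fin.revPerm_apply, smul_eq_mul, Complex.ofRealHom_eq_coe]
    push_cast
    rfl
  rw [hmatrix, Matrix.det_submatrix_equiv_self, ← RingHom.mapMatrix_apply, ← RingHom.map_det]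
  rfl

theorem hasFredholmDet_sqrt_smul_cutDiff {t : ℝ} (ht : 0 ≤ t) :
    HasFredholmDet ((Real.sqrt t : ℂ) • cutDiff u n M) ((1 + (Real.sqrt t : ℂ)) ^ n *
      ((weightedDet M (tailWeight M n t) (-u) /
        weightedDet M (tailWeight M n 0) (-u) : ℝ) : ℂ)) := by
  have hc : 1 + (Real.sqrt t : ℂ) ≠ 0 := by
    exact_mod_cast (show (0 : ℝ) < 1 + Real.sqrt t by positivity).ne'
  have hsq : (Real.sqrt t : ℂ) ^ 2 = t := by exact_mod_cast Real.sq_sqrt ht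
  have hzero := det_gram_add_crossGram u n M 0
  rw [Complex.ofReal_zero, sub_zero, one_smul, zero_smul, add_zero] at hzero
  have h := hasFredholmDet_smul_cutDiff u n M hc
  rwa [hsq, det_gram_add_crossGram, hzero, ← Complex.ofReal_div] at h

end CutDiff

/-! ### Integral operators with separated kernels -/

section IntegralOperator

variable {I : Type*} {X Y : I → C(Angle, ℂ)}

theorem summable_inner_toL2_smul (hs : Summable fun i => ‖X i‖ * ‖Y i‖) (f : L2Circle) :
    Summable fun i => inner ℂ (toL2 (Y i)) f • X i := by
  refine Summable.of_norm_bounded (hs.mul_left (‖toL2‖ * ‖f‖)) fun i => ?_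
  calc ‖inner ℂ (toL2 (Y i)) f • X i‖
      ≤ ‖toL2 (Y i)‖ * ‖f‖ * ‖X i‖ := by
        rw [norm_smul]
        gcongr
        exact norm_inner_le_norm _ _
    _ ≤ ‖toL2‖ * ‖Y i‖ * ‖f‖ * ‖X i‖ := by
        gcongr
        exact toL2.le_opNorm _
    _ = ‖toL2‖ * ‖f‖ * (‖X i‖ * ‖Y i‖) := by ring

theorem inner_toL2_mul (g : C(Angle, ℂ)) (f : L2Circle) (a : ℂ) :
    inner ℂ (toL2 g) f * a = ∫ η, a * (starRingEnd ℂ) (g η) * f η := by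
  rw [L2.inner_def, ← integral_mul_const]
  refine integral_congr_ae ?_
  filter_upwards [ContinuousMap.coeFn_toLp (p := 2) (𝕜 := ℂ) volume g] with η hη
  rw [hη, RCLike.inner_apply]
  ring

theorem norm_mul_conj_apply_le (g h : C(Angle, ℂ)) (θ η : Angle) :
    ‖g θ * (starRingEnd ℂ) (h η)‖ ≤ ‖g‖ * ‖h‖ := by
  rw [norm_mul, RCLike.norm_conj]
  gcongr
  exacts [g.norm_coe_le_norm θ, h.norm_coe_le_norm η]

theorem integrable_L2Circle (f : L2Circle) : Integrable f volume :=
  (Lp.memLp f).integrable one_le_two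

theorem integrable_mul_conj_mul (g h : C(Angle, ℂ)) (f : L2Circle) (θ : Angle) :
    Integrable (fun η => g θ * (starRingEnd ℂ) (h η) * f η) volume :=
  (integrable_L2Circle f).bdd_mul (c := ‖g‖ * ‖h‖)
    (Continuous.aestronglyMeasurable (by fun_prop))
    (ae_of_all _ fun η => norm_mul_conj_apply_le g h θ η)

theorem hasSum_integral_mul_conj_mul [Countable I] (hs : Summable fun i => ‖X i‖ * ‖Y i‖)
    (f : L2Circle) (θ : Angle) :
    HasSum (fun i => ∫ η, X i θ * (starRingEnd ℂ) (Y i η) * f η)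
      (∫ η, ∑' i, X i θ * (starRingEnd ℂ) (Y i η) * f η) := by
  have hint (i : I) := integrable_mul_conj_mul (X i) (Y i) f θ
  refine hasSum_integral_of_summable_integral_norm hint (Summable.of_nonneg_of_le
    (fun i => by positivity) (fun i => ?_) (hs.mul_right (∫ η, ‖f η‖)))
  rw [← integral_const_mul]
  refine integral_mono (hint i).norm ((integrable_L2Circle f).norm.const_mul _) fun η => ?_
  simp only [norm_mul (X i θ * _)]
  gcongr
  exact norm_mul_conj_apply_le _ _ _ _

theorem ae_ne_angle (θ : Angle) : ∀ᵐ η : Angle, η ≠ θ := by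
  have hnull : volume ({θ} : Set Angle) = 0 := by
    rw [← Metric.closedBall_zero, AddCircle.volume_closedBall]
    simp [Real.pi_pos.le]
  exact measure_eq_zero_iff_ae_notMem.1 hnull

theorem isIntegralOperator_of_hasSum [Countable I] {k : ℂ → ℂ → ℂ} {K : L2Circle →L[ℂ] L2Circle}
    (hs : Summable fun i => ‖X i‖ * ‖Y i‖)
    (hK : ∀ v, HasSum (fun i => inner ℂ (toL2 (Y i)) v • toL2 (X i)) (K v))
    (hk : ∀ θ η : Angle, θ ≠ η → HasSum (fun i => X i θ * (starRingEnd ℂ) (Y i η))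
      (k (pt θ) (pt η) * (Complex.I * pt η))) : IsIntegralOperator k K := by
  intro f
  have hsum := (summable_inner_toL2_smul hs f).hasSum
  set G : C(Angle, ℂ) := ∑' i, inner ℂ (toL2 (Y i)) f • X i
  have hKG : K f = toL2 G :=
    (hK f).unique ((hsum.mapL toL2).congr_fun fun i => (map_smul toL2 _ _).symm)
  rw [hKG]
  filter_upwards [ContinuousMap.coeFn_toLp (p := 2) (𝕜 := ℂ) volume G] with θ hθ
  have hG : HasSum (fun i => ∫ η, X i θ * (starRingEnd ℂ) (Y i η) * f η) (G θ) :=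
    (hsum.mapL (ContinuousMap.evalCLM ℂ θ)).congr_fun fun i => (inner_toL2_mul _ _ _).symm
  rw [hθ, hG.unique (hasSum_integral_mul_conj_mul hs f θ)]
  refine integral_congr_ae ?_
  filter_upwards [ae_ne_angle θ] with η hη
  rw [tsum_mul_right, (hk θ η hη.symm).tsum_eq]
  ring

end IntegralOperator

theorem fourier_eq_pt_zpow (k : ℤ) (θ : Angle) : fourier k θ = pt θ ^ k := by
  rw [fourier_apply, AddCircle.toCircle_zsmul, pt, Circle.coe_zpow]

theorem norm_pt (θ : Angle) : ‖pt θ‖ = 1 := Circle.norm_coe _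

theorem pt_ne_zero (θ : Angle) : pt θ ≠ 0 := Circle.coe_ne_zero _

theorem pt_injective : Function.Injective pt := fun _ _ h =>
  AddCircle.injective_toCircle Real.two_pi_pos.ne' (Subtype.ext h)

theorem conj_pt (θ : Angle) : (starRingEnd ℂ) (pt θ) = (pt θ)⁻¹ :=
  (Circle.coe_inv_eq_conj _).symm

theorem sum_antidiagonal_pow_mul_pow {K : Type*} [Field K] {x y : K} (hxy : x ≠ y) (m : ℕ) :
    ∑ p ∈ Finset.HasAntidiagonal.antidiagonal m, x ^ p.2 * y ^ p.1 =
      (x ^ (m + 1) - y ^ (m + 1)) / (x - y) := by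
  rw [eq_div_iff (sub_ne_zero.2 hxy), ← (Commute.all x y).geom_sum₂_mul,
    ← Finset.Nat.sum_antidiagonal_swap]
  simp only [Prod.fst_swap, Prod.snd_swap]
  rw [Finset.Nat.sum_antidiagonal_eq_sum_range_succ fun a b => x ^ a * y ^ b]
  simp only [Nat.add_sub_cancel]

theorem hasSum_expCoeff_mul_divided_pow (v : ℝ) (x y : ℂ) :
    HasSum (fun m => expCoeff v (m + 1) * ((x ^ (m + 1) - y ^ (m + 1)) / (x - y)))
      ((Complex.exp (v * x) - Complex.exp (v * y)) / (x - y)) := by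
  have h := ((hasSum_expCoeff_mul_pow v x).sub (hasSum_expCoeff_mul_pow v y)).div_const (x - y)
  rw [← hasSum_nat_add_iff' 1] at h
  simp only [Finset.range_one, Finset.sum_singleton, pow_zero, sub_self, zero_div, sub_zero] at h
  refine h.congr_fun fun m => ?_
  ring

theorem hasSum_expCoeff_mul_pow_mul_pow (v : ℝ) {x y : ℂ} (hx : ‖x‖ = 1) (hy : ‖y‖ = 1)
    (hxy : x ≠ y) :
    HasSum (fun p : ℕ × ℕ => expCoeff v (p.1 + p.2 + 1) * (x ^ p.2 * y ^ p.1))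
      ((Complex.exp (v * x) - Complex.exp (v * y)) / (x - y)) := by
  have hs : Summable fun p : ℕ × ℕ => expCoeff v (p.1 + p.2 + 1) * (x ^ p.2 * y ^ p.1) :=
    Summable.of_norm ((summable_norm_expCoeff_add v).congr fun p => by simp [hx, hy])
  have hfiber := (Finset.HasAntidiagonal.sigmaAntidiagonalEquivProd.hasSum_iff.2 hs.hasSum).sigma
    fun m => hasSum_fintype _
  rw [← hfiber.unique ((hasSum_expCoeff_mul_divided_pow v x y).congr_fun fun m => ?_)]
  · exact hs.hasSum
  · rw [← sum_antidiagonal_pow_mul_pow hxy, Finset.mul_sum,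
      ← Finset.sum_coe_sort (Finset.HasAntidiagonal.antidiagonal m)]
    refine Finset.sum_congr rfl fun p _ => ?_
    have hp : p.1.1 + p.1.2 = m := Finset.HasAntidiagonal.mem_antidiagonal.1 p.2
    simp [Finset.HasAntidiagonal.sigmaAntidiagonalEquivProd, hp]

/-! ### The limiting operator and its Fredholm determinant -/

/-- The orthogonal projection onto the closed span of `z^j`, `j ≥ 0`. -/
abbrev posProj : L2Circle →L[ℂ] L2Circle := fullProj 0

theorem mulOp_fexp_zero (σ : ℤ) (f : L2Circle) : mulOp (fexp σ 0) f = f := by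
  have hone : fexp σ 0 = 1 := by
    ext θ
    simp [fexp_apply]
  rw [hone, mulOp_one]

theorem posProj_natCast (j : ℕ) : posProj (fBasis j) = fBasis j := by
  have h := (isCut_fullProj 0).fix j (Set.mem_univ j)
  rwa [psiOp, neg_zero, mulOp_fexp_zero] at h

theorem posProj_negSucc (j : ℕ) : posProj (fBasis (-1 - j)) = 0 := by
  have h := (isCut_fullProj 0).kill j
  rwa [chiOp, mulOp_fexp_zero] at h

/-- The projection onto the closed span of `exp (-u / z) z^j`, `j ≥ 0`, minus the projection onto
the closed span of `z^k`, `k ≥ -n`. For `u = √lam` this is the operator of the theorem. -/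
def fullDiff (u : ℝ) (n : ℕ) : L2Circle →L[ℂ] L2Circle :=
  fullProj u - (posProj + ∑ r : Fin n, InnerProductSpace.rankOne ℂ
    (fBasis (-1 - (r : ℕ))) (fBasis (-1 - (r : ℕ))))

theorem posProj_add_sum_rankOne_fBasis (n : ℕ) (k : ℤ) :
    (posProj + ∑ r : Fin n, InnerProductSpace.rankOne ℂ
      (fBasis (-1 - (r : ℕ))) (fBasis (-1 - (r : ℕ)))) (fBasis k) =
      if -(n : ℤ) ≤ k then fBasis k else 0 := by
  simp only [add_apply, sum_apply, InnerProductSpace.rankOne_apply, inner_fBasis]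
  rcases lt_or_ge k 0 with hk | hk
  · obtain ⟨j, rfl⟩ : ∃ j : ℕ, k = -1 - j := ⟨(-1 - k).toNat, by omega⟩
    rw [posProj_negSucc, zero_add]
    split_ifs with hj
    · rw [Finset.sum_eq_single_of_mem ⟨j, by omega⟩ (Finset.mem_univ _) fun r _ hr => ?_,
        if_pos rfl, one_smul]
      rw [if_neg fun h => hr (Fin.ext (by simp only; omega)), zero_smul]
    · refine Finset.sum_eq_zero fun r _ => ?_
      rw [if_neg (by omega), zero_smul]
  · obtain ⟨j, rfl⟩ := Int.eq_ofNat_of_zero_le hk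
    rw [posProj_natCast, if_pos (by omega), Finset.sum_eq_zero fun r _ => ?_, add_zero]
    rw [if_neg (by omega), zero_smul]

theorem isNuclearExpansion_fullDiff (u : ℝ) (n : ℕ) :
    IsNuclearExpansion (fullDiff u n) (nucLeft u n (fullProj u)) (nucRight u n Set.univ) :=
  (isCut_fullProj u).isNuclearExpansion_sub fun k => by
    simpa using posProj_add_sum_rankOne_fBasis n k

theorem fredholmDet_sqrt_smul_fullDiff (u : ℝ) (n : ℕ) {t : ℝ} (ht₀ : 0 ≤ t)
    (ht : |1 - t| ≤ 1) :
    fredholmDet ((Real.sqrt t : ℂ) • fullDiff u n) =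
      (1 + (Real.sqrt t : ℂ)) ^ n * (poissonGen n (u ^ 2) t : ℂ) := by
  rw [((isNuclearExpansion_fullDiff u n).hasFredholmDet_smul _).fredholmDet_eq fBasis]
  refine tendsto_nhds_unique (tendsto_minorSum_cut u n (Real.sqrt t : ℂ)) ?_
  have hratio := tendsto_weightedDet_ratio (n := n) ht (-u)
  rw [neg_sq] at hratio
  refine (((Complex.continuous_ofReal.tendsto _).comp hratio).const_mul
    ((1 + (Real.sqrt t : ℂ)) ^ n)).congr fun M => ?_
  exact (hasFredholmDet_sqrt_smul_cutDiff u n M ht₀).unique fBasis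
    ((isNuclearExpansion_cutDiff u n M).hasFredholmDet_smul _)

theorem zpow_neg_mul_fredholmDet_fullDiff (u : ℝ) (n : ℕ) {t : ℝ} (ht₀ : 0 ≤ t)
    (ht : |1 - t| ≤ 1) :
    (1 + (Real.sqrt t : ℂ)) ^ (-(n : ℤ)) * fredholmDet ((Real.sqrt t : ℂ) • fullDiff u n) =
      (poissonGen n (u ^ 2) t : ℂ) := by
  have hc : 1 + (Real.sqrt t : ℂ) ≠ 0 := by
    exact_mod_cast (show (0 : ℝ) < 1 + Real.sqrt t by positivity).ne'
  rw [fredholmDet_sqrt_smul_fullDiff u n ht₀ ht, zpow_neg, zpow_natCast,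
    inv_mul_cancel_left₀ (pow_ne_zero n hc)]

theorem hasDerivAt_zpow_neg_mul_fredholmDet_fullDiff (u : ℝ) (n : ℕ) :
    HasDerivAt (fun t : ℝ => (1 + (Real.sqrt t : ℂ)) ^ (-(n : ℤ)) *
        fredholmDet ((Real.sqrt t : ℂ) • fullDiff u n))
      ((-(poissonRow 2 (n + 1) (u ^ 2) - poissonRow 1 n (u ^ 2)) : ℝ) : ℂ) 1 := by
  refine (hasDerivAt_poissonGen n (sq_nonneg u)).ofReal_comp.congr_of_eventuallyEq ?_
  filter_upwards [Ioo_mem_nhds (zero_lt_one (α := ℝ)) one_lt_two] with t ht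
  exact zpow_neg_mul_fredholmDet_fullDiff u n ht.1.le
    (abs_le.2 ⟨by linarith [ht.2], by linarith [ht.1]⟩)

/-! ### The limiting operator as an integral operator -/

/-- The symbol `exp (u (z - 1/z))` as a function on the circle. -/
def phi (u : ℝ) : C(Angle, ℂ) := fexp 1 u * fexp (-1) (-u)

theorem phi_apply (u : ℝ) (θ : Angle) :
    phi u θ = Complex.exp (u * pt θ) * Complex.exp ((-u : ℝ) * (pt θ)⁻¹) := by
  rw [phi, ContinuousMap.mul_apply, fexp_apply, fexp_apply, fourier_eq_pt_zpow,
    fourier_eq_pt_zpow, zpow_one, zpow_neg_one]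

theorem symbolFn_pt (lam : ℝ) (θ : Angle) : symbolFn lam (pt θ) = phi (Real.sqrt lam) θ := by
  rw [phi_apply, symbolFn, ← Complex.exp_add]
  push_cast
  ring_nf

theorem phi_mul_star_phi (u : ℝ) : phi u * star (phi u) = 1 := by
  have hinv := fexp_mul_fexp_neg (-1) (-u)
  rw [neg_neg] at hinv
  rw [phi, star_mul, star_fexp, star_fexp, neg_neg, mul_mul_mul_comm, fexp_mul_fexp_neg, hinv,
    mul_one]

theorem conj_phi (u : ℝ) (η : Angle) : (starRingEnd ℂ) (phi u η) = (phi u η)⁻¹ :=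
  eq_inv_of_mul_eq_one_right (DFunLike.congr_fun (phi_mul_star_phi u) η)

theorem mulOp_phi (u : ℝ) (x : L2Circle) : mulOp (phi u) x = chiOp u (psiOp u x) :=
  (mulOp_mulOp _ _ _).symm

theorem fullProj_mulOp_phi_natCast (u : ℝ) (j : ℕ) :
    fullProj u (mulOp (phi u) (fBasis j)) = mulOp (phi u) (fBasis j) := by
  have h := (hasSum_mulOp_fexp 1 u j).mapL (psiOp u)
  rw [mulOp_mulOp, mul_comm (fexp (-1) (-u)), ← phi] at h
  refine (h.mapL (fullProj u)).unique (h.congr_fun fun m => ?_)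
  rw [map_smul, map_smul, show (j : ℤ) + m * 1 = ((j + m : ℕ) : ℤ) by push_cast; ring,
    (isCut_fullProj u).fix _ trivial]

theorem fullProj_mulOp_phi_negSucc (u : ℝ) (j : ℕ) :
    fullProj u (mulOp (phi u) (fBasis (-1 - j))) = 0 := by
  have h := ((hasSum_mulOp_fexp (-1) (-u) (-1 - j)).mapL (chiOp u)).mapL (fullProj u)
  rw [mulOp_phi]
  refine h.unique (hasSum_zero.congr_fun fun m => ?_)
  rw [map_smul, map_smul, show (-1 - (j : ℤ)) + m * -1 = -1 - ((j + m : ℕ) : ℤ) by push_cast; ring,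
    (isCut_fullProj u).kill, smul_zero]

theorem posProj_chiOp_natCast (u : ℝ) (j : ℕ) :
    posProj (chiOp u (fBasis j)) = chiOp u (fBasis j) := by
  have h := hasSum_mulOp_fexp 1 u j
  refine (h.mapL posProj).unique (h.congr_fun fun m => ?_)
  rw [map_smul, show (j : ℤ) + m * 1 = ((j + m : ℕ) : ℤ) by push_cast; ring, posProj_natCast]

theorem posProj_psiOp_negSucc (u : ℝ) (j : ℕ) : posProj (psiOp u (fBasis (-1 - j))) = 0 := by
  have h := (hasSum_mulOp_fexp (-1) (-u) (-1 - j)).mapL posProj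
  refine h.unique (hasSum_zero.congr_fun fun m => ?_)
  rw [map_smul, show (-1 - (j : ℤ)) + m * -1 = -1 - ((j + m : ℕ) : ℤ) by push_cast; ring,
    posProj_negSucc, smul_zero]

theorem hasSum_sub_posProj_psiOp (u : ℝ) (j : ℕ) :
    HasSum (fun l : ℕ => expCoeff (-u) (j + l + 1) • fBasis (-1 - l))
      (psiOp u (fBasis j) - posProj (psiOp u (fBasis j))) := by
  have hpsi := hasSum_mulOp_fexp (-1) (-u) j
  refine (hasSum_nat_add_of_zero j (fun m hm => ?_)
    (hpsi.sub (hpsi.mapL posProj))).congr_fun fun l => ?_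
  · rw [map_smul, show (j : ℤ) + m * -1 = ((j - m : ℕ) : ℤ) by omega, posProj_natCast, sub_self]
  · rw [map_smul, show (j : ℤ) + (j + l + 1 : ℕ) * -1 = -1 - l by push_cast; ring,
      posProj_negSucc, smul_zero, sub_zero]

theorem hasSum_posProj_chiOp (u : ℝ) (j : ℕ) :
    HasSum (fun l : ℕ => expCoeff u (j + l + 1) • fBasis l)
      (posProj (chiOp u (fBasis (-1 - j)))) := by
  refine (hasSum_nat_add_of_zero j (fun m hm => ?_)
    ((hasSum_mulOp_fexp 1 u (-1 - j)).mapL posProj)).congr_fun fun l => ?_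
  · rw [map_smul, show (-1 - (j : ℤ)) + m * 1 = -1 - ((j - m : ℕ) : ℤ) by omega, posProj_negSucc,
      smul_zero]
  · rw [map_smul, show (-1 - (j : ℤ)) + (j + l + 1 : ℕ) * 1 = l by push_cast; ring,
      posProj_natCast]

theorem isNuclearExpansion_of_hankel {T : L2Circle →L[ℂ] L2Circle} {v C : ℝ} {X : ℕ → L2Circle}
    {e : ℕ → ℤ} (he : Function.Injective e) (hX : ∀ l, ‖X l‖ ≤ C)
    (hT : ∀ j, HasSum (fun l => expCoeff v (j + l + 1) • X l) (T (fBasis (e j))))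
    (hT₀ : ∀ k ∉ Set.range e, T (fBasis k) = 0) :
    IsNuclearExpansion T (fun p : ℕ × ℕ => X p.2)
      (fun p => expCoeff v (p.1 + p.2 + 1) • fBasis (e p.1)) := by
  have hinner (p : ℕ × ℕ) (k : ℤ) :
      inner ℂ (expCoeff v (p.1 + p.2 + 1) • fBasis (e p.1)) (fBasis k) =
        if e p.1 = k then expCoeff v (p.1 + p.2 + 1) else 0 := by
    rw [inner_smul_left, inner_fBasis, conj_expCoeff, mul_ite, mul_one, mul_zero]
  refine .of_hilbertBasis fBasis ?_ fun k => ?_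
  · refine Summable.of_nonneg_of_le (fun _ => by positivity) (fun p => ?_)
      ((summable_norm_expCoeff_add v).mul_left C)
    rw [norm_smul, norm_fBasis, mul_one]
    gcongr
    exact hX _
  · simp only [hinner]
    by_cases hk : k ∈ Set.range e
    · obtain ⟨j, rfl⟩ := hk
      refine hasSum_prod_of_fst_eq j (fun i l hi => ?_) ((hT j).congr_fun fun l => ?_)
      · rw [if_neg (he.ne hi), zero_smul]
      · rw [if_pos rfl]
    · rw [hT₀ k hk]
      refine hasSum_zero.congr_fun fun p => ?_
      rw [if_neg fun h => hk ⟨p.1, h⟩, zero_smul]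

theorem IsNuclearExpansion.hasSum_of_comp_mulOp {I : Type*} {T : L2Circle →L[ℂ] L2Circle}
    {x y : I → L2Circle} {g h : C(Angle, ℂ)} (hT : IsNuclearExpansion (T.comp (mulOp g)) x y)
    (hgh : g * star h = 1) (v : L2Circle) :
    HasSum (fun i => inner ℂ (mulOp h (y i)) v • x i) (T v) := by
  have hsum := hT.hasSum (mulOp (star h) v)
  rw [ContinuousLinearMap.comp_apply, mulOp_mulOp, hgh, mulOp_one] at hsum
  refine hsum.congr_fun fun i => ?_
  rw [inner_mulOp_left]

/-- Conjugation of `posProj` by multiplication by `exp (u z)`. -/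
def midProj (u : ℝ) : L2Circle →L[ℂ] L2Circle :=
  (chiOp u).comp (posProj.comp (mulOp (fexp 1 (-u))))

theorem midProj_chiOp (u : ℝ) (x : L2Circle) : midProj u (chiOp u x) = chiOp u (posProj x) := by
  rw [midProj, ContinuousLinearMap.comp_apply, ContinuousLinearMap.comp_apply,
    mulOp_fexp_neg_mulOp_fexp]

theorem hasSum_fullProj_sub_midProj (u : ℝ) (v : L2Circle) :
    HasSum (fun p : ℕ × ℕ => inner ℂ
        (mulOp (phi u) (expCoeff (-u) (p.1 + p.2 + 1) • fBasis p.1)) v •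
          chiOp u (fBasis (-1 - p.2)))
      ((fullProj u - midProj u) v) := by
  refine (isNuclearExpansion_of_hankel (C := ‖chiOp u‖) (e := fun j => (j : ℤ))
    (X := fun l => chiOp u (fBasis (-1 - l))) Nat.cast_injective (fun l => ?_) (fun j => ?_)
    fun k hk => ?_).hasSum_of_comp_mulOp (phi_mul_star_phi u) v
  · simpa [norm_fBasis] using (chiOp u).le_opNorm (fBasis (-1 - l))
  · rw [ContinuousLinearMap.comp_apply, sub_apply, fullProj_mulOp_phi_natCast, mulOp_phi,
      midProj_chiOp, ← map_sub]
    refine ((hasSum_sub_posProj_psiOp u j).mapL (chiOp u)).congr_fun fun l => ?_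
    rw [map_smul]
  · have hneg : ¬ 0 ≤ k := fun h => hk ⟨k.toNat, Int.toNat_of_nonneg h⟩
    obtain ⟨j, rfl⟩ : ∃ j : ℕ, k = -1 - j := ⟨(-1 - k).toNat, by omega⟩
    rw [ContinuousLinearMap.comp_apply, sub_apply, fullProj_mulOp_phi_negSucc, mulOp_phi,
      midProj_chiOp, posProj_psiOp_negSucc, map_zero, sub_zero]

theorem hasSum_midProj_sub_posProj (u : ℝ) (v : L2Circle) :
    HasSum (fun p : ℕ × ℕ => inner ℂ
        (psiOp u (expCoeff u (p.1 + p.2 + 1) • fBasis (-1 - p.1))) v • -fBasis p.2)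
      ((midProj u - posProj) v) := by
  have hinv : fexp 1 u * star (fexp (-1) (-u)) = 1 := by
    rw [star_fexp, neg_neg, fexp_mul_fexp_neg]
  refine (isNuclearExpansion_of_hankel (C := 1) (e := fun j => -1 - (j : ℤ))
    (X := fun l => -fBasis (l : ℤ)) (fun i j h => by simpa using h) (fun l => ?_) (fun j => ?_)
    fun k hk => ?_).hasSum_of_comp_mulOp hinv v
  · rw [norm_neg, norm_fBasis]
  · rw [ContinuousLinearMap.comp_apply, sub_apply, midProj_chiOp, posProj_negSucc, map_zero,
      zero_sub]
    refine (hasSum_posProj_chiOp u j).neg.congr_fun fun l => ?_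
    rw [smul_neg]
  · have hneg : ¬ k < 0 := fun h => hk ⟨(-1 - k).toNat, by simp only; omega⟩
    obtain ⟨j, rfl⟩ := Int.eq_ofNat_of_zero_le (not_lt.1 hneg)
    rw [ContinuousLinearMap.comp_apply, sub_apply, midProj_chiOp, posProj_natCast,
      posProj_chiOp_natCast, sub_self]

/-- The left functions of the separated expansion of the kernel. -/
def kerLeft (u : ℝ) (n : ℕ) : NucIndex n → C(Angle, ℂ)
  | Sum.inl (_, l) => fexp 1 u * monomial (-1 - l)
  | Sum.inr (Sum.inl (_, l)) => -monomial l
  | Sum.inr (Sum.inr r) => -monomial (-1 - (r : ℕ))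

/-- The right functions of the separated expansion of the kernel. -/
def kerRight (u : ℝ) (n : ℕ) : NucIndex n → C(Angle, ℂ)
  | Sum.inl (j, l) => expCoeff (-u) (j + l + 1) • (phi u * monomial j)
  | Sum.inr (Sum.inl (j, l)) => expCoeff u (j + l + 1) • (fexp (-1) (-u) * monomial (-1 - j))
  | Sum.inr (Sum.inr r) => monomial (-1 - (r : ℕ))

theorem norm_monomial (k : ℤ) : ‖monomial k‖ = (Real.sqrt (2 * Real.pi))⁻¹ := by
  rw [monomial, norm_smul, fourier_norm, mul_one, norm_inv, Complex.norm_real, Real.norm_eq_abs,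
    abs_of_nonneg (Real.sqrt_nonneg _)]

theorem norm_mul_monomial_le (g : C(Angle, ℂ)) (k : ℤ) :
    ‖g * monomial k‖ ≤ ‖g‖ * (Real.sqrt (2 * Real.pi))⁻¹ := by
  rw [← norm_monomial k]
  exact norm_mul_le _ _

theorem summable_of_norm_le_expCoeff {X Y : ℕ × ℕ → C(Angle, ℂ)} {v A B : ℝ}
    (hX : ∀ p, ‖X p‖ ≤ A) (hY : ∀ p, ‖Y p‖ ≤ B) :
    Summable fun p => ‖X p‖ * ‖expCoeff v (p.1 + p.2 + 1) • Y p‖ := by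
  refine Summable.of_nonneg_of_le (fun _ => by positivity) (fun p => ?_)
    ((summable_norm_expCoeff_add v).mul_left (A * B))
  have hA : 0 ≤ A := (norm_nonneg _).trans (hX p)
  calc ‖X p‖ * ‖expCoeff v (p.1 + p.2 + 1) • Y p‖
      = ‖X p‖ * ‖Y p‖ * ‖expCoeff v (p.1 + p.2 + 1)‖ := by rw [norm_smul]; ring
    _ ≤ A * B * ‖expCoeff v (p.1 + p.2 + 1)‖ := by
        gcongr
        exacts [hX p, hY p]

theorem summable_ker (u : ℝ) (n : ℕ) : Summable fun i => ‖kerLeft u n i‖ * ‖kerRight u n i‖ :=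
  Summable.sum _
    (summable_of_norm_le_expCoeff (fun _ => norm_mul_monomial_le _ _)
      fun _ => norm_mul_monomial_le _ _)
    (Summable.sum _
      (summable_of_norm_le_expCoeff (fun _ => ((norm_neg _).trans (norm_monomial _)).le)
        fun _ => norm_mul_monomial_le _ _)
      Summable.of_finite)

theorem hasSum_ker_apply (u : ℝ) (n : ℕ) (v : L2Circle) :
    HasSum (fun i => inner ℂ (toL2 (kerRight u n i)) v • toL2 (kerLeft u n i))
      (fullDiff u n v) := by
  have hfin := hasSum_fintype fun r : Fin n =>
    inner ℂ (fBasis (-1 - (r : ℕ))) v • -fBasis (-1 - (r : ℕ))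
  have h := HasSum.sum (f := fun i => inner ℂ (toL2 (kerRight u n i)) v • toL2 (kerLeft u n i))
    ((hasSum_fullProj_sub_midProj u v).congr_fun fun p => ?_)
    (HasSum.sum ((hasSum_midProj_sub_posProj u v).congr_fun fun p => ?_)
      (hfin.congr_fun fun r => ?_))
  · convert h using 1
    simp only [fullDiff, sub_apply, add_apply, sum_apply, InnerProductSpace.rankOne_apply, smul_neg,
      Finset.sum_neg_distrib]
    abel
  all_goals simp only [Function.comp_apply, kerLeft, kerRight, map_smul, map_neg, fBasis_apply,
    mulOp_toL2]

theorem conj_fexp (σ : ℤ) (v : ℝ) (η : Angle) :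
    (starRingEnd ℂ) (fexp σ v η) = Complex.exp (v * pt η ^ (-σ)) := by
  rw [← fourier_eq_pt_zpow, ← fexp_apply, ← star_fexp]
  rfl

theorem monomial_apply (k : ℤ) (θ : Angle) :
    monomial k θ = ((Real.sqrt (2 * Real.pi))⁻¹ : ℂ) * pt θ ^ k := by
  rw [monomial, ContinuousMap.smul_apply, fourier_eq_pt_zpow, smul_eq_mul]

theorem monomial_mul_conj_monomial (j k : ℤ) (θ η : Angle) :
    monomial j θ * (starRingEnd ℂ) (monomial k η) =
      (2 * Real.pi : ℂ)⁻¹ * (pt θ ^ j * pt η ^ (-k)) := by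
  rw [← eq_inv_of_mul_eq_one_left sqrt_two_pi_inv_mul_self, monomial_apply, monomial_apply, map_mul,
    map_inv₀, Complex.conj_ofReal, map_zpow₀, conj_pt, inv_zpow', zpow_neg]
  ring

theorem sum_div_pow_succ {K : Type*} [Field K] {z w : K} (hz : z ≠ 0) (hzw : z ≠ w) (n : ℕ) :
    ∑ r ∈ Finset.range n, (w / z) ^ (r + 1) = w * ((w / z) ^ n - 1) / (w - z) := by
  have hratio : w / z ≠ 1 := fun h => hzw ((div_eq_one_iff_eq hz).1 h).symm
  have hdiff : w - z ≠ 0 := sub_ne_zero.2 hzw.symm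
  have hsub : w / z - 1 = (w - z) / z := by field_simp
  simp_rw [pow_succ]
  rw [← Finset.sum_mul, geom_sum_eq hratio, hsub]
  field_simp

section Pointwise

variable (u : ℝ) (n : ℕ) {θ η : Angle}

theorem hasSum_ker_pointwise_inl (hne : θ ≠ η) :
    HasSum (fun p : ℕ × ℕ => kerLeft u n (Sum.inl p) θ *
        (starRingEnd ℂ) (kerRight u n (Sum.inl p) η))
      ((2 * Real.pi : ℂ)⁻¹ * (pt η / (pt η - pt θ)) *
        (phi u θ * (phi u η)⁻¹ - Complex.exp (u * (pt θ - pt η)))) := by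
  have hz := pt_ne_zero θ
  have hw := pt_ne_zero η
  have hzw : pt θ ≠ pt η := pt_injective.ne hne
  have h := (hasSum_expCoeff_mul_pow_mul_pow (-u) (x := (pt θ)⁻¹) (y := (pt η)⁻¹)
    (by rw [norm_inv, norm_pt, inv_one]) (by rw [norm_inv, norm_pt, inv_one])
    (inv_injective.ne hzw)).mul_left
      ((2 * Real.pi : ℂ)⁻¹ * (Complex.exp (u * pt θ) * (pt θ)⁻¹ * (phi u η)⁻¹))
  have hinv : (pt θ)⁻¹ - (pt η)⁻¹ = (pt η - pt θ) / (pt θ * pt η) := by field_simp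
  have hexp : Complex.exp (u * (pt θ - pt η)) = Complex.exp (u * pt θ) *
      Complex.exp ((-u : ℝ) * (pt η)⁻¹) * (phi u η)⁻¹ := by
    rw [phi_apply, mul_sub, Complex.exp_sub]
    field_simp
  have hvalue : (2 * Real.pi : ℂ)⁻¹ * (pt η / (pt η - pt θ)) *
        (phi u θ * (phi u η)⁻¹ - Complex.exp (u * (pt θ - pt η))) =
      (2 * Real.pi : ℂ)⁻¹ * (Complex.exp (u * pt θ) * (pt θ)⁻¹ * (phi u η)⁻¹) *
        ((Complex.exp ((-u : ℝ) * (pt θ)⁻¹) - Complex.exp ((-u : ℝ) * (pt η)⁻¹)) /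
          ((pt θ)⁻¹ - (pt η)⁻¹)) := by
    rw [hinv, hexp, phi_apply u θ]
    field_simp
  rw [hvalue]
  refine h.congr_fun fun p => ?_
  calc _ = Complex.exp (u * pt θ) * expCoeff (-u) (p.1 + p.2 + 1) * (phi u η)⁻¹ *
          (monomial (-1 - p.2) θ * (starRingEnd ℂ) (monomial p.1 η)) := by
        simp only [kerLeft, kerRight, ContinuousMap.mul_apply, ContinuousMap.smul_apply,
          smul_eq_mul, map_mul, conj_phi, conj_expCoeff, fexp_apply, fourier_eq_pt_zpow, zpow_one]
        ring
    _ = _ := by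
        rw [monomial_mul_conj_monomial, zpow_sub₀ hz, zpow_neg_one, zpow_natCast,
          zpow_neg, zpow_natCast, inv_pow, inv_pow]
        ring

theorem hasSum_ker_pointwise_inr_inl (hne : θ ≠ η) :
    HasSum (fun p : ℕ × ℕ => kerLeft u n (Sum.inr (Sum.inl p)) θ *
        (starRingEnd ℂ) (kerRight u n (Sum.inr (Sum.inl p)) η))
      ((2 * Real.pi : ℂ)⁻¹ * (pt η / (pt η - pt θ)) *
        (Complex.exp (u * (pt θ - pt η)) - 1)) := by
  have hzw : pt θ ≠ pt η := pt_injective.ne hne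
  have h := (hasSum_expCoeff_mul_pow_mul_pow u (norm_pt θ) (norm_pt η) hzw).mul_left
    (-((2 * Real.pi : ℂ)⁻¹ * (Complex.exp ((-u : ℝ) * pt η) * pt η)))
  have hdiff : pt θ - pt η ≠ 0 := sub_ne_zero.2 hzw
  have hneg : pt η - pt θ = -(pt θ - pt η) := by ring
  have hvalue : (2 * Real.pi : ℂ)⁻¹ * (pt η / (pt η - pt θ)) *
        (Complex.exp (u * (pt θ - pt η)) - 1) =
      -((2 * Real.pi : ℂ)⁻¹ * (Complex.exp ((-u : ℝ) * pt η) * pt η)) *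
        ((Complex.exp (u * pt θ) - Complex.exp (u * pt η)) / (pt θ - pt η)) := by
    rw [hneg, mul_sub (u : ℂ), Complex.exp_sub, Complex.ofReal_neg, neg_mul (u : ℂ),
      Complex.exp_neg]
    field_simp
  rw [hvalue]
  refine h.congr_fun fun p => ?_
  calc _ = -(expCoeff u (p.1 + p.2 + 1) * Complex.exp ((-u : ℝ) * pt η) *
          (monomial p.2 θ * (starRingEnd ℂ) (monomial (-1 - p.1) η))) := by
        simp only [kerLeft, kerRight, ContinuousMap.mul_apply, ContinuousMap.smul_apply,
          ContinuousMap.neg_apply, smul_eq_mul, map_mul, conj_expCoeff, conj_fexp, neg_neg,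
          zpow_one]
        ring
    _ = _ := by
        rw [monomial_mul_conj_monomial, neg_sub, sub_neg_eq_add, zpow_add₀ (pt_ne_zero η),
          zpow_natCast, zpow_natCast, zpow_one]
        ring

theorem hasSum_ker_pointwise_inr_inr (hne : θ ≠ η) :
    HasSum (fun r : Fin n => kerLeft u n (Sum.inr (Sum.inr r)) θ *
        (starRingEnd ℂ) (kerRight u n (Sum.inr (Sum.inr r)) η))
      ((2 * Real.pi : ℂ)⁻¹ * (pt η / (pt η - pt θ)) * (1 - (pt η / pt θ) ^ n)) := by
  have hz := pt_ne_zero θ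
  have hterm (r : Fin n) : kerLeft u n (Sum.inr (Sum.inr r)) θ *
      (starRingEnd ℂ) (kerRight u n (Sum.inr (Sum.inr r)) η) =
        -((2 * Real.pi : ℂ)⁻¹ * (pt η / pt θ) ^ ((r : ℕ) + 1)) := by
    simp only [kerLeft, kerRight, ContinuousMap.neg_apply, neg_mul, monomial_mul_conj_monomial]
    rw [neg_sub, sub_neg_eq_add, zpow_add₀ (pt_ne_zero η), zpow_sub₀ hz, zpow_natCast,
      zpow_natCast, zpow_one, zpow_neg_one, div_pow]
    ring
  have h := hasSum_fintype fun r : Fin n => -((2 * Real.pi : ℂ)⁻¹ * (pt η / pt θ) ^ ((r : ℕ) + 1))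
  convert h.congr_fun hterm using 1
  rw [Finset.sum_neg_distrib, ← Finset.mul_sum,
    Fin.sum_univ_eq_sum_range (fun r => (pt η / pt θ) ^ (r + 1)),
    sum_div_pow_succ hz (pt_injective.ne hne)]
  ring

end Pointwise

theorem kernel_mul_I_mul_pt (lam : ℝ) (n : ℕ) {θ η : Angle} (hne : θ ≠ η) :
    kernel lam n (pt θ) (pt η) * (Complex.I * pt η) =
      (2 * Real.pi : ℂ)⁻¹ * (pt η / (pt η - pt θ)) *
        (phi (Real.sqrt lam) θ * (phi (Real.sqrt lam) η)⁻¹ - (pt η / pt θ) ^ n) := by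
  have hdiff : pt θ - pt η ≠ 0 := sub_ne_zero.2 (pt_injective.ne hne)
  have hneg : pt η - pt θ = -(pt θ - pt η) := by ring
  rw [kernel, symbolFn_pt, symbolFn_pt, zpow_neg, zpow_natCast, div_pow, hneg]
  field_simp
  ring

theorem hasSum_ker_pointwise (lam : ℝ) (n : ℕ) {θ η : Angle} (hne : θ ≠ η) :
    HasSum (fun i => kerLeft (Real.sqrt lam) n i θ *
        (starRingEnd ℂ) (kerRight (Real.sqrt lam) n i η))
      (kernel lam n (pt θ) (pt η) * (Complex.I * pt η)) := by
  have h := (hasSum_ker_pointwise_inl (Real.sqrt lam) n hne).sum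
    (f := fun i => kerLeft (Real.sqrt lam) n i θ *
      (starRingEnd ℂ) (kerRight (Real.sqrt lam) n i η))
    (HasSum.sum (hasSum_ker_pointwise_inr_inl (Real.sqrt lam) n hne)
      (hasSum_ker_pointwise_inr_inr (Real.sqrt lam) n hne))
  convert h using 1
  rw [kernel_mul_I_mul_pt lam n hne]
  ring

theorem isIntegralOperator_fullDiff (lam : ℝ) (n : ℕ) :
    IsIntegralOperator (kernel lam n) (fullDiff (Real.sqrt lam) n) :=
  isIntegralOperator_of_hasSum (summable_ker _ n) (hasSum_ker_apply _ n)
    fun _ _ hne => hasSum_ker_pointwise lam n hne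

end PlancherelRows

end

theorem theorem1 (n : ℕ) (lam : ℝ) (hlam : 0 ≤ lam) :
    ∃ K : PlancherelRows.L2Circle →L[ℂ] PlancherelRows.L2Circle,
      PlancherelRows.IsIntegralOperator (PlancherelRows.kernel lam n) K ∧
      PlancherelRows.IsTraceClass K ∧
      (∀ c : ℂ, PlancherelRows.HasFredholmDet (c • K) (PlancherelRows.fredholmDet (c • K))) ∧
      (PlancherelRows.poissonRow 1 n lam : ℂ) =
        (2 : ℂ) ^ (-(n : ℤ)) * PlancherelRows.fredholmDet K ∧
      DifferentiableAt ℝ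
        (fun t : ℝ => (1 + (Real.sqrt t : ℂ)) ^ (-(n : ℤ)) *
          PlancherelRows.fredholmDet ((Real.sqrt t : ℂ) • K)) 1 ∧
      (PlancherelRows.poissonRow 2 (n + 1) lam : ℂ) =
        (PlancherelRows.poissonRow 1 n lam : ℂ) +
          -deriv (fun t : ℝ => (1 + (Real.sqrt t : ℂ)) ^ (-(n : ℤ)) *
            PlancherelRows.fredholmDet ((Real.sqrt t : ℂ) • K)) 1 := by
  have hsq : Real.sqrt lam ^ 2 = lam := Real.sq_sqrt hlam
  have hexpansion := PlancherelRows.isNuclearExpansion_fullDiff (Real.sqrt lam) n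
  have hvalue := PlancherelRows.zpow_neg_mul_fredholmDet_fullDiff (Real.sqrt lam) n
    zero_le_one (by simp)
  have hderiv := PlancherelRows.hasDerivAt_zpow_neg_mul_fredholmDet_fullDiff (Real.sqrt lam) n
  rw [hsq] at hvalue hderiv
  refine ⟨PlancherelRows.fullDiff (Real.sqrt lam) n,
    PlancherelRows.isIntegralOperator_fullDiff lam n, hexpansion.isTraceClass,
    fun c => (hexpansion.hasFredholmDet_smul c).hasFredholmDet_fredholmDet, ?_,
    hderiv.differentiableAt, ?_⟩
  · rw [PlancherelRows.poissonRow_one_eq_poissonGen, ← hvalue, Real.sqrt_one, Complex.ofReal_one,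
      one_smul, one_add_one_eq_two]
  · rw [hderiv.deriv]
    push_cast
    ring
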